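/- Let $F$ be a field of prime characteristic $p$ and write $F\mathfrak S_n$ for the group algebra of the symmetric group on $\{1,\dots,n\}$, permutations being composed from left to right; modules are right modules. **Notation.** For a composition $q=(q_1,\dots,q_k)$ of $n$ put $q_j^+=q_1+\cdots+q_j$, let $\lambda(q)$ be the partition obtained by rearranging the parts of $q$, and write $(q,p)=1$ if $p$ divides no $q_j$. A partition is $p$-regular if no part occurs $p$ or more times; $\Lambda_p^+(n)$ is the set of $p$-regular partitions of $n$. We write $r\preccurlyeq q$ if some rearrangement of $r$ can be cut into consecutive pieces that are compositions of $q_1,\dots,q_k$ respectively. Let $\mathscr C_\lambda$ be the conjugacy class of permutations of cycle type $\lambda$ and $\mathscr C_{\lambda,p}$ the union of all $\mathscr C_\mu$ such that the $p'$-parts of the elements of $\mathscr C_\mu$ are conjugate to those of the elements of $\mathscr C_\lambda$. Let $\Xi^q=\sum\sigma$ over all $\sigma\in\mathfrak S_n$ with $\{i: 1\le i<n,\ (i)\sigma>(i+1)\sigma\}\subseteq\{q_1^+,\dots,q_k^+\}$, and $X_F^q=\Xi^qF\mathfrak S_n$. For $1\le j\le k$ let $\omega^{(j)}=(1-c^{(j)}_{q_j})(1-c^{(j)}_{q_j-1})\cdots(1-c^{(j)}_2)$,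 where $c_i^{(j)}$ is the cycle $(q_{j-1}^++i,\ q_{j-1}^++i-1,\ \dots,\ q_{j-1}^++1)$ and $q_0^+=0$. Put $\omega_q=\omega^{(1)}\cdots\omega^{(k)}\,\Xi^q$ and $\mathrm{Lie}_F(q)=\omega_qF\mathfrak S_n$. **The idempotents $e_{\lambda,F}$.** Fix a total order on $\Lambda_p^+(n)$ refining $\preccurlyeq$, say $\lambda^{(1)}<\cdots<\lambda^{(m)}$. Let $\varphi^\lambda(\mu)$ be the number of right cosets of the Young subgroup $\mathfrak S_\lambda$ in $\mathfrak S_n$ fixed under right multiplication by a permutation of cycle type $\mu$, let $(b_{\lambda,\mu})$ be the inverse of the matrix $(\varphi^\lambda(\mu)\cdot 1_F)_{\lambda,\mu\in\Lambda_p^+(n)}$, and put $f_\lambda=\sum_{\mu\in\Lambda_p^+(n)} b_{\lambda,\mu}\Xi^\mu$ and $f_{\ge i}=\sum_{j\ge i}f_{\lambda^{(j)}}$. Let $f_1'=1$, $f_i'=(f_{i-1}'f_{\ge i}f_{i-1}')^{p^\infty}$ for $2\le i\le m$, and $f'_{m+1}=0$, where $x^{p^\infty}$ is the eventual value of $x^{p^k}$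 for large $k$ ($k=n$ suffices here). Then $e_{\lambda^{(i)},F}=f_i'-f_{i+1}'$. **Theorem.** Let $q$ be a composition of $n$ such that $(q,p)=1$ and $\lambda=\lambda(q)$ is $p$-regular. Then there are isomorphisms of right $F\mathfrak S_n$-modules $$\Xi^qe_{\lambda,F}F\mathfrak S_n\;\cong\;\mathrm{Lie}_F(q)\;\cong\;e_{\lambda,F}F\mathfrak S_n .$$ In particular, $\Xi^qe_{\lambda,F}F\mathfrak S_n$ is projective and is a direct summand of $X_F^q$, and its dimension over $F$ is $|\mathscr C_{\lambda,p}|=|\mathscr C_\lambda|$. -/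

import Mathlib

open Equiv

namespace DescentAlg

/-! ### Compositions, partitions and cycle types -/

/-- The composition whose parts are the parts of the partition `μ` in weakly decreasing order. -/
def toComp {n : ℕ} (μ : n.Partition) : Composition n where
  blocks := μ.parts.sort (· ≥ ·)
  blocks_pos := fun hi => μ.parts_pos (by simpa using hi)
  blocks_sum := by
    have h : ((μ.parts.sort (· ≥ ·) : List ℕ) : Multiset ℕ).sum = n := by
      rw [Multiset.sort_eq]; exact μ.parts_sum
    rwa [Multiset.sum_coe] at h

/-- `r ≤ q`: the composition `r` is cut into consecutive nonempty pieces, the `j`-th of which is a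
composition of the `j`-th part of `q`. (Pieces are nonempty because the parts of `q` are
positive.) -/
def StrongRef {n : ℕ} (r q : Composition n) : Prop :=
  ∃ L : List (List ℕ), L.flatten = r.blocks ∧ L.map List.sum = q.blocks

/-- `r ≼ q`: some rearrangement `s` of `r` is a strong refinement of `q`. -/
def WeakRef {n : ℕ} (r q : Composition n) : Prop :=
  ∃ s : Composition n, s.blocks.Perm r.blocks ∧ StrongRef s q

/-- `(q, p) = 1`: no part of `q` is divisible by `p`. -/
def CoprimeTo (p : ℕ) {n : ℕ} (q : Composition n) : Prop :=
  ∀ i ∈ q.blocks, ¬ p ∣ i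

/-- `μ` is `p`-regular (for `p > 0`): no part occurs `p` or more times. -/
def IsRegular (p : ℕ) {n : ℕ} (μ : n.Partition) : Prop :=
  ∀ i : ℕ, μ.parts.count i < p

/-- The `p`-regular partitions of `n`. -/
abbrev RegPart (p n : ℕ) : Type := {μ : n.Partition // IsRegular p μ}

noncomputable instance instFintypeRegPart (p n : ℕ) : Fintype (RegPart p n) :=
  Fintype.ofFinite _

/-- The conjugacy class of permutations of cycle type `μ` (fixed points counting as parts `1`). -/
def ccl {n : ℕ} (μ : n.Partition) : Set (Perm (Fin n)) :=
  {σ | σ.partition.parts = μ.parts}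

theorem ccl_nonempty {n : ℕ} (μ : n.Partition) : ∃ σ : Perm (Fin n), σ ∈ ccl μ := by
  classical
  have hsplit : μ.parts.filter (fun a => 2 ≤ a) + μ.parts.filter (fun a => ¬ 2 ≤ a) = μ.parts :=
    Multiset.filter_add_not _ _
  have hone : μ.parts.filter (fun a => ¬ 2 ≤ a)
      = Multiset.replicate (Multiset.card (μ.parts.filter (fun a => ¬ 2 ≤ a))) 1 := by
    rw [Multiset.eq_replicate]
    refine ⟨rfl, fun b hb => ?_⟩
    rw [Multiset.mem_filter] at hb
    have := μ.parts_pos hb.1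
    omega
  have hsum : (μ.parts.filter (fun a => 2 ≤ a)).sum
      + Multiset.card (μ.parts.filter (fun a => ¬ 2 ≤ a)) = n := by
    have h := μ.parts_sum
    rw [← hsplit, Multiset.sum_add, hone, Multiset.sum_replicate] at h
    simpa using h
  obtain ⟨σ, hσ⟩ := (Equiv.Perm.exists_with_cycleType_iff (α := Fin n)
    (m := μ.parts.filter (fun a => 2 ≤ a))).2
    ⟨by rw [Fintype.card_fin]; omega, fun a ha => (Multiset.mem_filter.1 ha).2⟩
  refine ⟨σ, ?_⟩
  have hs : σ.support.card = (μ.parts.filter (fun a => 2 ≤ a)).sum := by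
    rw [← Equiv.Perm.sum_cycleType, hσ]
  have hc : Fintype.card (Fin n) - σ.support.card
      = Multiset.card (μ.parts.filter (fun a => ¬ 2 ≤ a)) := by
    rw [hs, Fintype.card_fin]; omega
  change σ.partition.parts = μ.parts
  rw [Equiv.Perm.parts_partition, hσ, hc, ← hone, hsplit]

/-- `s` is the `p'`-part of `σ`: `σ = u s = s u` with `u` of `p`-power order and `s` of order prime
to `p`. -/
def IsPPrimePart (p : ℕ) {n : ℕ} (σ s : Perm (Fin n)) : Prop :=
  ∃ u : Perm (Fin n), σ = u * s ∧ σ = s * u ∧ (∃ k : ℕ, orderOf u = p ^ k) ∧ ¬ p ∣ orderOf s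

/-- `μ ∼_p ν`: the `p'`-parts of any `σ` of cycle type `μ` and any `τ` of cycle type `ν` are
conjugate. -/
def PEquiv (p : ℕ) {n : ℕ} (μ ν : n.Partition) : Prop :=
  ∀ σ ∈ ccl μ, ∀ τ ∈ ccl ν, ∀ s t : Perm (Fin n),
    IsPPrimePart p σ s → IsPPrimePart p τ t → IsConj s t

/-- The union of the conjugacy classes labelled by the partitions that are `p`-equivalent
to `μ`. -/
def pccl (p : ℕ) {n : ℕ} (μ : n.Partition) : Set (Perm (Fin n)) :=
  {σ | ∃ ν : n.Partition, PEquiv p ν μ ∧ σ ∈ ccl ν}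

/-! ### Young characters -/

/-- The number of `q`-tabloids (equivalently, right cosets of the Young subgroup of `q`) fixed by
`σ`. A tabloid is given by the row `t x` in which each number `x` lies; row `j` has `q_j`
entries. -/
noncomputable def youngCharPerm {n : ℕ} (q : Composition n) (σ : Perm (Fin n)) : ℕ :=
  Nat.card {t : Fin n → Fin q.length //
    (∀ j, Nat.card {x : Fin n // t x = j} = q.blocksFun j) ∧ ∀ x, t (σ x) = t x}

/-- The Young character at the conjugacy class labelled by `μ`. -/
noncomputable def youngChar {n : ℕ} (q : Composition n) (μ : n.Partition) : ℕ :=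
  youngCharPerm q (ccl_nonempty μ).choose

/-! ### The group algebra -/

/-- The group algebra of the symmetric group on `n` points over `R`, permutations being composed
from left to right: in `(Perm (Fin n))ᵐᵒᵖ` the product of `σ` and `τ` is "first `σ`, then `τ`". -/
abbrev SymAlg (R : Type*) [CommRing R] (n : ℕ) : Type _ :=
  MonoidAlgebra R (Perm (Fin n))ᵐᵒᵖ

/-- A permutation as an element of the group algebra. -/
noncomputable def perm (R : Type*) [CommRing R] {n : ℕ} (σ : Perm (Fin n)) : SymAlg R n :=
  MonoidAlgebra.of R (Perm (Fin n))ᵐᵒᵖ (MulOpposite.op σ)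

/-- The right ideal `x R S_n`, a right module over the group algebra. -/
noncomputable def rightIdeal {R : Type*} [CommRing R] {n : ℕ} (x : SymAlg R n) :
    Submodule (SymAlg R n)ᵐᵒᵖ (SymAlg R n) :=
  Submodule.span (SymAlg R n)ᵐᵒᵖ {x}

/-- The descent set of `σ`, as a set of positions in `{1, …, n-1}`; position `i` of the word of `σ`
is the element `i - 1` of `Fin n`. -/
def descents {n : ℕ} (σ : Perm (Fin n)) : Set ℕ :=
  {i | ∃ (_ : 1 ≤ i) (h : i < n), σ ⟨i, h⟩ < σ ⟨i - 1, by omega⟩}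

open Classical in
/-- Solomon's descent element `Ξ^q`: the sum of the permutations all of whose descents are
partial sums of `q`. -/
noncomputable def Xi (R : Type*) [CommRing R] {n : ℕ} (q : Composition n) : SymAlg R n :=
  ∑ σ : Perm (Fin n) with descents σ ⊆ {i | ∃ j ∈ Finset.Icc 1 q.length, i = q.sizeUpTo j},
    perm R σ

/-! ### Higher Lie modules -/

/-- The descending cycle `(a+i, a+i-1, …, a+1)` on the numbers `1, …, n` (here shifted to start
at `0`). -/
def descCycle (n a i : ℕ) : Perm (Fin n) :=
  (((List.finRange n).filter fun x : Fin n => a ≤ x.val ∧ x.val < a + i).reverse).formPerm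

/-- The Dynkin–Specht–Wever element `(1 - c_m)(1 - c_{m-1}) ⋯ (1 - c_2)` on the numbers
`a+1, …, a+m`. -/
noncomputable def dswShift (R : Type*) [CommRing R] (n a m : ℕ) : SymAlg R n :=
  (((List.range' 2 (m - 1)).reverse).map fun i => 1 - perm R (descCycle n a i)).prod

/-- `ω^q`: the product of the Dynkin–Specht–Wever elements on the consecutive blocks of `q`. -/
noncomputable def omegaUp (R : Type*) [CommRing R] {n : ℕ} (q : Composition n) : SymAlg R n :=
  (List.ofFn fun j : Fin q.length => dswShift R n (q.sizeUpTo j) (q.blocksFun j)).prod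

/-- `ω_q = ω^q Ξ^q`. -/
noncomputable def omega (R : Type*) [CommRing R] {n : ℕ} (q : Composition n) : SymAlg R n :=
  omegaUp R q * Xi R q

/-- The higher Lie module `Lie_R(q) = ω_q R S_n`. -/
noncomputable def LieMod (R : Type*) [CommRing R] {n : ℕ} (q : Composition n) :
    Submodule (SymAlg R n)ᵐᵒᵖ (SymAlg R n) :=
  rightIdeal (omega R q)

/-- The right ideal `X^q_R = Ξ^q R S_n`. -/
noncomputable def XMod (R : Type*) [CommRing R] {n : ℕ} (q : Composition n) :
    Submodule (SymAlg R n)ᵐᵒᵖ (SymAlg R n) :=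
  rightIdeal (Xi R q)

/-! ### The modular idempotents -/

open Classical in
/-- The matrix `Φ` of values of the Young characters, over the `p`-regular partitions. -/
noncomputable def youngMatrix (F : Type*) [Field F] (p n : ℕ) :
    Matrix (RegPart p n) (RegPart p n) F :=
  Matrix.of fun l μ => (youngChar (toComp l.1) μ.1 : F)

open Classical in
/-- `f_λ = ∑_μ b_{λ,μ} Ξ^μ`, where `(b_{λ,μ})` is the inverse of the matrix `Φ`. -/
noncomputable def fElt (F : Type*) [Field F] {p n : ℕ} (l : RegPart p n) : SymAlg F n :=
  ∑ μ : RegPart p n, (youngMatrix F p n)⁻¹ l μ • Xi F (toComp μ.1)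

/-- `f_{≥ i} = ∑_{j ≥ i} f_{λ^(j)}`, for a listing `ν` of the `p`-regular partitions. -/
noncomputable def fGe (F : Type*) [Field F] {p n m : ℕ} (ν : Fin m ≃ RegPart p n) (i : ℕ) :
    SymAlg F n :=
  ∑ j : Fin m with i ≤ j.val, fElt F (ν j)

/-- The elements `f'_i`, indexed from `0`: `f'_0 = 1`, `f'_i = (f'_{i-1} f_{≥ i} f'_{i-1})^{p^∞}`
for `0 < i < m`, and `f'_m = 0`. Here `x^{p^∞}` denotes the eventual value of `x^{p^k}` for large
`k`; the exponent `k = n` is large enough, as `p^n ≥ n - 1`. -/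
noncomputable def fPrime (F : Type*) [Field F] {p n m : ℕ} (ν : Fin m ≃ RegPart p n) :
    ℕ → SymAlg F n
  | 0 => 1
  | i + 1 => if i + 1 < m then (fPrime F ν i * fGe F ν (i + 1) * fPrime F ν i) ^ p ^ n else 0

/-- The modular idempotent `e_{λ,F} = f'_i - f'_{i+1}`, where `λ` is the `i`-th `p`-regular
partition in the listing `ν`. -/
noncomputable def modIdem (F : Type*) [Field F] {p n m : ℕ} (ν : Fin m ≃ RegPart p n)
    (l : RegPart p n) : SymAlg F n :=
  fPrime F ν (ν.symm l : ℕ) - fPrime F ν ((ν.symm l : ℕ) + 1)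

end DescentAlg

open DescentAlg

namespace DescentAlg

/-! ### The face monoid -/

/-! Write A for the group algebra, e for the idempotent attached to λ, and c for the order of the
centralizer of a permutation of cycle type λ: the product of the parts of λ and the factorials of
their multiplicities. The hypotheses on q make c nonzero in F.

The computations are lifted to the monoid algebra of the face monoid. Faces act on permutations, and
on elements invariant under relabelling this action is left multiplication by an element of A
(`toSym_mul`). So `toSym` is multiplicative on the subalgebra `faceDescent` generated by sums of
faces of a given type, and it sends the sum of type q to Ξ^q. In the lift, right multiplication by y
is triangular for the depth of faces, with values of characters on the diagonal. An element killed
by all characters is therefore nilpotent, already with exponent p^n. On `faceDescent` a character is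
read off from a product of power sums; since the p-th power of the i-th power sum is the (pi)-th one
in characteristic p, only p-regular partitions matter (`exists_partChar_eq`). Consequently e lifts
to an idempotent whose character is 1 at λ and 0 at the other p-regular partitions
(`exists_lift_modIdem`).

The element ω_q lifts to a product of noncommutative power sums, `facePower`. One transfer
principle, `map_facePower`, gives three facts: the lift maps to ω_q (`toSym_facePower`), its
character is c at λ and 0 elsewhere (`partChar_facePower`), and ω_q² = c ω_q (`omega_mul_self`).

Hence E = c⁻¹ω_q is an idempotent with the same characters as e, and u = Ee + (1 - E)(1 - e) is a
unit with ue = Ee = Eu. This gives eA ≅ ueA = EuA = EA = Lie(q). Moreover ω^q Ξ^q e = c u e, so left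
multiplication by Ξ^q is injective on eA, and it splits.

For the dimension, ω_q has coefficient 1 at the identity, so left multiplication by it on the
integral group ring has trace n!. Being c times an idempotent, it has rank n!/c over F, which is the
size of the class. As p does not divide c, no nontrivial p-element centralizes an element of the
class, so the p-class is the class itself. -/

/-- A face of the braid arrangement on `X`: a total preorder on `X`. -/
@[ext]
structure Face (X : Type*) where
  /-- The underlying relation. -/
  rel : X → X → Prop
  total : ∀ x y, rel x y ∨ rel y x
  trans : ∀ x y z, rel x y → rel y z → rel x z

namespace Face

variable {X : Type*}

theorem refl (t : Face X) (x : X) : t.rel x x := (t.total x x).elim id id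

/-- The product of faces is the lexicographic refinement. -/
instance : Mul (Face X) where
  mul s t :=
    { rel := fun x y => s.rel x y ∧ (s.rel y x → t.rel x y)
      total := fun x y => by
        have := s.total x y
        have := t.total x y
        tauto
      trans := fun x y z h₁ h₂ =>
        ⟨s.trans x y z h₁.1 h₂.1, fun h => t.trans x y z (h₁.2 (s.trans _ _ _ h₂.1 h))
          (h₂.2 (s.trans _ _ _ h h₁.1))⟩ }

instance : One (Face X) where
  one := { rel := fun _ _ => True, total := by simp, trans := by simp }

theorem mul_rel (s t : Face X) (x y : X) :
    (s * t).rel x y ↔ s.rel x y ∧ (s.rel y x → t.rel x y) := Iff.rfl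

@[simp] theorem one_rel (x y : X) : (1 : Face X).rel x y := trivial

theorem ext_of_rel_iff {s t : Face X} (h : ∀ x y, s.rel x y ↔ t.rel x y) : s = t :=
  Face.ext (by funext x y; exact propext (h x y))

instance : Monoid (Face X) where
  mul_assoc r s t := ext_of_rel_iff fun x y => by simp only [mul_rel]; tauto
  one_mul t := ext_of_rel_iff fun x y => by simp [mul_rel]
  mul_one t := ext_of_rel_iff fun x y => by simp [mul_rel]

theorem mul_eq_left_iff (s t : Face X) :
    s * t = s ↔ ∀ x y, s.rel x y → s.rel y x → t.rel x y := by
  constructor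
  · intro h x y h₁ h₂
    rw [← h] at h₁
    exact h₁.2 h₂
  · intro h
    refine ext_of_rel_iff fun x y => ?_
    rw [mul_rel]
    exact ⟨fun h => h.1, fun h' => ⟨h', h x y h'⟩⟩

/-- Relabelling a face along a permutation. -/
def relabel (σ : Perm X) (t : Face X) : Face X where
  rel x y := t.rel (σ⁻¹ x) (σ⁻¹ y)
  total _ _ := t.total _ _
  trans _ _ _ := t.trans _ _ _

theorem relabel_rel (σ : Perm X) (t : Face X) (x y : X) :
    (relabel σ t).rel x y ↔ t.rel (σ⁻¹ x) (σ⁻¹ y) := Iff.rfl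

theorem relabel_mul (σ : Perm X) (s t : Face X) :
    relabel σ (s * t) = relabel σ s * relabel σ t := rfl

/-- The face whose blocks are the fibres of a function to a linear order. -/
def ofFun {κ : Type*} [LinearOrder κ] (f : X → κ) : Face X where
  rel x y := f x ≤ f y
  total _ _ := le_total _ _
  trans _ _ _ := le_trans

theorem ofFun_rel {κ : Type*} [LinearOrder κ] (f : X → κ) (x y : X) :
    (ofFun f).rel x y ↔ f x ≤ f y := Iff.rfl

section Finite

variable [Fintype X]

open Classical in
/-- The number of ordered pairs violating the preorder. -/
noncomputable def depth (t : Face X) : ℕ :=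
  (Finset.univ.filter fun z : X × X => ¬ t.rel z.1 z.2).card

/-- A product refines its left factor, so violated pairs stay violated; if it differs from s, some
pair inside a block of s becomes violated. -/
theorem depth_lt_mul (s t : Face X) (h : s * t ≠ s) : s.depth < (s * t).depth := by
  classical
  rw [Ne, mul_eq_left_iff] at h
  push Not at h
  obtain ⟨x, y, h₁, h₂, h₃⟩ := h
  refine Finset.card_lt_card ((Finset.ssubset_iff_of_subset ?_).2 ⟨(x, y), ?_, ?_⟩)
  · intro z
    simp only [Finset.mem_filter, Finset.mem_univ, true_and, mul_rel]
    tauto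
  · simp only [Finset.mem_filter, Finset.mem_univ, true_and, mul_rel]
    tauto
  · simpa using h₁

/-- By totality a pair and its reverse are never both violated, so the violated pairs and their
reverses are disjoint sets of off-diagonal pairs. -/
theorem depth_le (t : Face X) :
    2 * t.depth ≤ Fintype.card X * Fintype.card X - Fintype.card X := by
  classical
  let A := Finset.univ.filter fun z : X × X => ¬ t.rel z.1 z.2
  have hA : A.card = t.depth := by unfold depth; congr
  have hB : (A.map (Equiv.prodComm X X).toEmbedding).card = t.depth := by
    rw [Finset.card_map, hA]
  have hd : Disjoint A (A.map (Equiv.prodComm X X).toEmbedding) := by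
    rw [Finset.disjoint_left]
    rintro ⟨x, y⟩ h₁ h₂
    simp only [Finset.mem_map_equiv, A, Finset.mem_filter, Finset.mem_univ, true_and] at h₁ h₂
    exact (t.total x y).elim h₁ h₂
  have hs : A ∪ A.map (Equiv.prodComm X X).toEmbedding ⊆ (Finset.univ : Finset X).offDiag := by
    rintro ⟨x, y⟩ h
    simp only [Finset.mem_union, Finset.mem_map_equiv, A, Finset.mem_filter, Finset.mem_univ,
      true_and, Finset.mem_offDiag] at h ⊢
    rintro rfl
    exact h.elim (fun h => h (t.refl x)) (fun h => h (t.refl x))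
  have := Finset.card_le_card hs
  rw [Finset.card_union_of_disjoint hd, hA, hB, Finset.offDiag_card, Finset.card_univ] at this
  omega

end Finite

end Face

/-! ### The face algebra -/

/-- The monoid algebra of the face monoid. -/
abbrev FaceAlg (R X : Type*) [CommRing R] : Type _ := MonoidAlgebra R (Face X)

open Classical in
/-- The character of the face monoid attached to a relation `E`: it tests whether a face is
constant on `E`-related pairs. -/
noncomputable def faceChar (R : Type*) [CommRing R] {X : Type*} (E : X → X → Prop) :
    FaceAlg R X →ₐ[R] R :=
  MonoidAlgebra.lift R R (Face X)
    { toFun := fun t => if ∀ x y, E x y → t.rel x y ∧ t.rel y x then 1 else 0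
      map_one' := by simp
      map_mul' := fun s t => by
        rw [mul_ite, mul_one, mul_zero, ← ite_and]
        refine if_congr ?_ rfl rfl
        simp only [Face.mul_rel]
        constructor
        · intro h
          exact ⟨fun x y e => by have := h x y e; tauto, fun x y e => by have := h x y e; tauto⟩
        · intro h x y e
          have := h.2 x y e
          have := h.1 x y e
          tauto }

theorem faceChar_single (R : Type*) [CommRing R] {X : Type*} (E : X → X → Prop) (t : Face X)
    (r : R) [Decidable (∀ x y, E x y → t.rel x y ∧ t.rel y x)] :
    faceChar R E (MonoidAlgebra.single t r) =
      if ∀ x y, E x y → t.rel x y ∧ t.rel y x then r else 0 := by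
  rw [faceChar, MonoidAlgebra.lift_single]
  by_cases h : ∀ x y, E x y → t.rel x y ∧ t.rel y x <;> simp [h]

section Nilpotent

variable {R X : Type*} [CommRing R] [Fintype X]

/-- The span of the faces of depth at least `k`. -/
noncomputable def deepSpan (R X : Type*) [CommRing R] [Fintype X] (k : ℕ) : Submodule R (FaceAlg R X) :=
  Submodule.span R ((fun t : Face X => MonoidAlgebra.single t 1) '' {t | k ≤ t.depth})

theorem single_mem_deepSpan {t : Face X} {k : ℕ} (h : k ≤ t.depth) (r : R) :
    MonoidAlgebra.single t r ∈ deepSpan R X k := by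
  have : (MonoidAlgebra.single t r : FaceAlg R X) = r • MonoidAlgebra.single t 1 := by
    simp [MonoidAlgebra.smul_single]
  rw [this]
  exact Submodule.smul_mem _ _ (Submodule.subset_span ⟨t, h, rfl⟩)

/-- Two points are in the same block of the face `t`. -/
def Face.block (t : Face X) (x y : X) : Prop := t.rel x y ∧ t.rel y x

/-- Either every block of t lies in a block of u and t * u = t, or t * u is strictly deeper. Thus
right multiplication by y is triangular for the depth filtration, the diagonal entry at t being the
character of the blocks of t. -/
theorem single_mul_sub_mem (t : Face X) (y : FaceAlg R X) :
    MonoidAlgebra.single t 1 * y - faceChar R t.block y • MonoidAlgebra.single t 1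
      ∈ deepSpan R X (t.depth + 1) := by
  classical
  induction y using MonoidAlgebra.induction_linear with
  | zero => simp
  | add a b ha hb =>
    rw [mul_add, map_add, add_smul, add_sub_add_comm]
    exact add_mem ha hb
  | single u r =>
    rw [MonoidAlgebra.single_mul_single, faceChar_single, one_mul]
    split_ifs with h
    · have : t * u = t := (Face.mul_eq_left_iff _ _).2 fun x y h₁ h₂ => (h x y ⟨h₁, h₂⟩).1
      rw [this]
      simp [MonoidAlgebra.smul_single]
    · rw [zero_smul, sub_zero]
      refine single_mem_deepSpan (Face.depth_lt_mul t u fun he => h fun x y hb => ?_) r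
      rw [Face.mul_eq_left_iff] at he
      exact ⟨he _ _ hb.1 hb.2, he _ _ hb.2 hb.1⟩

theorem mul_mem_deepSpan {y : FaceAlg R X} (hy : ∀ t : Face X, faceChar R t.block y = 0)
    {k : ℕ} {z : FaceAlg R X} (hz : z ∈ deepSpan R X k) : z * y ∈ deepSpan R X (k + 1) := by
  induction hz using Submodule.span_induction with
  | zero => simp
  | add a b _ _ ha hb => rw [add_mul]; exact add_mem ha hb
  | smul r a _ ha => rw [smul_mul_assoc]; exact Submodule.smul_mem _ _ ha
  | mem x hx =>
    obtain ⟨t, ht, rfl⟩ := hx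
    have := single_mul_sub_mem t y
    rw [hy, zero_smul, sub_zero] at this
    refine Submodule.span_mono ?_ this
    apply Set.image_mono
    intro u (hu : t.depth + 1 ≤ u.depth)
    exact le_trans (Nat.succ_le_succ ht) hu

/-- An element annihilated by all characters is nilpotent, with an explicit exponent. -/
theorem pow_eq_zero_of_faceChar {y : FaceAlg R X}
    (hy : ∀ t : Face X, faceChar R t.block y = 0) {N : ℕ}
    (hN : Fintype.card X * Fintype.card X - Fintype.card X < 2 * N) : y ^ N = 0 := by
  have key : ∀ k, y ^ k ∈ deepSpan R X k := by
    intro k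
    induction k with
    | zero =>
      rw [pow_zero, MonoidAlgebra.one_def]
      exact single_mem_deepSpan (Nat.zero_le _) 1
    | succ k ih => rw [pow_succ]; exact mul_mem_deepSpan hy ih
  have h := key N
  have : {t : Face X | N ≤ t.depth} = ∅ := by
    ext t
    have := t.depth_le
    simp only [Set.mem_ofPred_eq, Set.mem_empty_iff_false, iff_false]
    omega
  rw [deepSpan, this, Set.image_empty, Submodule.span_empty] at h
  exact h

/-- Depth is at most n(n-1)/2, and this bound makes 2^n, hence p^n, a sufficient exponent for
nilpotency; it is the exponent occurring in `fPrime`. -/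
theorem card_sq_lt_two_pow (n : ℕ) : n * n - n < 2 * 2 ^ n := by
  have h : ∀ n : ℕ, n * n + 1 ≤ n + 2 * 2 ^ n ∧ n + 1 ≤ 2 ^ n := by
    intro n
    induction n with
    | zero => simp
    | succ n ih =>
      obtain ⟨h₁, h₂⟩ := ih
      rw [pow_succ]
      constructor <;> nlinarith
  have := (h n).1
  have := Nat.two_pow_pos n
  omega

theorem pow_prime_pow_eq_zero {p : ℕ} (hp : p.Prime) {y : FaceAlg R X}
    (hy : ∀ t : Face X, faceChar R t.block y = 0) : y ^ p ^ Fintype.card X = 0 := by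
  refine pow_eq_zero_of_faceChar hy (lt_of_lt_of_le (card_sq_lt_two_pow _) ?_)
  exact Nat.mul_le_mul_left 2 (Nat.pow_le_pow_left hp.two_le _)

end Nilpotent

/-! ### Chambers and the action of the face algebra on the group algebra -/

variable {n : ℕ}

/-- The chamber listing the points in the order given by `σ`. -/
def chamber (σ : Perm (Fin n)) : Face (Fin n) := Face.ofFun fun x => σ⁻¹ x

theorem chamber_rel (σ : Perm (Fin n)) (x y : Fin n) :
    (chamber σ).rel x y ↔ σ⁻¹ x ≤ σ⁻¹ y := Iff.rfl

theorem relabel_chamber (π σ : Perm (Fin n)) :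
    Face.relabel π (chamber σ) = chamber (π * σ) :=
  Face.ext_of_rel_iff fun x y => by simp [Face.relabel_rel, chamber_rel]

theorem chamber_injective : Function.Injective (chamber (n := n)) := by
  intro σ τ h
  have h' : ∀ i j, i ≤ j ↔ τ⁻¹ (σ i) ≤ τ⁻¹ (σ j) := fun i j => by
    have := congrArg (fun f => f.rel (σ i) (σ j)) h
    simpa [chamber_rel] using this
  -- Two permutations with the same chamber differ by an order automorphism of a finite chain, which
  -- is trivial.
  let e : Fin n ≃o Fin n :=
    { toEquiv := σ.trans τ⁻¹
      map_rel_iff' := fun {a b} => (h' a b).symm }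
  have he : e = OrderIso.refl _ := Subsingleton.elim _ _
  ext i
  have := congrArg (fun f : Fin n ≃o Fin n => τ (f i)) he
  simp only [OrderIso.refl_apply] at this
  have h2 : τ (e i) = σ i := by
    change τ (τ⁻¹ (σ i)) = σ i
    simp
  rw [← h2, this]

theorem exists_chamber (t : Face (Fin n)) (h : ∀ x y, t.rel x y → t.rel y x → x = y) :
    ∃ σ, chamber σ = t := by
  classical
  -- An antisymmetric face is a linear order, and ρ is the rank: the number of strict predecessors.
  let ρ : Fin n → Fin n := fun x =>
    ⟨(Finset.univ.filter fun y => t.rel y x ∧ y ≠ x).card, by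
      have : (Finset.univ.filter fun y => t.rel y x ∧ y ≠ x) ⊂ Finset.univ := by
        refine Finset.filter_ssubset.2 ⟨x, Finset.mem_univ _, by simp⟩
      simpa using Finset.card_lt_card this⟩
  have hlt : ∀ x y, t.rel x y → x ≠ y → ρ x < ρ y := by
    intro x y hxy hne
    refine Fin.mk_lt_mk.2 (Finset.card_lt_card
      ((Finset.ssubset_iff_of_subset ?_).2 ⟨x, ?_, ?_⟩))
    · intro z hz
      simp only [Finset.mem_filter, Finset.mem_univ, true_and] at hz ⊢
      refine ⟨t.trans _ _ _ hz.1 hxy, ?_⟩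
      rintro rfl
      exact hne (h _ _ hxy hz.1)
    · simpa using ⟨hxy, hne⟩
    · simp
  have hinj : Function.Injective ρ := by
    intro x y hxy
    by_contra hne
    rcases t.total x y with h' | h'
    · exact (hlt _ _ h' hne).ne hxy
    · exact (hlt _ _ h' (Ne.symm hne)).ne hxy.symm
  let e : Perm (Fin n) := Equiv.ofBijective ρ (Finite.injective_iff_bijective.1 hinj)
  refine ⟨e⁻¹, Face.ext_of_rel_iff fun x y => ?_⟩
  rw [chamber_rel, inv_inv]
  change ρ x ≤ ρ y ↔ _
  constructor
  · intro hle
    rcases t.total x y with h' | h'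
    · exact h'
    · by_cases hne : y = x
      · rw [hne]; exact t.refl x
      · exact absurd (hlt _ _ h' hne) (not_lt.2 hle)
  · intro h'
    by_cases hne : x = y
    · rw [hne]
    · exact (hlt _ _ h' hne).le

theorem exists_chamber_mul (t : Face (Fin n)) (τ : Perm (Fin n)) :
    ∃ σ, chamber σ = t * chamber τ := by
  refine exists_chamber _ fun x y h₁ h₂ => ?_
  have h₁ := h₁.2 h₂.1
  have h₂ := h₂.2 (by assumption : (t * chamber τ).rel x y).1
  rw [chamber_rel] at h₁ h₂
  exact τ⁻¹.injective (le_antisymm h₁ h₂)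

/-- The permutation `τ` rearranged by the face `t`. -/
noncomputable def Face.sortPerm (t : Face (Fin n)) (τ : Perm (Fin n)) : Perm (Fin n) :=
  (exists_chamber_mul t τ).choose

theorem chamber_sortPerm (t : Face (Fin n)) (τ : Perm (Fin n)) :
    chamber (t.sortPerm τ) = t * chamber τ := (exists_chamber_mul t τ).choose_spec

theorem sortPerm_eq_iff (t : Face (Fin n)) (τ σ : Perm (Fin n)) :
    t.sortPerm τ = σ ↔ chamber σ = t * chamber τ := by
  rw [← chamber_sortPerm, chamber_injective.eq_iff, eq_comm]

theorem sortPerm_relabel (π : Perm (Fin n)) (t : Face (Fin n)) (τ : Perm (Fin n)) :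
    (Face.relabel π t).sortPerm (π * τ) = π * t.sortPerm τ := by
  rw [sortPerm_eq_iff, ← relabel_chamber, chamber_sortPerm, Face.relabel_mul, relabel_chamber]

section Action

variable (R : Type*) [CommRing R]

/-- The linear map on the group algebra induced by a map of permutations. -/
noncomputable def permMap (f : Perm (Fin n) → Perm (Fin n)) : SymAlg R n →ₗ[R] SymAlg R n :=
  MonoidAlgebra.mapDomainLinearMap R R fun σ => MulOpposite.op (f σ.unop)

theorem permMap_perm (f : Perm (Fin n) → Perm (Fin n)) (σ : Perm (Fin n)) :
    permMap R f (perm R σ) = perm R (f σ) := by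
  simp [permMap, perm]

theorem perm_mul_perm (σ τ : Perm (Fin n)) : perm R σ * perm R τ = perm R (τ * σ) := by
  rw [perm, perm, perm, ← map_mul, ← MulOpposite.op_mul]

theorem perm_one : perm R (1 : Perm (Fin n)) = 1 := by
  rw [perm, MulOpposite.op_one, map_one]

theorem single_eq_smul_perm (σ : (Perm (Fin n))ᵐᵒᵖ) (r : R) :
    (MonoidAlgebra.single σ r : SymAlg R n) = r • perm R σ.unop := by
  simp [perm, MonoidAlgebra.smul_single]

variable {R} in
theorem symAlg_hom_ext {V : Type*} [AddCommMonoid V] [Module R V] {f g : SymAlg R n →ₗ[R] V}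
    (h : ∀ σ, f (perm R σ) = g (perm R σ)) : f = g := by
  refine LinearMap.ext fun x => ?_
  induction x using MonoidAlgebra.induction_linear with
  | zero => simp
  | add a b ha hb => rw [map_add, map_add, ha, hb]
  | single σ r => rw [single_eq_smul_perm, map_smul, map_smul, h]

/-- The action of the face algebra on the group algebra. -/
noncomputable def faceAct : FaceAlg R (Fin n) →ₐ[R] Module.End R (SymAlg R n) :=
  MonoidAlgebra.lift R _ _
    { toFun := fun t => permMap R t.sortPerm
      map_one' := symAlg_hom_ext fun σ => by
        rw [permMap_perm, (sortPerm_eq_iff _ _ _).2 (one_mul (chamber σ)).symm]; rfl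
      map_mul' := fun s t => symAlg_hom_ext fun σ => by
        rw [Module.End.mul_apply, permMap_perm, permMap_perm, permMap_perm,
          (sortPerm_eq_iff _ _ (s.sortPerm (t.sortPerm σ))).2]
        rw [chamber_sortPerm, chamber_sortPerm, mul_assoc] }

theorem faceAct_single_perm (t : Face (Fin n)) (r : R) (σ : Perm (Fin n)) :
    faceAct R (MonoidAlgebra.single t r) (perm R σ) = r • perm R (t.sortPerm σ) := by
  rw [faceAct, MonoidAlgebra.lift_single]
  simp [permMap_perm]

/-- The element of the group algebra attached to an element of the face algebra. -/
noncomputable def toSym : FaceAlg R (Fin n) →ₗ[R] SymAlg R n :=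
  (LinearMap.applyₗ (1 : SymAlg R n)) ∘ₗ (faceAct R).toLinearMap

theorem toSym_apply (y : FaceAlg R (Fin n)) : toSym R y = faceAct R y 1 := rfl

theorem toSym_single (t : Face (Fin n)) (r : R) :
    toSym R (MonoidAlgebra.single t r) = r • perm R (t.sortPerm 1) := by
  rw [toSym_apply, ← perm_one, faceAct_single_perm]

/-- Relabelling as an automorphism of the face algebra. -/
noncomputable def relabelHom (X : Type*) (π : Perm X) : FaceAlg R X →ₐ[R] FaceAlg R X :=
  MonoidAlgebra.mapDomainAlgHom R R
    { toFun := Face.relabel π, map_one' := rfl, map_mul' := Face.relabel_mul π }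

theorem relabelHom_single {X : Type*} (π : Perm X) (t : Face X) (r : R) :
    relabelHom R X π (MonoidAlgebra.single t r) = MonoidAlgebra.single (Face.relabel π t) r := by
  simp only [relabelHom, MonoidAlgebra.mapDomainAlgHom_apply, MonoidAlgebra.mapDomain_single]
  rfl

/-- Right multiplication by τ renames the letters of a permutation, and renaming is equivariant for
the action of faces (`sortPerm_relabel`). -/
theorem toSym_mul_perm (y : FaceAlg R (Fin n)) (τ : Perm (Fin n)) :
    toSym R y * perm R τ = faceAct R (relabelHom R _ τ y) (perm R τ) := by
  induction y using MonoidAlgebra.induction_linear with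
  | zero => simp
  | add a b ha hb => rw [map_add, add_mul, map_add, map_add, LinearMap.add_apply, ha, hb]
  | single t r =>
    rw [toSym_single, relabelHom_single, faceAct_single_perm, smul_mul_assoc, perm_mul_perm]
    have := sortPerm_relabel τ t 1
    rw [mul_one] at this
    rw [this]

/-- The invariants of the symmetric group in the face algebra. -/
noncomputable def faceInvariants (X : Type*) : Subalgebra R (FaceAlg R X) :=
  ⨅ π : Perm X, AlgHom.equalizer (relabelHom R X π) (AlgHom.id R _)

theorem mem_faceInvariants {X : Type*} {y : FaceAlg R X} :
    y ∈ faceInvariants R X ↔ ∀ π, relabelHom R X π y = y := by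
  simp [faceInvariants, Algebra.mem_iInf, AlgHom.mem_equalizer]

/-- Bidigare's observation: the action of a relabelling-invariant element commutes with right
multiplication by permutations, so it is left multiplication by its value at 1. -/
theorem toSym_mul {y : FaceAlg R (Fin n)} (hy : y ∈ faceInvariants R (Fin n))
    (x : SymAlg R n) : toSym R y * x = faceAct R y x := by
  have : LinearMap.mulLeft R (toSym R y) = faceAct R y := symAlg_hom_ext fun σ => by
    rw [LinearMap.mulLeft_apply, toSym_mul_perm, (mem_faceInvariants R).1 hy]
  exact LinearMap.congr_fun this x

theorem toSym_map_mul {y : FaceAlg R (Fin n)} (hy : y ∈ faceInvariants R (Fin n))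
    (z : FaceAlg R (Fin n)) : toSym R (y * z) = toSym R y * toSym R z := by
  rw [toSym_mul R hy, toSym_apply, toSym_apply, map_mul, Module.End.mul_apply]

theorem toSym_one : toSym R (1 : FaceAlg R (Fin n)) = 1 := by
  rw [toSym_apply, map_one (faceAct R)]; rfl

end Action

/-! ### Sums of faces of a given type -/

/-- The weights of the fibres of a function. -/
def sizes {X κ : Type*} [Fintype X] [DecidableEq κ] (d : X → ℕ) (f : X → κ) : κ → ℕ :=
  fun j => ∑ x with f x = j, d x

theorem sizes_comp_perm {X κ : Type*} [Fintype X] [DecidableEq κ] (f : X → κ) (π : Perm X) :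
    sizes (fun _ => 1) (fun x => f (π x)) = sizes (fun _ => 1) f := by
  funext j
  simp only [sizes, Finset.sum_filter]
  exact Equiv.sum_comp π fun x => if f x = j then 1 else 0

section FaceSum

variable (R : Type*) [CommRing R] (X : Type*) [Fintype X] [DecidableEq X]

/-- The sum of the faces attached to the functions to `Fin l` with fibres of sizes `s`. -/
noncomputable def faceSum {l : ℕ} (s : Fin l → ℕ) : FaceAlg R X :=
  ∑ f : X → Fin l with sizes (fun _ => 1) f = s, MonoidAlgebra.single (Face.ofFun f) 1

variable {X}

theorem faceSum_mem_faceInvariants {l : ℕ} (s : Fin l → ℕ) :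
    faceSum R X s ∈ faceInvariants R X := by
  rw [mem_faceInvariants]
  intro π
  rw [faceSum, map_sum]
  refine Finset.sum_nbij' (fun f x => f (π⁻¹ x)) (fun f x => f (π x)) ?_ ?_ ?_ ?_ ?_
  · intro f hf
    simp only [Finset.mem_filter, Finset.mem_univ, true_and] at hf ⊢
    rw [sizes_comp_perm f π⁻¹, hf]
  · intro f hf
    simp only [Finset.mem_filter, Finset.mem_univ, true_and] at hf ⊢
    rw [sizes_comp_perm f π, hf]
  · intro f _; simp
  · intro f _; simp
  · intro f _
    rw [relabelHom_single]
    rfl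

theorem faceChar_faceSum {l : ℕ} (s : Fin l → ℕ) (E : X → X → Prop) :
    faceChar R E (faceSum R X s) = (Nat.card {f : X → Fin l //
      sizes (fun _ => 1) f = s ∧ ∀ x y, E x y → f x = f y} : R) := by
  classical
  rw [Nat.card_eq_fintype_card, Fintype.card_subtype, faceSum, map_sum, ← Finset.filter_filter,
    Finset.card_filter, Nat.cast_sum]
  refine Finset.sum_congr rfl fun f _ => (faceChar_single _ _ _ _).trans ?_
  rw [Nat.cast_ite, Nat.cast_one, Nat.cast_zero]
  refine if_congr (forall_congr' fun x => forall_congr' fun y => imp_congr_right fun _ => ?_) rfl rfl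
  simp only [Face.ofFun_rel]
  exact ⟨fun h => le_antisymm h.1 h.2, fun h => ⟨h.le, h.ge⟩⟩

end FaceSum

section Young

variable {n : ℕ}

theorem sizes_one_eq_iff {X : Type*} [Fintype X] {l : ℕ} (f : X → Fin l)
    (s : Fin l → ℕ) :
    sizes (fun _ => 1) f = s ↔ ∀ j, Nat.card {x : X // f x = j} = s j := by
  rw [funext_iff]
  refine forall_congr' fun j => ?_
  rw [sizes, Finset.sum_const, smul_eq_mul, mul_one, Nat.card_eq_fintype_card, Fintype.card_subtype]

theorem sameCycle_forall_iff {X κ : Type*} [Finite X] (σ : Perm X) (f : X → κ) :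
    (∀ x y, σ.SameCycle x y → f x = f y) ↔ ∀ x, f (σ x) = f x := by
  constructor
  · intro h x
    exact (h x (σ x) ⟨1, by simp⟩).symm
  · rintro h x y hxy
    obtain ⟨i, rfl⟩ := hxy.exists_nat_pow_eq
    have : ∀ i : ℕ, f ((σ ^ i) x) = f x := by
      intro i
      induction i with
      | zero => simp
      | succ i ih => rw [pow_succ', Perm.mul_apply, h, ih]
    exact (this i).symm

/-- A face given by a colouring passes the test of the character exactly when the colouring is
constant on the cycles of σ, that is, when the tabloid is fixed by σ. -/
theorem youngCharPerm_eq (R : Type*) [CommRing R] (q : Composition n) (σ : Perm (Fin n)) :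
    (youngCharPerm q σ : R) = faceChar R σ.SameCycle (faceSum R (Fin n) q.blocksFun) := by
  classical
  rw [faceChar_faceSum, youngCharPerm]
  congr 1
  refine Nat.card_congr (Equiv.subtypeEquivRight fun f => ?_)
  rw [sizes_one_eq_iff, sameCycle_forall_iff]

end Young

/-! ### The descent elements as images of face sums -/

section DescentSum

variable {n : ℕ}

theorem index_mono (q : Composition n) : Monotone q.index := by
  intro a b hab
  by_contra h
  push Not at h
  have h₁ := q.lt_sizeUpTo_index_succ b
  have h₂ := q.sizeUpTo_index_le a
  have h₃ : q.sizeUpTo (q.index b).succ ≤ q.sizeUpTo (q.index a) :=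
    q.monotone_sizeUpTo (by simpa using Nat.succ_le_of_lt h)
  have : (a : ℕ) ≤ b := hab
  omega

theorem sizes_index (q : Composition n) : sizes (fun _ => 1) q.index = q.blocksFun := by
  classical
  funext j
  rw [sizes, Finset.sum_const, smul_eq_mul, mul_one]
  have : (Finset.univ.filter fun x => q.index x = j)
      = Finset.univ.map (q.embedding j).toEmbedding := by
    ext x
    simp only [Finset.mem_filter, Finset.mem_univ, true_and, Finset.mem_map]
    rw [eq_comm, ← q.mem_range_embedding_iff']
    simp [Set.mem_range]
  rw [this, Finset.card_map, Finset.card_univ, Fintype.card_fin]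

theorem mem_lowerFinset_iff (S : Finset (Fin n)) (hS : ∀ a ∈ S, ∀ b ≤ a, b ∈ S) (a : Fin n) :
    a ∈ S ↔ (a : ℕ) < S.card := by
  constructor
  · intro ha
    have := Finset.card_le_card (show Finset.Iic a ⊆ S from fun b hb => hS a ha b (by simpa using hb))
    rw [Fin.card_Iic] at this
    omega
  · intro h
    by_contra ha
    have := Finset.card_le_card (show S ⊆ Finset.Iio a from fun b hb => by
      rw [Finset.mem_Iio]
      by_contra hab
      exact ha (hS b hb a (not_lt.1 hab)))
    rw [Fin.card_Iio] at this
    omega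

/-- The set where a monotone map is below j is an initial segment, determined by its cardinality,
which is a sum of fibre sizes. -/
theorem monotone_eq_of_sizes_eq {l : ℕ} {f g : Fin n → Fin l} (hf : Monotone f) (hg : Monotone g)
    (h : sizes (fun _ => 1) f = sizes (fun _ => 1) g) : f = g := by
  have hc : ∀ (f : Fin n → Fin l) (j : Fin l), (Finset.univ.filter fun a => f a < j).card
      = ∑ i with i < j, sizes (fun _ => 1) f i := by
    intro f j
    simp only [sizes]
    rw [Finset.card_eq_sum_ones, ← Finset.sum_fiberwise_of_maps_to
      (s := Finset.univ.filter fun a => f a < j) (t := Finset.univ.filter fun i => i < j) (g := f)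
      (fun a ha => by simpa using ha)]
    refine Finset.sum_congr rfl fun i hi => ?_
    congr 1
    ext a
    simp only [Finset.mem_filter, Finset.mem_univ, true_and] at hi ⊢
    exact ⟨fun h => h.2, fun h => ⟨h ▸ hi, h⟩⟩
  have hlt : ∀ a j, f a < j ↔ g a < j := by
    intro a j
    have h₁ := mem_lowerFinset_iff (Finset.univ.filter fun a => f a < j)
      (fun a ha b hb => by
        simp only [Finset.mem_filter, Finset.mem_univ, true_and] at ha ⊢
        exact (hf hb).trans_lt ha) a
    have h₂ := mem_lowerFinset_iff (Finset.univ.filter fun a => g a < j)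
      (fun a ha b hb => by
        simp only [Finset.mem_filter, Finset.mem_univ, true_and] at ha ⊢
        exact (hg hb).trans_lt ha) a
    rw [hc, h, ← hc, ← h₂] at h₁
    simpa using h₁
  funext a
  refine le_antisymm ?_ ?_
  · by_contra hlt'
    exact lt_irrefl _ ((hlt a (f a)).2 (not_le.1 hlt'))
  · by_contra hlt'
    exact lt_irrefl _ ((hlt a (g a)).1 (not_le.1 hlt'))

/-- The permutations in the sum `Ξ^q`. -/
theorem increasing_of_descents {q : Composition n} {σ : Perm (Fin n)}
    (h : descents σ ⊆ {i | ∃ j ∈ Finset.Icc 1 q.length, i = q.sizeUpTo j}) {a b : Fin n}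
    (hab : a ≤ b) (hi : q.index a = q.index b) : σ a ≤ σ b := by
  obtain ⟨a, ha⟩ := a
  obtain ⟨b, hb⟩ := b
  have hab' : a ≤ b := hab
  induction b, hab' using Nat.le_induction with
  | base => exact le_rfl
  | succ b hab' ih =>
    have hb' : b < n := Nat.lt_of_succ_lt hb
    have h₁ : q.index ⟨a, ha⟩ ≤ q.index ⟨b, hb'⟩ := index_mono q hab'
    have h₂ : q.index ⟨b, hb'⟩ ≤ q.index ⟨b + 1, hb⟩ := index_mono q (Nat.le_succ b)
    refine (ih hb' hab' (le_antisymm h₁ (hi ▸ h₂))).trans ?_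
    by_contra hlt
    obtain ⟨j, hj, hbj⟩ := h (show b + 1 ∈ descents σ from
      ⟨Nat.succ_pos b, hb, by simpa using not_le.1 hlt⟩)
    have h₃ : (q.index ⟨b, hb'⟩ : ℕ) = q.index ⟨b + 1, hb⟩ := by
      rw [← hi]; exact congrArg _ (le_antisymm (hi ▸ h₂) h₁)
    have h₄ := q.sizeUpTo_index_le ⟨b, hb'⟩
    have h₅ : b + 1 < q.sizeUpTo ((q.index ⟨b + 1, hb⟩ : ℕ) + 1) :=
      q.lt_sizeUpTo_index_succ ⟨b + 1, hb⟩
    simp only at h₄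
    rcases le_or_gt j (q.index ⟨b, hb'⟩) with hle | hlt'
    · have := q.monotone_sizeUpTo hle
      omega
    · have : q.sizeUpTo ((q.index ⟨b + 1, hb⟩ : ℕ) + 1) ≤ q.sizeUpTo j :=
        q.monotone_sizeUpTo (by omega)
      omega

theorem sortPerm_ofFun_rel {κ : Type*} [LinearOrder κ] (f : Fin n → κ) (τ : Perm (Fin n))
    (a b : Fin n) : a ≤ b ↔ f ((Face.ofFun f).sortPerm τ a) ≤ f ((Face.ofFun f).sortPerm τ b) ∧
      (f ((Face.ofFun f).sortPerm τ b) ≤ f ((Face.ofFun f).sortPerm τ a) →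
        τ⁻¹ ((Face.ofFun f).sortPerm τ a) ≤ τ⁻¹ ((Face.ofFun f).sortPerm τ b)) := by
  have := congrArg (fun t => t.rel ((Face.ofFun f).sortPerm τ a) ((Face.ofFun f).sortPerm τ b))
    (chamber_sortPerm (Face.ofFun f) τ)
  simpa [chamber_rel, Face.mul_rel, Face.ofFun_rel] using this

theorem comp_sortPerm_eq_index {q : Composition n} {f : Fin n → Fin q.length}
    (hf : sizes (fun _ => 1) f = q.blocksFun) (τ : Perm (Fin n)) (a : Fin n) :
    f ((Face.ofFun f).sortPerm τ a) = q.index a := by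
  have : (fun a => f ((Face.ofFun f).sortPerm τ a)) = q.index := by
    refine monotone_eq_of_sizes_eq ?_ (index_mono q) ?_
    · intro a b hab
      exact ((sortPerm_ofFun_rel f τ a b).1 hab).1
    · rw [sizes_comp_perm, hf, sizes_index]
  exact congrFun this a

/-- Applying the face of f to the identity lists the fibres of f one after the other, each
increasingly. The result can have descents only at partial sums of q, and f is recovered from σ as
`q.index` composed with σ⁻¹. -/
theorem toSym_faceSum (R : Type*) [CommRing R] (q : Composition n) :
    toSym R (faceSum R (Fin n) q.blocksFun) = Xi R q := by
  classical
  rw [faceSum, map_sum, Xi]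
  simp only [toSym_single, one_smul]
  refine Finset.sum_nbij' (fun f => (Face.ofFun f).sortPerm 1) (fun σ x => q.index (σ⁻¹ x))
    ?_ ?_ ?_ ?_ ?_
  · intro f hf
    simp only [Finset.mem_filter, Finset.mem_univ, true_and] at hf ⊢
    rintro i ⟨h₁, h₂, h₃⟩
    have hi := comp_sortPerm_eq_index hf 1
    have hrel := sortPerm_ofFun_rel f 1
    generalize (Face.ofFun f).sortPerm 1 = σ at *
    have h₄ := (hrel ⟨i - 1, by omega⟩ ⟨i, h₂⟩).1 (Nat.sub_le i 1)
    rw [hi, hi] at h₄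
    have h₅ : q.index ⟨i - 1, by omega⟩ < q.index ⟨i, h₂⟩ := by
      refine lt_of_le_not_ge h₄.1 fun h => ?_
      exact absurd (h₄.2 h) (by simpa using h₃)
    refine ⟨q.index ⟨i, h₂⟩, ?_, ?_⟩
    · rw [Finset.mem_Icc]
      have : (q.index ⟨i - 1, by omega⟩ : ℕ) < q.index ⟨i, h₂⟩ := h₅
      have := (q.index ⟨i, h₂⟩).2
      omega
    · have h₆ := q.sizeUpTo_index_le ⟨i, h₂⟩
      have h₇ := q.lt_sizeUpTo_index_succ ⟨i - 1, by omega⟩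
      have h₈ : q.sizeUpTo (q.index ⟨i - 1, by omega⟩).succ ≤ q.sizeUpTo (q.index ⟨i, h₂⟩) :=
        q.monotone_sizeUpTo (by simpa using Nat.succ_le_of_lt h₅)
      simp only at h₆ h₇
      omega
  · intro σ _
    simp only [Finset.mem_filter, Finset.mem_univ, true_and]
    rw [sizes_comp_perm q.index σ⁻¹, sizes_index]
  · intro f hf
    simp only [Finset.mem_filter, Finset.mem_univ, true_and] at hf
    funext x
    rw [← comp_sortPerm_eq_index hf 1]
    simp
  · intro σ hσ
    simp only [Finset.mem_filter, Finset.mem_univ, true_and] at hσ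
    rw [sortPerm_eq_iff]
    refine Face.ext_of_rel_iff fun x y => ?_
    rw [chamber_rel, Face.mul_rel, Face.ofFun_rel, Face.ofFun_rel, chamber_rel]
    simp only [inv_one, Perm.one_apply]
    obtain ⟨a, rfl⟩ := σ.surjective x
    obtain ⟨b, rfl⟩ := σ.surjective y
    simp only [Equiv.Perm.coe_inv, Equiv.symm_apply_apply]
    constructor
    · intro hab
      exact ⟨index_mono q hab, fun h =>
        increasing_of_descents hσ hab (le_antisymm (index_mono q hab) h)⟩
    · rintro ⟨h₁, h₂⟩
      by_contra hab
      have hba := (not_le.1 hab).le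
      have h₃ := h₂ (index_mono q hba)
      have h₄ := increasing_of_descents hσ hba (le_antisymm (index_mono q hba) h₁)
      exact hab (σ.injective (le_antisymm h₃ h₄)).le
  · intro f _
    rfl

end DescentSum

/-! ### Weighted colourings -/

section Counting

theorem sum_sizes {X κ : Type*} [Fintype X] [Fintype κ] [DecidableEq κ] (d : X → ℕ) (f : X → κ) :
    ∑ j, sizes d f j = ∑ x, d x := by
  simp only [sizes]
  exact Finset.sum_fiberwise _ _ _

theorem sizes_comp {X ι κ : Type*} [Fintype X] [Fintype ι] [DecidableEq ι] [DecidableEq κ]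
    (d : X → ℕ) (u : X → ι) (g : ι → κ) :
    sizes d (fun x => g (u x)) = sizes (sizes d u) g := by
  funext j
  simp only [sizes]
  rw [← Finset.sum_fiberwise_of_maps_to (s := Finset.univ.filter fun x => g (u x) = j)
    (t := Finset.univ.filter fun i => g i = j) (g := u) (fun x hx => by simpa using hx)]
  refine Finset.sum_congr rfl fun i hi => Finset.sum_congr ?_ fun _ _ => rfl
  ext x
  simp only [Finset.mem_filter, Finset.mem_univ, true_and] at hi ⊢
  exact ⟨fun h => h.2, fun h => ⟨h ▸ hi, h⟩⟩

/-- Colourings that are constant on the fibres of a surjection are colourings of its range. -/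
noncomputable def constColouringEquiv {X ι κ : Type*} [Fintype X] [Fintype ι] [DecidableEq ι]
    [DecidableEq κ] (d : X → ℕ) (u : X → ι) (hu : Function.Surjective u) (s : κ → ℕ) :
    {f : X → κ // sizes d f = s ∧ ∀ x y, u x = u y → f x = f y} ≃
      {g : ι → κ // sizes (sizes d u) g = s} where
  toFun f := ⟨fun i => f.1 (hu i).choose, by
    refine (sizes_comp d u _).symm.trans (Eq.trans ?_ f.2.1)
    congr 1
    funext x
    exact f.2.2 _ _ (hu (u x)).choose_spec⟩
  invFun g := ⟨fun x => g.1 (u x), by rw [sizes_comp, g.2], fun _ _ h => congrArg g.1 h⟩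
  left_inv f := Subtype.ext (funext fun x => f.2.2 _ _ (hu (u x)).choose_spec)
  right_inv g := Subtype.ext (funext fun i => by
    change g.1 (u (hu i).choose) = g.1 i
    rw [(hu i).choose_spec])

/-- The product of the power sums indexed by a multiset. -/
noncomputable def psumProd (R : Type*) [CommRing R] (l : ℕ) (M : Multiset ℕ) :
    MvPolynomial (Fin l) R := (M.map fun i => MvPolynomial.psum (Fin l) R i).prod

/-- Expanding the product of power sums means choosing a variable, that is a colour, in each factor;
the exponents of the resulting monomial are the weights of the colours. -/
theorem card_colourings_eq_coeff (R : Type*) [CommRing R] {ι : Type*} [Fintype ι] [DecidableEq ι]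
    {l : ℕ} (d : ι → ℕ) (s : Fin l → ℕ) :
    (Nat.card {g : ι → Fin l // sizes d g = s} : R) =
      (psumProd R l (Finset.univ.val.map d)).coeff (Finsupp.equivFunOnFinite.symm s) := by
  classical
  have h₁ : psumProd R l (Finset.univ.val.map d) = ∏ i, ∑ j, MvPolynomial.X j ^ d i := by
    rw [psumProd, Multiset.map_map]; rfl
  rw [h₁, Finset.prod_univ_sum, MvPolynomial.coeff_sum, Nat.card_eq_fintype_card,
    Fintype.card_subtype, Finset.card_filter, Nat.cast_sum, Fintype.piFinset_univ]
  refine Finset.sum_congr rfl fun g _ => ?_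
  have h₂ : ∏ i, (MvPolynomial.X (g i) : MvPolynomial (Fin l) R) ^ d i
      = MvPolynomial.monomial (∑ i, Finsupp.single (g i) (d i)) 1 := by
    rw [MvPolynomial.monomial_sum_one]
    exact Finset.prod_congr rfl fun i _ => MvPolynomial.X_pow_eq_monomial
  rw [h₂, MvPolynomial.coeff_monomial]
  push_cast
  refine if_congr ?_ rfl rfl
  rw [Finsupp.ext_iff, funext_iff]
  refine forall_congr' fun j => ?_
  simp [Finsupp.finsetSum_apply, Finsupp.single_apply, sizes, Finset.sum_filter]

theorem faceChar_faceSum_eq_coeff (R : Type*) [CommRing R] {X ι : Type*} [Fintype X]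
    [DecidableEq X] [Fintype ι] [DecidableEq ι] {l : ℕ} (s : Fin l → ℕ) {E : X → X → Prop}
    {u : X → ι} (hu : Function.Surjective u) (hE : ∀ x y, E x y ↔ u x = u y) :
    faceChar R E (faceSum R X s) = (psumProd R l (Finset.univ.val.map
      (sizes (fun _ => 1) u))).coeff (Finsupp.equivFunOnFinite.symm s) := by
  rw [faceChar_faceSum, ← card_colourings_eq_coeff]
  simp only [hE]
  rw [Nat.card_congr (constColouringEquiv _ u hu s)]

/-- In characteristic `p`, equal power sums may be merged, `p` at a time. -/
theorem exists_regular_psumProd (F : Type*) [Field F] {p : ℕ} (hp : p.Prime) [CharP F p]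
    (M : Multiset ℕ) (hM : ∀ i ∈ M, 0 < i) :
    ∃ M' : Multiset ℕ, M'.sum = M.sum ∧ (∀ i ∈ M', 0 < i) ∧ (∀ i, M'.count i < p) ∧
      ∀ l, psumProd F l M' = psumProd F l M := by
  induction hc : M.card using Nat.strong_induction_on generalizing M with
  | _ k ih =>
    subst hc
    by_cases h : ∀ i, M.count i < p
    · exact ⟨M, rfl, hM, h, fun _ => rfl⟩
    · push Not at h
      obtain ⟨i, hi⟩ := h
      obtain ⟨M₁, rfl⟩ := Multiset.le_iff_exists_add.1 (Multiset.le_count_iff_replicate_le.1 hi)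
      have hi0 : 0 < i := hM i (by
        rw [Multiset.mem_add, Multiset.mem_replicate]; exact Or.inl ⟨hp.ne_zero, rfl⟩)
      -- Replacing p copies of i by one part p * i keeps the sum and lowers the number of parts,
      -- since p ≥ 2.
      obtain ⟨M', h₁, h₂, h₃, h₄⟩ := ih (Multiset.card ((p * i) ::ₘ M₁))
        (by simp only [Multiset.card_cons, Multiset.card_add, Multiset.card_replicate]
            have := hp.two_le; omega) ((p * i) ::ₘ M₁)
        (fun j hj => by
          rcases Multiset.mem_cons.1 hj with rfl | hj
          · exact Nat.mul_pos hp.pos hi0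
          · exact hM j (Multiset.mem_add.2 (Or.inr hj))) rfl
      refine ⟨M', by rw [h₁]; simp, h₂, h₃, fun l => ?_⟩
      rw [h₄]
      have : CharP (MvPolynomial (Fin l) F) p := inferInstance
      have : ExpChar (MvPolynomial (Fin l) F) p := ExpChar.prime hp
      simp only [psumProd, Multiset.map_cons, Multiset.prod_cons, Multiset.map_add,
        Multiset.prod_add, Multiset.map_replicate, Multiset.prod_replicate]
      -- Frobenius: the p-th power of the power sum of degree i is the power sum of degree p * i.
      rw [MvPolynomial.psum, MvPolynomial.psum, sum_pow_char]
      simp only [← pow_mul, mul_comm p i]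

theorem exists_equiv_of_map_eq {α β : Type*} [Fintype α] [Fintype β] {d : α → ℕ} {b : β → ℕ}
    (h : Finset.univ.val.map d = Finset.univ.val.map b) : ∃ e : α ≃ β, ∀ a, b (e a) = d a := by
  classical
  have hc : ∀ c, Nonempty ({a // d a = c} ≃ {a // b a = c}) := by
    intro c
    have := congrArg (Multiset.count c) h
    rw [Multiset.count_map, Multiset.count_map] at this
    refine ⟨Fintype.equivOfCardEq ?_⟩
    rw [Fintype.card_subtype, Fintype.card_subtype, Finset.card, Finset.card, Finset.filter_val,
      Finset.filter_val]
    simpa only [eq_comm] using this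
  exact ⟨Equiv.ofFiberEquiv fun c => (hc c).some, fun a => Equiv.ofFiberEquiv_map _ a⟩

theorem surjective_of_sizes_pos {ι κ : Type*} [Fintype ι] [DecidableEq κ] {d : ι → ℕ} {s : κ → ℕ}
    (hs : ∀ j, 0 < s j) {g : ι → κ} (hg : sizes d g = s) : Function.Surjective g := by
  intro j
  by_contra h
  push Not at h
  have h₁ := hs j
  rw [← hg, sizes, Finset.filter_false_of_mem (fun x _ => h x)] at h₁
  simp at h₁

theorem sizes_of_injective {ι κ : Type*} [Fintype ι] [DecidableEq κ] {d : ι → ℕ}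
    {g : ι → κ} (hg : Function.Injective g) (i : ι) : sizes d g (g i) = d i := by
  classical
  rw [sizes, Finset.sum_eq_single i]
  · intro b hb hbi
    exact absurd (hg (by simpa using hb)) hbi
  · simp

/-- The number of permutations of the positions of `s` that preserve `s`. -/
noncomputable def symCount {l : ℕ} (s : Fin l → ℕ) : ℕ := Nat.card {h : Perm (Fin l) // s ∘ h = s}

/-- A colouring of as many objects as there are colours with all colours used is a bijection. -/
theorem card_bijective_colourings {ι : Type*} [Fintype ι] [DecidableEq ι] {l : ℕ} {d : ι → ℕ}
    {s : Fin l → ℕ} (h : Finset.univ.val.map d = Finset.univ.val.map s) :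
    Nat.card {g : ι → Fin l // Function.Bijective g ∧ sizes d g = s} = symCount s := by
  obtain ⟨e, he⟩ := exists_equiv_of_map_eq h
  refine Nat.card_congr
    { toFun := fun g => ⟨e.symm.trans (Equiv.ofBijective g.1 g.2.1), ?_⟩
      invFun := fun π => ⟨fun i => π.1 (e i), (e.trans π.1).bijective, ?_⟩
      left_inv := fun g => Subtype.ext (funext fun i => by simp)
      right_inv := fun π => Subtype.ext (Equiv.ext fun j => by simp) }
  · funext j
    obtain ⟨i, rfl⟩ := e.surjective j
    simp only [Function.comp_apply, Equiv.trans_apply, Equiv.symm_apply_apply,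
      Equiv.ofBijective_apply]
    rw [he, ← sizes_of_injective (d := d) g.2.1.injective i, g.2.2]
  · funext j
    obtain ⟨i, rfl⟩ := (e.trans π.1).surjective j
    have := sizes_of_injective (d := d) (g := fun i => π.1 (e i)) (e.trans π.1).injective i
    simp only [Equiv.trans_apply]
    rw [this, ← he i]
    exact (congrFun π.2 (e i)).symm

theorem symCount_eq_prod {l : ℕ} (s : Fin l → ℕ) :
    symCount s = ∏ i ∈ (Finset.univ.val.map s).toFinset,
      ((Finset.univ.val.map s).count i).factorial := by
  classical
  rw [symCount, Nat.card_eq_fintype_card, DomMulAct.stabilizer_card']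
  have : Finset.univ.image s = (Finset.univ.val.map s).toFinset := by
    ext; simp
  rw [this]
  refine Finset.prod_congr rfl fun i _ => ?_
  rw [Multiset.count_map, Fintype.card_subtype, Finset.card, Finset.filter_val]
  simp only [eq_comm]

theorem symCount_cast_ne_zero (F : Type*) [Field F] {p : ℕ} (hp : p.Prime) [CharP F p] {l : ℕ}
    {s : Fin l → ℕ} (h : ∀ i, (Finset.univ.val.map s).count i < p) : (symCount s : F) ≠ 0 := by
  rw [symCount_eq_prod, Nat.cast_prod, Finset.prod_ne_zero_iff]
  intro i _ h0
  rw [CharP.cast_eq_zero_iff F p, hp.dvd_factorial] at h0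
  exact absurd (h i) (not_lt.2 h0)

end Counting

/-! ### Cycles of permutations and blocks of faces -/

section Cycles

theorem exists_surjection_of_setoid {X : Type*} [Fintype X] (r : Setoid X) :
    ∃ (k : ℕ) (u : X → Fin k), Function.Surjective u ∧ ∀ x y, r x y ↔ u x = u y := by
  classical
  let e := Fintype.equivFin (Quotient r)
  refine ⟨_, fun x => e (Quotient.mk r x), fun j => ?_, fun x y => ?_⟩
  · obtain ⟨x, hx⟩ := Quotient.exists_rep (e.symm j)
    exact ⟨x, (congrArg e hx).trans (e.apply_symm_apply j)⟩
  · rw [e.injective.eq_iff, Quotient.eq]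

/-- The cycle type omits fixed points, whereas the fibres of u include them. The fibres of moved
points (the set `A`) give the cycle type, and the remaining ones give the parts equal to 1. -/
theorem map_sizes_eq_partition {X : Type*} [Fintype X] [DecidableEq X] {ι : Type*} [Fintype ι]
    [DecidableEq ι] (σ : Perm X) {u : X → ι} (hu : Function.Surjective u)
    (hE : ∀ x y, σ.SameCycle x y ↔ u x = u y) :
    Finset.univ.val.map (sizes (fun _ => 1) u) = σ.partition.parts := by
  classical
  let v : ι → X := fun i => (hu i).choose
  have hv : ∀ i, u (v i) = i := fun i => (hu i).choose_spec
  have hsize : ∀ i, sizes (fun _ => 1) u i = (Finset.univ.filter fun x => u x = i).card := by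
    intro i; simp [sizes]
  let A : Finset ι := Finset.univ.filter fun i => σ (v i) ≠ v i
  have hA : ∀ i ∈ A, sizes (fun _ => 1) u i = (σ.cycleOf (v i)).support.card := by
    intro i hi
    rw [hsize]
    congr 1
    ext x
    have hi' : σ (v i) ≠ v i := by simpa [A] using hi
    rw [Perm.mem_support_cycleOf_iff' hi', hE, hv]
    simp [eq_comm]
  have hinj : Set.InjOn (fun i => σ.cycleOf (v i)) A := by
    intro i hi j hj hij
    have hi' : σ (v i) ≠ v i := by simpa [A] using hi
    have hj' : σ (v j) ≠ v j := by simpa [A] using hj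
    have := (Perm.sameCycle_iff_cycleOf_eq_of_mem_support (Perm.mem_support.2 hi')
      (Perm.mem_support.2 hj')).2 hij
    rw [hE, hv, hv] at this
    exact this
  have himage : A.image (fun i => σ.cycleOf (v i)) = σ.cycleFactorsFinset := by
    ext c
    rw [Finset.mem_image]
    constructor
    · rintro ⟨i, hi, rfl⟩
      have hi' : σ (v i) ≠ v i := by simpa [A] using hi
      exact Perm.cycleOf_mem_cycleFactorsFinset_iff.2 (Perm.mem_support.2 hi')
    · intro hc
      have hcyc := (Perm.mem_cycleFactorsFinset_iff.1 hc).1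
      obtain ⟨a, ha⟩ := hcyc.nonempty_support
      have hca := Perm.cycle_is_cycleOf ha hc
      have haσ : a ∈ σ.support := Perm.mem_cycleFactorsFinset_support_le hc ha
      have hsame : σ.SameCycle (v (u a)) a := (hE _ _).2 (hv _)
      refine ⟨u a, ?_, ?_⟩
      · have := hsame.apply_eq_self_iff
        simp only [A, Finset.mem_filter, Finset.mem_univ, true_and, Ne, this]
        exact Perm.mem_support.1 haσ
      · rw [hca, hsame.cycleOf_eq]
  have h₁ : A.val.map (sizes (fun _ => 1) u) = σ.cycleType := by
    rw [Perm.cycleType_def, ← himage, Finset.image_val_of_injOn hinj, Multiset.map_map]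
    exact Multiset.map_congr rfl fun i hi => hA i hi
  have h₂ : ∀ i ∈ Finset.univ.filter (fun i => ¬ σ (v i) ≠ v i), sizes (fun _ => 1) u i = 1 := by
    intro i hi
    have hi' : σ (v i) = v i := by simpa using hi
    rw [hsize, Finset.card_eq_one]
    refine ⟨v i, ?_⟩
    ext x
    simp only [Finset.mem_filter, Finset.mem_univ, true_and, Finset.mem_singleton]
    constructor
    · intro hx
      have : σ.SameCycle (v i) x := (hE _ _).2 (by rw [hv, hx])
      exact (this.eq_of_left hi').symm
    · rintro rfl
      exact hv i
  have h₃ : (Finset.univ.filter fun i => ¬ σ (v i) ≠ v i).val.map (sizes (fun _ => 1) u)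
      = Multiset.replicate (Fintype.card X - σ.support.card) 1 := by
    have h₄ : (Finset.univ.filter fun i => ¬ σ (v i) ≠ v i).val.map (sizes (fun _ => 1) u)
        = Multiset.replicate (Finset.univ.filter fun i => ¬ σ (v i) ≠ v i).card 1 := by
      rw [Multiset.map_congr rfl h₂, Multiset.map_const']
      rfl
    rw [h₄]
    congr 1
    have h₅ := sum_sizes (fun _ : X => 1) u
    rw [← Finset.sum_filter_add_sum_filter_not _ (fun i => σ (v i) ≠ v i),
      Finset.sum_congr rfl h₂] at h₅
    have h₆ : ∑ i with σ (v i) ≠ v i, sizes (fun _ => 1) u i = σ.support.card := by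
      rw [← Perm.sum_cycleType, ← h₁]; rfl
    rw [h₆] at h₅
    simp only [Finset.sum_const, smul_eq_mul, mul_one, Finset.card_univ] at h₅
    omega
  rw [Perm.parts_partition, ← h₁, ← h₃, ← Multiset.map_add]
  congr 1
  exact (Multiset.filter_add_not _ _).symm

theorem exists_cycle_map {X : Type*} [Fintype X] [DecidableEq X] (σ : Perm X) :
    ∃ (k : ℕ) (u : X → Fin k), Function.Surjective u ∧ (∀ x y, σ.SameCycle x y ↔ u x = u y) ∧
      Finset.univ.val.map (sizes (fun _ => 1) u) = σ.partition.parts := by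
  obtain ⟨k, u, hu, hE⟩ := exists_surjection_of_setoid (Perm.SameCycle.setoid σ)
  exact ⟨k, u, hu, hE, map_sizes_eq_partition σ hu hE⟩

/-- The blocks of a face as a setoid. -/
def Face.blockSetoid {X : Type*} (t : Face X) : Setoid X where
  r := t.block
  iseqv :=
    { refl := fun x => ⟨t.refl x, t.refl x⟩
      symm := fun h => ⟨h.2, h.1⟩
      trans := fun h h' => ⟨t.trans _ _ _ h.1 h'.1, t.trans _ _ _ h'.2 h.2⟩ }

end Cycles

/-! ### The descent algebra inside the face algebra -/

section Descent

variable (R : Type*) [CommRing R] (X : Type*) [Fintype X] [DecidableEq X]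

/-- The subalgebra generated by the sums of faces of a given type. -/
noncomputable def faceDescent : Subalgebra R (FaceAlg R X) :=
  Algebra.adjoin R {y | ∃ (l : ℕ) (s : Fin l → ℕ), y = faceSum R X s}

variable {X}

theorem faceSum_mem_faceDescent {l : ℕ} (s : Fin l → ℕ) : faceSum R X s ∈ faceDescent R X :=
  Algebra.subset_adjoin ⟨l, s, rfl⟩

variable (X) in
theorem faceDescent_le_faceInvariants : faceDescent R X ≤ faceInvariants R X :=
  Algebra.adjoin_le fun y hy => by
    obtain ⟨l, s, rfl⟩ := hy
    exact faceSum_mem_faceInvariants R s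

variable {R}

theorem faceChar_eq_of_mem_faceDescent {E E' : X → X → Prop}
    (h : ∀ (l : ℕ) (s : Fin l → ℕ), faceChar R E (faceSum R X s) = faceChar R E' (faceSum R X s))
    {y : FaceAlg R X} (hy : y ∈ faceDescent R X) : faceChar R E y = faceChar R E' y := by
  have : faceDescent R X ≤ AlgHom.equalizer (faceChar R E) (faceChar R E') :=
    Algebra.adjoin_le fun y hy => by
      obtain ⟨l, s, rfl⟩ := hy
      exact h l s
  exact this hy

end Descent

section Regular

variable {F : Type*} [Field F] {p : ℕ} {n : ℕ}

/-- The character of the descent algebra attached to a partition. -/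
noncomputable def partChar (R : Type*) [CommRing R] {n : ℕ} (μ : n.Partition) :
    FaceAlg R (Fin n) →ₐ[R] R := faceChar R (ccl_nonempty μ).choose.SameCycle

theorem partChar_faceSum (R : Type*) [CommRing R] (μ : n.Partition) (q : Composition n) :
    partChar R μ (faceSum R (Fin n) q.blocksFun) = youngChar q μ := by
  rw [partChar, ← youngCharPerm_eq, youngChar]

theorem exists_cycle_map_choose (μ : n.Partition) :
    ∃ (k : ℕ) (u : Fin n → Fin k), Function.Surjective u ∧
      (∀ x y, (ccl_nonempty μ).choose.SameCycle x y ↔ u x = u y) ∧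
      Finset.univ.val.map (sizes (fun _ => 1) u) = μ.parts := by
  obtain ⟨k, u, hu, hE, h⟩ := exists_cycle_map (ccl_nonempty μ).choose
  exact ⟨k, u, hu, hE, h.trans (ccl_nonempty μ).choose_spec⟩

/-- On the descent subalgebra a character depends only on the product of power sums over the block
sizes. Merging equal parts p at a time does not change this product and ends at a p-regular
partition. -/
theorem exists_partChar_eq (hp : p.Prime) [CharP F p] (t : Face (Fin n)) :
    ∃ μ : RegPart p n, ∀ y ∈ faceDescent F (Fin n), faceChar F t.block y = partChar F μ.1 y := by
  classical
  obtain ⟨k, u, hu, hE⟩ := exists_surjection_of_setoid t.blockSetoid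
  obtain ⟨M', h₁, h₂, h₃, h₄⟩ := exists_regular_psumProd F hp
    (Finset.univ.val.map (sizes (fun _ => 1) u)) (by
      intro i hi
      obtain ⟨j, -, rfl⟩ := Multiset.mem_map.1 hi
      obtain ⟨x, rfl⟩ := hu j
      rw [sizes, Finset.sum_const, smul_eq_mul, mul_one]
      exact Finset.card_pos.2 ⟨x, by simp⟩)
  have hsum : M'.sum = n := by
    rw [h₁]
    refine (sum_sizes (fun _ : Fin n => 1) u).trans ?_
    simp
  refine ⟨⟨⟨M', fun hi => h₂ _ hi, hsum⟩, h₃⟩, fun y hy =>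
    faceChar_eq_of_mem_faceDescent (fun l s => ?_) hy⟩
  obtain ⟨k', u', hu', hE', hM'⟩ := exists_cycle_map_choose (⟨M', fun hi => h₂ _ hi, hsum⟩ : n.Partition)
  refine (faceChar_faceSum_eq_coeff F s hu hE).trans (Eq.symm ?_)
  refine (faceChar_faceSum_eq_coeff F s hu' hE').trans ?_
  rw [hM', h₄]

theorem pow_eq_zero_of_partChar (hp : p.Prime) [CharP F p] {y : FaceAlg F (Fin n)}
    (hy : y ∈ faceDescent F (Fin n)) (h : ∀ μ : RegPart p n, partChar F μ.1 y = 0) :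
    y ^ p ^ n = 0 := by
  have := pow_prime_pow_eq_zero hp (y := y) fun t => by
    obtain ⟨μ, hμ⟩ := exists_partChar_eq (F := F) hp t
    rw [hμ y hy, h]
  rwa [Fintype.card_fin] at this

end Regular

/-! ### Young characters are triangular -/

section Triangular

variable {n : ℕ}

theorem map_blocksFun (q : Composition n) :
    Finset.univ.val.map q.blocksFun = (q.blocks : Multiset ℕ) := by
  rw [Fin.univ_val_map, q.ofFn_blocksFun]

theorem coe_blocks_toComp (μ : n.Partition) : ((toComp μ).blocks : Multiset ℕ) = μ.parts :=
  Multiset.sort_eq _ _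

theorem youngChar_eq_card {k : ℕ} {μ : n.Partition} {u : Fin n → Fin k}
    (hu : Function.Surjective u)
    (hE : ∀ x y, (ccl_nonempty μ).choose.SameCycle x y ↔ u x = u y) (q : Composition n) :
    youngChar q μ = Nat.card {g : Fin k → Fin q.length //
      sizes (sizes (fun _ => 1) u) g = q.blocksFun} := by
  have h := partChar_faceSum ℤ μ q
  rw [partChar, faceChar_faceSum] at h
  rw [← Nat.card_congr (constColouringEquiv (fun _ => 1) u hu q.blocksFun)]
  simp only [hE] at h
  exact_mod_cast h.symm

/-- A colouring counted by the Young character groups the parts of μ into sublists whose sums are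
the parts of κ. -/
theorem weakRef_of_youngChar_ne_zero {κ μ : n.Partition} (h : youngChar (toComp κ) μ ≠ 0) :
    WeakRef (toComp μ) (toComp κ) := by
  classical
  obtain ⟨k, u, hu, hE, hparts⟩ := exists_cycle_map_choose μ
  rw [youngChar_eq_card hu hE] at h
  obtain ⟨⟨g, hg⟩⟩ := (Nat.card_ne_zero.1 h).1
  generalize sizes (fun _ => 1) u = d at *
  have hd : ∀ i, 0 < d i := fun i => μ.parts_pos (hparts ▸ Multiset.mem_map_of_mem d
    (Finset.mem_univ i))
  let L : List (List ℕ) := List.ofFn fun j : Fin (toComp κ).length =>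
    (Finset.univ.filter fun i => g i = j).toList.map d
  have hperm : L.flatten.Perm (toComp μ).blocks := by
    rw [← Multiset.coe_eq_coe, coe_blocks_toComp, ← hparts]
    ext a
    rw [Multiset.coe_count, List.count_flatten, List.map_ofFn, List.sum_ofFn, Multiset.count_map]
    have : ∀ j, (List.count a ∘ fun j => (Finset.univ.filter fun i => g i = j).toList.map d) j
        = ((Finset.univ.filter fun i => a = d i).filter fun i => g i = j).card := by
      intro j
      rw [Function.comp_apply, ← Multiset.coe_count, ← Multiset.map_coe, Finset.coe_toList,
        Multiset.count_map, ← Finset.filter_val, ← Finset.card_def, Finset.filter_comm]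
    rw [Finset.sum_congr rfl fun j _ => this j, ← Finset.filter_val, ← Finset.card_def,
      Finset.card_eq_sum_card_fiberwise (f := g) (t := Finset.univ)]
    intro x _
    simp
  refine ⟨⟨L.flatten, fun {i} hi => (toComp μ).blocks_pos (hperm.mem_iff.1 hi), ?_⟩, hperm, L, rfl, ?_⟩
  · rw [hperm.sum_eq, (toComp μ).blocks_sum]
  · rw [← (toComp κ).ofFn_blocksFun, ← hg, List.map_ofFn]
    congr 1
    funext j
    rw [Function.comp_apply, sizes, Finset.sum_map_toList]

/-- There are as many cycles as colours and every colour must occur, so each colouring that is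
counted is a bijection. -/
theorem youngChar_self (μ : n.Partition) :
    youngChar (toComp μ) μ = symCount (toComp μ).blocksFun := by
  obtain ⟨k, u, hu, hE, hparts⟩ := exists_cycle_map_choose μ
  have hmap := hparts.trans ((coe_blocks_toComp μ).symm.trans (map_blocksFun _).symm)
  rw [youngChar_eq_card hu hE, ← card_bijective_colourings hmap]
  refine Nat.card_congr (Equiv.subtypeEquivRight fun g => ?_)
  refine ⟨fun hg => ⟨?_, hg⟩, fun h => h.2⟩
  have hsurj := surjective_of_sizes_pos (fun j => (toComp μ).one_le_blocksFun j) hg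
  refine (Fintype.bijective_iff_surjective_and_card g).2 ⟨hsurj, ?_⟩
  simpa using congrArg Multiset.card hmap

variable {F : Type*} [Field F] {p m : ℕ}

/-- In an order refining `WeakRef` the matrix is triangular. Its diagonal entries are products of
factorials of multiplicities, which are below p by regularity. -/
theorem isUnit_det_youngMatrix (hp : p.Prime) [CharP F p] (ν : Fin m ≃ RegPart p n)
    (hν : ∀ i j : Fin m, WeakRef (toComp (ν i).1) (toComp (ν j).1) → i ≤ j) :
    IsUnit (youngMatrix F p n).det := by
  classical
  rw [← Matrix.det_submatrix_equiv_self ν, Matrix.det_of_isLowerTriangular, isUnit_iff_ne_zero,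
    Finset.prod_ne_zero_iff]
  · intro i _
    rw [Matrix.submatrix_apply, youngMatrix, Matrix.of_apply, youngChar_self]
    refine symCount_cast_ne_zero F hp fun j => ?_
    rw [map_blocksFun, coe_blocks_toComp]
    exact (ν i).2 j
  · intro i j hij
    rw [Matrix.submatrix_apply, youngMatrix, Matrix.of_apply]
    by_contra h
    have := hν j i (weakRef_of_youngChar_ne_zero fun h0 => h (by rw [h0, Nat.cast_zero]))
    exact absurd hij (not_lt.2 this)

end Triangular

/-! ### Lifting the modular idempotents to the face algebra -/

section Lift

variable {F : Type*} [Field F] {p n m : ℕ}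

/-- All characters kill x² - x, so its p^n-th power vanishes; by Frobenius for the commuting
elements x² and x this power is the difference of their p^n-th powers. -/
theorem isIdempotentElem_pow (hp : p.Prime) [CharP F p] {x : FaceAlg F (Fin n)}
    (hx : x ∈ faceDescent F (Fin n))
    (h : ∀ μ : RegPart p n, IsIdempotentElem (partChar F μ.1 x)) :
    IsIdempotentElem (x ^ p ^ n) := by
  have : CharP (FaceAlg F (Fin n)) p := charP_of_injective_algebraMap' F p
  have : ExpChar (FaceAlg F (Fin n)) p := ExpChar.prime hp
  have h₁ := pow_eq_zero_of_partChar hp (y := x * x - x) (sub_mem (mul_mem hx hx) hx)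
    fun μ => by rw [map_sub, map_mul, h μ, sub_self]
  rw [sub_pow_expChar_pow_of_commute _ _ ((Commute.refl x).mul_left (Commute.refl x)),
    sub_eq_zero, (Commute.refl x).mul_pow] at h₁
  exact h₁

/-- Inverting the matrix of Young characters makes the lifts dual to the characters. -/
theorem exists_lift_fElt (hp : p.Prime) [CharP F p] (ν : Fin m ≃ RegPart p n)
    (hν : ∀ i j : Fin m, WeakRef (toComp (ν i).1) (toComp (ν j).1) → i ≤ j) (l : RegPart p n) :
    ∃ y ∈ faceDescent F (Fin n), toSym F y = fElt F l ∧
      ∀ i, partChar F (ν i).1 y = if ν i = l then 1 else 0 := by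
  classical
  refine ⟨∑ μ : RegPart p n, (youngMatrix F p n)⁻¹ l μ • faceSum F (Fin n) (toComp μ.1).blocksFun,
    sum_mem fun μ _ => Subalgebra.smul_mem _ (faceSum_mem_faceDescent F _) _, ?_, fun i => ?_⟩
  · rw [map_sum, fElt]
    exact Finset.sum_congr rfl fun μ _ => by rw [map_smul, toSym_faceSum]
  · have h := congrFun (congrFun (Matrix.nonsing_inv_mul _ (isUnit_det_youngMatrix (F := F) hp ν hν)) l)
      (ν i)
    rw [Matrix.mul_apply, Matrix.one_apply] at h
    rw [map_sum]
    simp only [eq_comm (a := ν i)]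
    rw [← h]
    refine Finset.sum_congr rfl fun μ _ => ?_
    rw [map_smul, partChar_faceSum, smul_eq_mul]
    rfl

theorem exists_lift_fGe (hp : p.Prime) [CharP F p] (ν : Fin m ≃ RegPart p n)
    (hν : ∀ i j : Fin m, WeakRef (toComp (ν i).1) (toComp (ν j).1) → i ≤ j) (k : ℕ) :
    ∃ y ∈ faceDescent F (Fin n), toSym F y = fGe F ν k ∧
      ∀ i : Fin m, partChar F (ν i).1 y = if k ≤ i.val then 1 else 0 := by
  classical
  choose y hy h₁ h₂ using exists_lift_fElt (F := F) hp ν hν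
  refine ⟨∑ j : Fin m with k ≤ j.val, y (ν j), sum_mem fun j _ => hy _, ?_, fun i => ?_⟩
  · rw [map_sum, fGe]
    exact Finset.sum_congr rfl fun μ _ => h₁ _
  · rw [map_sum]
    simp only [h₂, ν.injective.eq_iff]
    rw [Finset.sum_ite_eq]
    simp

/-- The conclusion also carries the lift of the preceding term, because the difference of two
idempotents is idempotent once one absorbs the other on both sides. Absorption holds since the new
term is a positive power of an element of the form f g f. -/
theorem exists_lift_fPrime (hp : p.Prime) [CharP F p] (ν : Fin m ≃ RegPart p n)
    (hν : ∀ i j : Fin m, WeakRef (toComp (ν i).1) (toComp (ν j).1) → i ≤ j) (k : ℕ) (hk : k ≤ m) :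
    ∃ y ∈ faceDescent F (Fin n), toSym F y = fPrime F ν k ∧ IsIdempotentElem y ∧
      (∀ i : Fin m, partChar F (ν i).1 y = if k ≤ i.val then 1 else 0) ∧
      (∀ k', k = k' + 1 → ∃ y' ∈ faceDescent F (Fin n), toSym F y' = fPrime F ν k' ∧
        IsIdempotentElem y' ∧ y' * y = y ∧ y * y' = y ∧
        ∀ i : Fin m, partChar F (ν i).1 y' = if k' ≤ i.val then 1 else 0) := by
  induction k with
  | zero =>
    refine ⟨1, one_mem _, ?_, IsIdempotentElem.one, fun i => ?_, fun k' h => by omega⟩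
    · rw [toSym_one, fPrime]
    · simp
  | succ k ih =>
    obtain ⟨f, hf, hf₁, hf₂, hf₃, -⟩ := ih (by omega)
    obtain ⟨g, hg, hg₁, hg₂⟩ := exists_lift_fGe (F := F) hp ν hν (k + 1)
    by_cases hkm : k + 1 < m
    · have hmem : f * g * f ∈ faceDescent F (Fin n) := mul_mem (mul_mem hf hg) hf
      have hchar : ∀ i : Fin m, partChar F (ν i).1 (f * g * f) = if k + 1 ≤ i.val then 1 else 0 := by
        intro i
        rw [map_mul, map_mul, hf₃, hg₂]
        by_cases h : k + 1 ≤ i.val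
        · have : k ≤ i.val := by omega
          simp [h, this]
        · simp [h]
      have hinv := faceDescent_le_faceInvariants F (Fin n)
      have hmap : ∀ z ∈ faceDescent F (Fin n), ∀ N : ℕ, toSym F (z ^ N) = toSym F z ^ N := by
        intro z hz N
        induction N with
        | zero => rw [pow_zero, pow_zero, toSym_one]
        | succ N ihN => rw [pow_succ, pow_succ, toSym_map_mul F (hinv (pow_mem hz N)), ihN]
      have hpos : p ^ n ≠ 0 := pow_ne_zero _ hp.ne_zero
      obtain ⟨N, hN⟩ := Nat.exists_eq_succ_of_ne_zero hpos
      have hl : f * (f * g * f) = f * g * f := by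
        rw [← mul_assoc, ← mul_assoc, hf₂.eq]
      have hr : f * g * f * f = f * g * f := by rw [mul_assoc, hf₂.eq]
      refine ⟨(f * g * f) ^ p ^ n, pow_mem hmem _, ?_, isIdempotentElem_pow hp hmem fun μ => ?_,
        fun i => ?_, fun k' hk' => ⟨f, hf, ?_, hf₂, ?_, ?_, ?_⟩⟩
      · rw [hmap _ hmem, fPrime, if_pos hkm, toSym_map_mul F (hinv (mul_mem hf hg)),
          toSym_map_mul F (hinv hf), hf₁, hg₁]
      · obtain ⟨i, rfl⟩ := ν.surjective μ
        rw [hchar]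
        split_ifs
        · exact IsIdempotentElem.one
        · exact IsIdempotentElem.zero
      · rw [map_pow, hchar]
        split_ifs
        · exact one_pow _
        · exact zero_pow hpos
      · rw [hf₁]; congr; omega
      · rw [hN, pow_succ', ← mul_assoc, hl]
      · rw [hN, pow_succ, mul_assoc, hr]
      · obtain rfl : k = k' := by omega
        exact hf₃
    · refine ⟨0, zero_mem _, ?_, IsIdempotentElem.zero, fun i => ?_,
        fun k' hk' => ⟨f, hf, ?_, hf₂, mul_zero _, zero_mul _, ?_⟩⟩
      · rw [fPrime, if_neg hkm, map_zero]
      · have := i.2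
        rw [if_neg (by omega), map_zero]
      · rw [hf₁]; congr; omega
      · obtain rfl : k = k' := by omega
        exact hf₃

theorem exists_lift_modIdem (hp : p.Prime) [CharP F p] (ν : Fin m ≃ RegPart p n)
    (hν : ∀ i j : Fin m, WeakRef (toComp (ν i).1) (toComp (ν j).1) → i ≤ j) (l : RegPart p n) :
    ∃ y ∈ faceDescent F (Fin n), toSym F y = modIdem F ν l ∧ IsIdempotentElem y ∧
      ∀ μ : RegPart p n, partChar F μ.1 y = if μ = l then 1 else 0 := by
  classical
  obtain ⟨z, hz, hz₁, hz₂, hz₃, hz₄⟩ := exists_lift_fPrime (F := F) hp ν hν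
    ((ν.symm l : ℕ) + 1) (ν.symm l).2
  obtain ⟨f, hf, hf₁, hf₂, hfz, hzf, hf₃⟩ := hz₄ _ rfl
  refine ⟨f - z, sub_mem hf hz, by rw [map_sub, hf₁, hz₁, modIdem], ?_, fun μ => ?_⟩
  · rw [IsIdempotentElem, sub_mul, mul_sub, mul_sub, hf₂.eq, hz₂.eq, hfz, hzf]
    abel
  · obtain ⟨i, rfl⟩ := ν.surjective μ
    obtain ⟨j, rfl⟩ := ν.surjective l
    rw [map_sub, hf₃, hz₃]
    simp only [Equiv.symm_apply_apply, ν.injective.eq_iff, Fin.ext_iff]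
    by_cases h₁ : (j : ℕ) + 1 ≤ i
    · rw [if_pos (by omega), if_pos h₁, if_neg (by omega), sub_self]
    · by_cases h₂ : (j : ℕ) ≤ i
      · rw [if_pos h₂, if_neg h₁, if_pos (by omega), sub_zero]
      · rw [if_neg h₂, if_neg h₁, if_neg (by omega), sub_zero]

end Lift

/-! ### Ordered products and nested brackets over finite sets -/

section Brackets

variable {ι Q : Type*} [LinearOrder ι] [Ring Q]

theorem sort_insert_max {S : Finset ι} {a : ι} (h : ∀ x ∈ S, x < a) :
    (insert a S).sort (· ≤ ·) = S.sort (· ≤ ·) ++ [a] := by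
  have ha : a ∉ S := fun h' => lt_irrefl _ (h a h')
  refine List.Perm.eq_of_pairwise' (r := (· ≤ ·)) ?_ ?_ ?_
  · exact Finset.pairwise_sort _ _
  · rw [List.pairwise_append]
    refine ⟨Finset.pairwise_sort _ _, List.pairwise_singleton _ _, fun x hx y hy => ?_⟩
    rw [List.mem_singleton.1 hy]
    exact (h x ((Finset.mem_sort _).1 hx)).le
  · rw [← Multiset.coe_eq_coe, ← Multiset.coe_add, Finset.sort_eq, Finset.sort_eq,
      Finset.insert_val_of_notMem ha, add_comm]
    rfl

/-- The product of the `P i` over a finite set, in increasing order. -/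
noncomputable def incProd (P : ι → Q) (S : Finset ι) : Q := ((S.sort (· ≤ ·)).map P).prod

/-- The left nested bracket of a list, the first entry being read through `c`. -/
def nestBr {ι Q : Type*} [Ring Q] (c P : ι → Q) : List ι → Q
  | [] => 0
  | a :: as => as.foldl (fun b i => b * P i - P i * b) (c a)

/-- The left nested bracket over a finite set, in increasing order. -/
noncomputable def setBr (c P : ι → Q) (S : Finset ι) : Q := nestBr c P (S.sort (· ≤ ·))

theorem nestBr_append_singleton {ι Q : Type*} [Ring Q] (c P : ι → Q) (w : List ι) (a : ι) :
    nestBr c P (w ++ [a]) = nestBr c P w * P a - P a * nestBr c P w +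
      if w = [] then c a else 0 := by
  cases w with
  | nil => simp [nestBr]
  | cons b w => simp [nestBr]

theorem incProd_empty (P : ι → Q) : incProd P ∅ = 1 := by simp [incProd]

theorem setBr_empty (c P : ι → Q) : setBr c P ∅ = 0 := by simp [setBr, nestBr]

theorem setBr_singleton (c P : ι → Q) (i : ι) : setBr c P {i} = c i := by simp [setBr, nestBr]

theorem incProd_insert_max (P : ι → Q) {S : Finset ι} {a : ι} (h : ∀ x ∈ S, x < a) :
    incProd P (insert a S) = incProd P S * P a := by
  simp [incProd, sort_insert_max h]

theorem setBr_insert_max (c P : ι → Q) {S : Finset ι} {a : ι} (h : ∀ x ∈ S, x < a) :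
    setBr c P (insert a S) = setBr c P S * P a - P a * setBr c P S + if S = ∅ then c a else 0 := by
  have : S.sort (· ≤ ·) = [] ↔ S = ∅ := by
    rw [← List.length_eq_zero_iff, Finset.length_sort, Finset.card_eq_zero]
  rw [setBr, sort_insert_max h, nestBr_append_singleton, setBr]
  simp only [this]

/-- Splitting an ordered set into an ordered product and a nested bracket. -/
theorem sum_incProd_mul_setBr (d : ι → ℕ) (P : ι → Q) (S : Finset ι) :
    ∑ U ∈ S.powerset, incProd P U * setBr (fun i => d i • P i) P (S \ U) =
      (∑ i ∈ S, d i) • incProd P S := by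
  induction S using Finset.induction_on_max with
  | empty => simp [setBr_empty]
  | insert a S h ih =>
    have ha : a ∉ S := fun h' => lt_irrefl _ (h a h')
    have h₁ : ∀ U ∈ S.powerset, incProd P U * setBr (fun i => d i • P i) P (insert a S \ U)
        = incProd P U * setBr (fun i => d i • P i) P (S \ U) * P a
          - incProd P U * P a * setBr (fun i => d i • P i) P (S \ U)
          + if U = S then incProd P S * (d a • P a) else 0 := by
      intro U hU
      have hU' := Finset.mem_powerset.1 hU
      rw [Finset.insert_sdiff_of_notMem _ (fun h' => ha (hU' h')),
        setBr_insert_max _ _ fun x hx => h x (Finset.mem_sdiff.1 hx).1]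
      have : S \ U = ∅ ↔ U = S := by
        rw [Finset.sdiff_eq_empty_iff_subset]
        exact ⟨fun h => Finset.Subset.antisymm hU' h, fun h => h ▸ Finset.Subset.refl _⟩
      simp only [this]
      split_ifs with he
      · rw [he]; noncomm_ring
      · noncomm_ring
    have h₂ : ∀ U ∈ S.powerset,
        incProd P (insert a U) * setBr (fun i => d i • P i) P (insert a S \ insert a U)
        = incProd P U * P a * setBr (fun i => d i • P i) P (S \ U) := by
      intro U hU
      have hU' := Finset.mem_powerset.1 hU
      have : insert a S \ insert a U = S \ U := by
        ext x
        simp only [Finset.mem_sdiff, Finset.mem_insert]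
        constructor
        · tauto
        · rintro ⟨h₁, h₂⟩
          refine ⟨Or.inr h₁, ?_⟩
          rintro (h₃ | h₃)
          · exact ha (h₃ ▸ h₁)
          · exact h₂ h₃
      rw [incProd_insert_max _ fun x hx => h x (hU' hx), this]
    -- Pairing U with U ∪ {a}: the second half of the commutator with the largest element a cancels
    -- the term in which a belongs to the ordered product.
    have h₃ : ∀ U ∈ S.powerset,
        incProd P U * setBr (fun i => d i • P i) P (insert a S \ U) +
          incProd P (insert a U) * setBr (fun i => d i • P i) P (insert a S \ insert a U) =
        incProd P U * setBr (fun i => d i • P i) P (S \ U) * P a +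
          if U = S then incProd P S * (d a • P a) else 0 := by
      intro U hU
      rw [h₁ U hU, h₂ U hU]
      abel
    rw [Finset.sum_powerset_insert ha, ← Finset.sum_add_distrib, Finset.sum_congr rfl h₃,
      Finset.sum_add_distrib, Finset.sum_ite_eq', if_pos (Finset.mem_powerset_self S),
      ← Finset.sum_mul, ih, Finset.sum_insert ha, incProd_insert_max _ h, add_smul,
      smul_mul_assoc, mul_smul_comm, add_comm]

end Brackets

/-! ### Noncommutative power sums -/

section PowerSums

/-- The noncommutative power sums attached to the complete functions `G`. -/
def ncPower {W : Type*} [Ring W] (G : ℕ → W) : ℕ → W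
  | 0 => 0
  | b + 1 => (b + 1) • G (b + 1) - ∑ i : Fin b, G (i + 1) * ncPower G (b - i)

theorem map_ncPower {W W' : Type*} [Ring W] [Ring W'] (f : W →+* W') (G : ℕ → W) (a : ℕ) :
    f (ncPower G a) = ncPower (fun i => f (G i)) a := by
  induction a using Nat.strong_induction_on with
  | _ a ih =>
    cases a with
    | zero => simp [ncPower]
    | succ b =>
      rw [ncPower, ncPower, map_sub, map_nsmul, map_sum]
      congr 1
      refine Finset.sum_congr rfl fun i _ => ?_
      rw [map_mul, ih _ (by omega)]

/-- Because G 0 = 1, the Newton relations determine H recursively. -/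
theorem eq_ncPower {W : Type*} [Ring W] {G H : ℕ → W} (hG : G 0 = 1) (hH : H 0 = 0)
    (h : ∀ a, ∑ z ∈ Finset.HasAntidiagonal.antidiagonal a, G z.1 * H z.2 = a • G a) (a : ℕ) :
    ncPower G a = H a := by
  induction a using Nat.strong_induction_on with
  | _ a ih =>
    cases a with
    | zero => rw [ncPower, hH]
    | succ b =>
      have h₁ := h (b + 1)
      rw [Finset.Nat.sum_antidiagonal_succ, hG, one_mul,
        Finset.Nat.sum_antidiagonal_eq_sum_range_succ (fun i j => G (i + 1) * H j),
        Finset.sum_range_succ, Nat.sub_self, hH, mul_zero, add_zero] at h₁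
      have h₂ : ∑ i : Fin b, G (i + 1) * ncPower G (b - i) = ∑ i : Fin b, G (i + 1) * H (b - i) :=
        Finset.sum_congr rfl fun i _ => by rw [ih _ (by omega)]
      rw [ncPower, ← h₁, Finset.sum_range, h₂]
      exact add_sub_cancel_right _ _

variable {ι Q : Type*} [Ring Q]

/-- The matrix on finite sets with entry `h (K' \ K)` at `K ⊆ K'` if `K' \ K` has weight `a`. -/
def weightMat [DecidableEq ι] (d : ι → ℕ) (h : Finset ι → Q) (a : ℕ) :
    Matrix (Finset ι) (Finset ι) Q :=
  Matrix.of fun K K' => if K ⊆ K' ∧ ∑ i ∈ K' \ K, d i = a then h (K' \ K) else 0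

theorem sum_antidiagonal_ite {C C' : Prop} [Decidable C] [Decidable C'] (A B a : ℕ) (x y : Q) :
    ∑ z ∈ Finset.HasAntidiagonal.antidiagonal a,
      (if C ∧ A = z.1 then x else 0) * (if C' ∧ B = z.2 then y else 0) =
      if (C ∧ C') ∧ A + B = a then x * y else 0 := by
  by_cases hC : C
  · by_cases hC' : C'
    · simp only [hC, hC', true_and]
      split_ifs with h
      · rw [Finset.sum_eq_single (A, B)]
        · simp
        · rintro ⟨i, j⟩ _ hne
          by_cases hi : A = i
          · have hj : B ≠ j := fun hj => hne (by rw [hi, hj])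
            simp [hj]
          · simp [hi]
        · intro h'
          exact absurd (Finset.HasAntidiagonal.mem_antidiagonal.2 h) h'
      · refine Finset.sum_eq_zero fun z hz => ?_
        rw [Finset.HasAntidiagonal.mem_antidiagonal] at hz
        by_cases hi : A = z.1
        · have hj : B ≠ z.2 := fun hj => h (by rw [hi, hj, hz])
          simp [hj]
        · simp [hi]
    · simp [hC']
  · simp [hC]

variable [LinearOrder ι]

theorem weightMat_zero {d : ι → ℕ} (hd : ∀ i, 0 < d i) (h : Finset ι → Q) (K K' : Finset ι) :
    weightMat d h 0 K K' = if K = K' then h ∅ else 0 := by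
  rw [weightMat, Matrix.of_apply]
  have : (K ⊆ K' ∧ ∑ i ∈ K' \ K, d i = 0) ↔ K = K' := by
    constructor
    · rintro ⟨h₁, h₂⟩
      refine Finset.Subset.antisymm h₁ fun x hx => ?_
      by_contra hxK
      exact (hd x).ne' (Finset.sum_eq_zero_iff.1 h₂ x (Finset.mem_sdiff.2 ⟨hx, hxK⟩))
    · rintro rfl; simp
  simp only [this]
  split_ifs with he
  · rw [he, Finset.sdiff_self]
  · rfl

variable [Fintype ι]

/-- A matrix product sums over intermediate sets K ⊆ U ⊆ K', so the Newton relations for these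
matrices amount to `sum_incProd_mul_setBr` on K' \ K. -/
theorem ncPower_weightMat {d : ι → ℕ} (hd : ∀ i, 0 < d i) (P : ι → Q) (a : ℕ) :
    ncPower (weightMat d (incProd P)) a = weightMat d (setBr (fun i => d i • P i) P) a := by
  refine eq_ncPower ?_ ?_ (fun a => ?_) a
  · ext K K'
    rw [weightMat_zero hd, incProd_empty, Matrix.one_apply]
  · ext K K'
    rw [weightMat_zero hd, setBr_empty, ite_self, Matrix.zero_apply]
  · ext K K'
    rw [Matrix.sum_apply, Matrix.smul_apply]
    simp only [Matrix.mul_apply]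
    rw [Finset.sum_comm]
    simp only [weightMat, Matrix.of_apply]
    rw [Finset.sum_congr rfl fun U _ => sum_antidiagonal_ite _ _ _ _ _]
    by_cases hKK : K ⊆ K'
    · rw [← Finset.sum_filter]
      have hdisj : ∀ V ⊆ K' \ K, Disjoint K V := fun V hV =>
        Finset.disjoint_left.2 fun x hx hx' => (Finset.mem_sdiff.1 (hV hx')).2 hx
      have hsum : ∀ U, K ⊆ U → U ⊆ K' →
          ∑ i ∈ U \ K, d i + ∑ i ∈ K' \ U, d i = ∑ i ∈ K' \ K, d i := by
        intro U h₁ h₂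
        rw [← Finset.sum_union]
        · congr 1
          ext x
          simp only [Finset.mem_union, Finset.mem_sdiff]
          have h₁ := @h₁ x
          have h₂ := @h₂ x
          tauto
        · rw [Finset.disjoint_left]
          intro x hx hx'
          exact (Finset.mem_sdiff.1 hx').2 (Finset.mem_sdiff.1 hx).1
      by_cases ha : ∑ i ∈ K' \ K, d i = a
      · rw [if_pos ⟨hKK, ha⟩]
        conv_rhs => rw [← ha, ← sum_incProd_mul_setBr]
        refine Finset.sum_nbij' (fun U => U \ K) (fun V => K ∪ V) ?_ ?_ ?_ ?_ ?_
        · intro U hU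
          simp only [Finset.mem_filter, Finset.mem_univ, true_and] at hU
          exact Finset.mem_powerset.2 (Finset.sdiff_subset_sdiff hU.1.2 (Finset.Subset.refl _))
        · intro V hV
          have hV' := Finset.mem_powerset.1 hV
          have h₁ : K ∪ V ⊆ K' := Finset.union_subset hKK fun x hx =>
            (Finset.mem_sdiff.1 (hV' hx)).1
          simp only [Finset.mem_filter, Finset.mem_univ, true_and]
          exact ⟨⟨Finset.subset_union_left, h₁⟩,
            (hsum _ Finset.subset_union_left h₁).trans ha⟩
        · intro U hU
          simp only [Finset.mem_filter, Finset.mem_univ, true_and] at hU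
          exact Finset.union_sdiff_of_subset hU.1.1
        · intro V hV
          exact Finset.union_sdiff_cancel_left (hdisj V (Finset.mem_powerset.1 hV))
        · intro U hU
          simp only [Finset.mem_filter, Finset.mem_univ, true_and] at hU
          have : (K' \ K) \ (U \ K) = K' \ U := by
            ext x
            have := @hU.1.1 x
            simp only [Finset.mem_sdiff]
            tauto
          rw [this]
      · rw [if_neg fun h => ha h.2, smul_zero]
        refine Finset.sum_eq_zero fun U hU => absurd ?_ ha
        simp only [Finset.mem_filter, Finset.mem_univ, true_and] at hU
        rw [← hsum U hU.1.1 hU.1.2, hU.2]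
    · rw [if_neg fun h => hKK h.1, smul_zero]
      refine Finset.sum_eq_zero fun U _ => if_neg ?_
      rintro ⟨⟨h₁, h₂⟩, -⟩
      exact hKK (h₁.trans h₂)

/-- The sum over colourings with colour weights `s` of the products of the values of `h` at the
colour classes. -/
noncomputable def colourSum (d : ι → ℕ) (h : Finset ι → Q) {l : ℕ} (s : Fin l → ℕ) : Q :=
  ∑ f : ι → Fin l with sizes d f = s, (List.ofFn fun j => h (Finset.univ.filter fun i => f i = j)).prod

/-- A term of the matrix product is a chain of sets from K to the whole set, encoded by a colouring:
colour 0 is K and the later colours are the successive differences. Removing the first factor merges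
colours 0 and 1. -/
theorem prod_weightMat_apply_univ (d : ι → ℕ) (h : Finset ι → Q) {l : ℕ} (s : Fin l → ℕ)
    (K : Finset ι) :
    (List.ofFn fun j => weightMat d h (s j)).prod K Finset.univ =
      ∑ f : ι → Fin (l + 1) with (Finset.univ.filter fun i => f i = 0) = K ∧
        ∀ j : Fin l, sizes d f j.succ = s j,
        (List.ofFn fun j : Fin l => h (Finset.univ.filter fun i => f i = j.succ)).prod := by
  induction l generalizing K with
  | zero =>
    simp only [List.ofFn_zero, List.prod_nil, Matrix.one_apply, IsEmpty.forall_iff, and_true]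
    rw [Finset.sum_const, Finset.card_filter]
    simp [Subsingleton.elim _ (0 : Fin 1), eq_comm]
  | succ l ih =>
    rw [List.ofFn_succ, List.prod_cons, Matrix.mul_apply]
    simp only [ih]
    have h₁ : ∀ U : Finset ι, weightMat d h (s 0) K U *
        ∑ f : ι → Fin (l + 1) with (Finset.univ.filter fun i => f i = 0) = U ∧
          ∀ j : Fin l, sizes d f j.succ = s j.succ,
          (List.ofFn fun j : Fin l => h (Finset.univ.filter fun i => f i = j.succ)).prod =
        ∑ f : ι → Fin (l + 1) with ∀ j : Fin l, sizes d f j.succ = s j.succ,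
          if (Finset.univ.filter fun i => f i = 0) = U then
            weightMat d h (s 0) K (Finset.univ.filter fun i => f i = 0) *
            (List.ofFn fun j : Fin l => h (Finset.univ.filter fun i => f i = j.succ)).prod
          else 0 := by
      intro U
      rw [← Finset.sum_filter, Finset.filter_filter, Finset.mul_sum]
      refine Finset.sum_congr (by ext; simp [and_comm]) fun f hf => ?_
      simp only [Finset.mem_filter, Finset.mem_univ, true_and] at hf
      rw [hf.2]
    rw [Finset.sum_congr rfl fun U _ => h₁ U, Finset.sum_comm]
    simp only [Finset.sum_ite_eq, Finset.mem_univ, if_true]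
    simp only [weightMat, Matrix.of_apply, ite_mul, zero_mul]
    rw [← Finset.sum_filter, Finset.filter_filter]
    have hφ₀ : ∀ f : ι → Fin (l + 1), (Finset.univ.filter fun i =>
        (if i ∈ K then 0 else (f i).succ : Fin (l + 2)) = 0) = K := by
      intro f; ext i
      by_cases hi : i ∈ K <;> simp [hi, Fin.succ_ne_zero]
    have hφ₁ : ∀ f : ι → Fin (l + 1), (Finset.univ.filter fun i =>
        (if i ∈ K then 0 else (f i).succ : Fin (l + 2)) = Fin.succ 0) =
        (Finset.univ.filter fun i => f i = 0) \ K := by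
      intro f; ext i
      by_cases hi : i ∈ K
      · simp only [hi, if_true, Finset.mem_filter, Finset.mem_univ, true_and, Finset.mem_sdiff,
          not_true, and_false, iff_false]
        exact (Fin.succ_ne_zero 0).symm
      · simp only [hi, if_false, Finset.mem_filter, Finset.mem_univ, true_and, Finset.mem_sdiff,
          not_false_eq_true, and_true, Fin.succ_inj]
    have hφ₂ : ∀ f : ι → Fin (l + 1), K ⊆ (Finset.univ.filter fun i => f i = 0) → ∀ j : Fin l,
        (Finset.univ.filter fun i => (if i ∈ K then 0 else (f i).succ : Fin (l + 2)) = j.succ.succ) =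
        Finset.univ.filter fun i => f i = j.succ := by
      intro f hf j; ext i
      by_cases hi : i ∈ K
      · have := hf hi
        simp only [Finset.mem_filter, Finset.mem_univ, true_and] at this
        simp [hi, this, (Fin.succ_ne_zero _).symm]
      · simp only [hi, if_false, Finset.mem_filter, Finset.mem_univ, true_and, Fin.succ_inj]
    have hρ : ∀ f : ι → Fin (l + 2), (Finset.univ.filter fun i => f i = 0) = K →
        (K ⊆ Finset.univ.filter fun i => (if h : f i = 0 then 0 else (f i).pred h) = 0) ∧
        (fun i => if i ∈ K then 0 else (if h : f i = 0 then 0 else (f i).pred h).succ) = f := by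
      rintro f rfl
      constructor
      · intro i hi
        simp only [Finset.mem_filter, Finset.mem_univ, true_and] at hi ⊢
        simp [hi]
      · funext i
        by_cases hi : f i = 0 <;> simp [hi]
    refine Finset.sum_nbij'
      (fun f i => if i ∈ K then 0 else (f i).succ)
      (fun f i => if h : f i = 0 then 0 else (f i).pred h) ?_ ?_ ?_ ?_ ?_
    · intro f hf
      simp only [Finset.mem_filter, Finset.mem_univ, true_and] at hf ⊢
      refine ⟨hφ₀ f, fun j => ?_⟩
      refine Fin.cases ?_ (fun j => ?_) j
      · rw [sizes, hφ₁, hf.2.2]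
      · rw [sizes, hφ₂ f hf.2.1, ← hf.1 j, sizes]
    · intro f hf
      simp only [Finset.mem_filter, Finset.mem_univ, true_and] at hf ⊢
      obtain ⟨h₁, h₂⟩ := hρ f hf.1
      have key : ∀ g : ι → Fin (l + 1), (K ⊆ Finset.univ.filter fun i => g i = 0) →
          (fun i => if i ∈ K then 0 else (g i).succ) = f →
          (∀ j : Fin l, sizes d g j.succ = s j.succ) ∧ (K ⊆ Finset.univ.filter fun i => g i = 0) ∧
            ∑ i ∈ (Finset.univ.filter fun i => g i = 0) \ K, d i = s 0 := by
        rintro g hg rfl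
        refine ⟨fun j => ?_, hg, ?_⟩
        · rw [sizes, ← hφ₂ g hg, ← hf.2 j.succ, sizes]
        · rw [← hφ₁, ← hf.2 0, sizes]
      exact key _ h₁ h₂
    · intro f hf
      simp only [Finset.mem_filter, Finset.mem_univ, true_and] at hf
      funext i
      by_cases hi : i ∈ K
      · have := hf.2.1 hi
        simp only [Finset.mem_filter, Finset.mem_univ, true_and] at this
        simp [hi, this]
      · simp [hi, Fin.succ_ne_zero]
    · intro f hf
      simp only [Finset.mem_filter, Finset.mem_univ, true_and] at hf
      exact (hρ f hf.1).2
    · intro f hf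
      simp only [Finset.mem_filter, Finset.mem_univ, true_and] at hf
      rw [List.ofFn_succ, List.prod_cons, hφ₁]
      simp only [hφ₂ f hf.2.1]

theorem prod_weightMat_apply (d : ι → ℕ) (h : Finset ι → Q) {l : ℕ} (s : Fin l → ℕ) :
    (List.ofFn fun j => weightMat d h (s j)).prod ∅ Finset.univ = colourSum d h s := by
  rw [prod_weightMat_apply_univ, colourSum]
  symm
  have hsucc : ∀ (f : ι → Fin l) (j : Fin l), (Finset.univ.filter fun i => (f i).succ = j.succ) =
      Finset.univ.filter fun i => f i = j := by
    intro f j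
    simp only [Fin.succ_inj]
  refine Finset.sum_bij (fun f _ i => (f i).succ) ?_ ?_ ?_ ?_
  · intro f hf
    simp only [Finset.mem_filter, Finset.mem_univ, true_and] at hf ⊢
    refine ⟨?_, fun j => ?_⟩
    · ext i; simp [Fin.succ_ne_zero]
    · rw [← hf, sizes, hsucc, sizes]
  · intro f _ g _ hfg
    funext i
    exact Fin.succ_injective _ (congrFun hfg i)
  · intro f hf
    simp only [Finset.mem_filter, Finset.mem_univ, true_and] at hf
    have h0 : ∀ i, f i ≠ 0 := fun i hi => by
      have : i ∈ (Finset.univ.filter fun i => f i = 0) := by simpa using hi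
      rw [hf.1] at this
      simp at this
    have hf' : f = fun i => ((f i).pred (h0 i)).succ := by funext i; simp
    refine ⟨fun i => (f i).pred (h0 i), ?_, hf'.symm⟩
    simp only [Finset.mem_filter, Finset.mem_univ, true_and]
    funext j
    rw [← hf.2 j, sizes, ← hsucc, sizes]
    simp only [Fin.succ_pred]
  · intro f _
    simp only [hsucc]

end PowerSums

/-! ### Power sums in the face algebra -/

section FacePower

variable (R : Type*) [CommRing R] (X : Type*) [Fintype X] [DecidableEq X]

/-- The linear map from noncommutative symmetric functions to the face algebra. -/
noncomputable def ncToFace : MonoidAlgebra R (FreeMonoid ℕ) →ₗ[R] FaceAlg R X :=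
  (MonoidAlgebra.basis (FreeMonoid ℕ) R).constr R fun w => faceSum R X w.toList.get

theorem ncToFace_single (w : FreeMonoid ℕ) :
    ncToFace R X (MonoidAlgebra.single w 1) = faceSum R X w.toList.get := by
  rw [← MonoidAlgebra.basis_apply, ncToFace, Module.Basis.constr_basis]

/-- The element of the face algebra attached to a product of noncommutative power sums. -/
noncomputable def facePower {l : ℕ} (s : Fin l → ℕ) : FaceAlg R X :=
  ncToFace R X (List.ofFn fun j =>
    ncPower (fun a => (MonoidAlgebra.single (FreeMonoid.of a) 1 : MonoidAlgebra R (FreeMonoid ℕ)))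
      (s j)).prod

theorem ncToFace_mem (y : MonoidAlgebra R (FreeMonoid ℕ)) : ncToFace R X y ∈ faceDescent R X := by
  induction y using MonoidAlgebra.induction_linear with
  | zero => simp
  | add a b ha hb => rw [map_add]; exact add_mem ha hb
  | single w r =>
    have : (MonoidAlgebra.single w r : MonoidAlgebra R (FreeMonoid ℕ))
        = r • MonoidAlgebra.single w 1 := by simp [MonoidAlgebra.smul_single]
    rw [this, map_smul, ncToFace_single]
    exact Subalgebra.smul_mem _ (faceSum_mem_faceDescent R _) r

theorem facePower_mem {l : ℕ} (s : Fin l → ℕ) : facePower R X s ∈ faceDescent R X :=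
  ncToFace_mem R X _

variable {R X}

/-- The transfer principle. The map L need not be multiplicative: its values on face sums are the
(∅, univ) entries of products of matrices `weightMat`, hence of an algebra homomorphism Θ on the
free algebra, and Θ carries power sums to bracket matrices. It is used for letters, for the constant
1, and for products of Lie brackets. -/
theorem map_facePower {ι Q : Type*} [LinearOrder ι] [Fintype ι] [Ring Q] [Algebra R Q]
    {d : ι → ℕ} (hd : ∀ i, 0 < d i) {P : ι → Q} {L : FaceAlg R X →ₗ[R] Q}
    (hL : ∀ (l : ℕ) (s : Fin l → ℕ), L (faceSum R X s) = colourSum d (incProd P) s)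
    {l : ℕ} (s : Fin l → ℕ) :
    L (facePower R X s) = colourSum d (setBr (fun i => d i • P i) P) s := by
  let Θ : MonoidAlgebra R (FreeMonoid ℕ) →ₐ[R] Matrix (Finset ι) (Finset ι) Q :=
    MonoidAlgebra.lift R _ _ (FreeMonoid.lift (weightMat d (incProd P)))
  let ev : Matrix (Finset ι) (Finset ι) Q →ₗ[R] Q := Matrix.entryLinearMap R Q ∅ Finset.univ
  have h₁ : L ∘ₗ ncToFace R X = ev ∘ₗ Θ.toLinearMap := by
    refine (MonoidAlgebra.basis (FreeMonoid ℕ) R).ext fun w => ?_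
    rw [MonoidAlgebra.basis_apply, LinearMap.comp_apply, LinearMap.comp_apply, ncToFace_single, hL,
      ← prod_weightMat_apply]
    change _ = (Θ (MonoidAlgebra.single w 1)) ∅ Finset.univ
    rw [MonoidAlgebra.lift_single, one_smul, FreeMonoid.lift_apply]
    conv_rhs => rw [← List.ofFn_get w.toList, List.map_ofFn]
    rfl
  have h₂ := LinearMap.congr_fun h₁ (List.ofFn fun j =>
    ncPower (fun a => (MonoidAlgebra.single (FreeMonoid.of a) 1 : MonoidAlgebra R (FreeMonoid ℕ)))
      (s j)).prod
  rw [facePower]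
  refine h₂.trans ?_
  rw [LinearMap.comp_apply]
  change (Θ _) ∅ Finset.univ = _
  have h₃ : (Θ ∘ fun j => ncPower (fun a =>
      (MonoidAlgebra.single (FreeMonoid.of a) 1 : MonoidAlgebra R (FreeMonoid ℕ))) (s j)) =
      fun j => weightMat d (setBr (fun i => d i • P i) P) (s j) := by
    funext j
    rw [Function.comp_apply, ← ncPower_weightMat hd]
    refine (map_ncPower Θ.toRingHom _ (s j)).trans ?_
    refine congrArg (ncPower · (s j)) (funext fun a => ?_)
    change Θ _ = _
    rw [MonoidAlgebra.lift_single, one_smul, FreeMonoid.lift_eval_of]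
  rw [map_list_prod, List.map_ofFn, ← prod_weightMat_apply, h₃]

end FacePower

/-! ### Words -/

section Words

variable (R : Type*) [CommRing R] {n : ℕ}

/-- The algebra of words in `n` letters. -/
abbrev WordAlg (R : Type*) [CommRing R] (n : ℕ) : Type _ := MonoidAlgebra R (FreeMonoid (Fin n))

/-- A word as an element of the algebra of words. -/
noncomputable def word (w : List (Fin n)) : WordAlg R n :=
  MonoidAlgebra.single (FreeMonoid.ofList w) 1

/-- A letter as an element of the algebra of words. -/
noncomputable def letter (i : Fin n) : WordAlg R n := word R [i]

theorem word_append (v w : List (Fin n)) : word R (v ++ w) = word R v * word R w := by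
  rw [word, word, word, MonoidAlgebra.single_mul_single, one_mul, FreeMonoid.ofList_append]

theorem word_nil : word R ([] : List (Fin n)) = 1 := rfl

theorem word_flatten (L : List (List (Fin n))) : word R L.flatten = (L.map (word R)).prod := by
  induction L with
  | nil => rfl
  | cons w L ih => rw [List.flatten_cons, word_append, ih, List.map_cons, List.prod_cons]

theorem word_eq_prod (w : List (Fin n)) : word R w = (w.map (letter R)).prod := by
  induction w with
  | nil => rfl
  | cons a w ih =>
    rw [← List.singleton_append, word_append, ih, List.map_append, List.prod_append]
    simp [letter]

variable {R} in
theorem wordAlg_hom_ext {V : Type*} [AddCommMonoid V] [Module R V] {f g : WordAlg R n →ₗ[R] V}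
    (h : ∀ w, f (word R w) = g (word R w)) : f = g :=
  (MonoidAlgebra.basis (FreeMonoid (Fin n)) R).ext fun w => h w.toList

/-- The linear map on words induced by a map of lists. -/
noncomputable def wordMap (f : List (Fin n) → List (Fin n)) : WordAlg R n →ₗ[R] WordAlg R n :=
  MonoidAlgebra.mapDomainLinearMap R R fun w => FreeMonoid.ofList (f w.toList)

theorem wordMap_word (f : List (Fin n) → List (Fin n)) (w : List (Fin n)) :
    wordMap R f (word R w) = word R (f w) := by
  simp [wordMap, word]

/-- The embedding of the group algebra in the algebra of words. -/
noncomputable def toWords : SymAlg R n →ₗ[R] WordAlg R n :=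
  MonoidAlgebra.mapDomainLinearMap R R fun σ => FreeMonoid.ofList (List.ofFn σ.unop)

theorem toWords_perm (σ : Perm (Fin n)) : toWords R (perm R σ) = word R (List.ofFn σ) := by
  simp [toWords, perm, word]

theorem toWords_injective : Function.Injective (toWords R (n := n)) := by
  refine MonoidAlgebra.mapDomain_injective fun σ τ h => ?_
  have := List.ofFn_injective (FreeMonoid.ofList.injective h)
  exact MulOpposite.unop_injective (Equiv.coe_fn_injective this)

/-- The stable rearrangement of a list by the values of a function. -/
def sortList {l : ℕ} (f : Fin n → Fin l) (w : List (Fin n)) : List (Fin n) :=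
  ((List.finRange l).map fun j => w.filter fun x => f x = j).flatten

/-- Both lists have the same entries without repetition and are sorted for the linear order `chamber
σ`. -/
theorem ofFn_sortPerm {l : ℕ} (f : Fin n → Fin l) (τ : Perm (Fin n)) :
    List.ofFn ((Face.ofFun f).sortPerm τ) = sortList f (List.ofFn τ) := by
  have hch := chamber_sortPerm (Face.ofFun f) τ
  generalize (Face.ofFun f).sortPerm τ = σ at *
  have hrel : ∀ x y, (chamber σ).rel x y ↔ f x ≤ f y ∧ (f y ≤ f x → τ⁻¹ x ≤ τ⁻¹ y) := by
    intro x y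
    rw [hch]; rfl
  refine List.Perm.eq_of_pairwise (le := (chamber σ).rel) ?_ ?_ ?_ ?_
  · intro x y _ _ h₁ h₂
    rw [chamber_rel] at h₁ h₂
    exact σ⁻¹.injective (le_antisymm h₁ h₂)
  · rw [List.pairwise_ofFn]
    intro i j hij
    rw [chamber_rel]
    simpa using hij.le
  · rw [sortList, List.pairwise_flatten]
    constructor
    · intro w hw
      obtain ⟨j, -, rfl⟩ := List.mem_map.1 hw
      rw [List.pairwise_filter, List.pairwise_ofFn]
      intro a b hab ha hb
      rw [hrel]
      have ha' : f (τ a) = j := by simpa using ha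
      have hb' : f (τ b) = j := by simpa using hb
      refine ⟨by rw [ha', hb'], fun _ => by simpa using hab.le⟩
    · rw [List.pairwise_map]
      refine (List.pairwise_lt_finRange l).imp fun {i j} hij x hx y hy => ?_
      have hx' : f x = i := by simpa using (List.mem_filter.1 hx).2
      have hy' : f y = j := by simpa using (List.mem_filter.1 hy).2
      rw [hrel, hx', hy']
      exact ⟨hij.le, fun h => absurd hij (not_lt.2 h)⟩
  · rw [List.perm_ext_iff_of_nodup]
    · intro x
      simp only [sortList, List.mem_flatten, List.mem_map, List.mem_finRange, true_and,
        List.mem_ofFn]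
      constructor
      · intro _
        refine ⟨_, ⟨f x, rfl⟩, ?_⟩
        rw [List.mem_filter, List.mem_ofFn]
        exact ⟨⟨τ⁻¹ x, by simp⟩, by simp⟩
      · intro _
        exact ⟨σ⁻¹ x, by simp⟩
    · exact List.nodup_ofFn.2 σ.injective
    · rw [sortList, List.nodup_flatten]
      constructor
      · intro w hw
        obtain ⟨j, -, rfl⟩ := List.mem_map.1 hw
        exact (List.nodup_ofFn.2 τ.injective).filter _
      · rw [List.pairwise_map]
        refine (List.pairwise_lt_finRange l).imp fun {i j} hij => ?_
        rw [List.disjoint_left]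
        intro x hx hy
        have hx' : f x = i := by simpa using (List.mem_filter.1 hx).2
        have hy' : f x = j := by simpa using (List.mem_filter.1 hy).2
        exact hij.ne (hx'.symm.trans hy')

theorem toWords_faceAct {l : ℕ} (f : Fin n → Fin l) (a : SymAlg R n) :
    toWords R (faceAct R (MonoidAlgebra.single (Face.ofFun f) 1) a) =
      wordMap R (sortList f) (toWords R a) := by
  have : toWords R ∘ₗ faceAct R (MonoidAlgebra.single (Face.ofFun f) 1) =
      wordMap R (sortList f) ∘ₗ toWords R := symAlg_hom_ext fun τ => by
    rw [LinearMap.comp_apply, LinearMap.comp_apply, faceAct_single_perm, one_smul, toWords_perm,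
      toWords_perm, wordMap_word, ofFn_sortPerm]
  exact LinearMap.congr_fun this a

theorem filter_finRange_eq_sort (p : Fin n → Prop) [DecidablePred p] :
    (List.finRange n).filter p = (Finset.univ.filter p).sort (· ≤ ·) := by
  refine List.Perm.eq_of_pairwise' (r := (· ≤ ·)) ?_ (Finset.pairwise_sort _ _) ?_
  · exact ((List.pairwise_lt_finRange n).imp fun h => le_of_lt h).filter _
  · rw [List.perm_ext_iff_of_nodup ((List.nodup_finRange n).filter _) (Finset.sort_nodup _ _)]
    intro x
    simp

theorem ofFn_sortPerm_one {l : ℕ} (f : Fin n → Fin l) :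
    List.ofFn ((Face.ofFun f).sortPerm 1) =
      (List.ofFn fun j => (Finset.univ.filter fun x => f x = j).sort (· ≤ ·)).flatten := by
  have h₁ : List.ofFn ⇑(1 : Perm (Fin n)) = List.finRange n := List.ofFn_id n
  rw [ofFn_sortPerm, sortList, h₁, List.ofFn_eq_map]
  simp only [filter_finRange_eq_sort]

theorem toWords_toSym_faceSum {l : ℕ} (s : Fin l → ℕ) :
    toWords R (toSym R (faceSum R (Fin n) s)) =
      colourSum (fun _ => 1) (incProd (letter R)) s := by
  rw [faceSum, map_sum, map_sum, colourSum]
  refine Finset.sum_congr rfl fun f _ => ?_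
  rw [toSym_single, one_smul, toWords_perm, ofFn_sortPerm_one, word_flatten, List.map_ofFn]
  congr 2
  funext j
  rw [Function.comp_apply, word_eq_prod, incProd]

theorem toWords_toSym_facePower {l : ℕ} (s : Fin l → ℕ) :
    toWords R (toSym R (facePower R (Fin n) s)) =
      colourSum (fun _ => 1) (setBr (letter R) (letter R)) s := by
  have := map_facePower (R := R) (X := Fin n) (d := fun _ : Fin n => 1) (P := letter R)
    (L := toWords R ∘ₗ toSym R) (fun _ => Nat.one_pos) (fun l s => toWords_toSym_faceSum R s) s
  simp only [one_smul] at this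
  exact this

end Words

/-! ### Characters of the power sums -/

section CharPower

variable {R : Type*} [CommRing R]

theorem incProd_one {ι : Type*} [LinearOrder ι] (S : Finset ι) :
    incProd (fun _ => (1 : R)) S = 1 := by
  simp [incProd]

theorem setBr_one {ι : Type*} [LinearOrder ι] (d : ι → ℕ) (S : Finset ι) (hS : S.card ≠ 1) :
    setBr (fun i => d i • (1 : R)) (fun _ => 1) S = 0 := by
  rw [setBr]
  have hlen : (S.sort (· ≤ ·)).length ≠ 1 := by rwa [Finset.length_sort]
  generalize S.sort (· ≤ ·) = w at *
  match w with
  | [] => rfl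
  | [a] => simp at hlen
  | a :: b :: w =>
    rw [nestBr, List.foldl_cons, mul_one, one_mul, sub_self]
    clear hlen
    induction w with
    | nil => rfl
    | cons c w ih => rw [List.foldl_cons, mul_one, one_mul, sub_self, ih]

/-- With all P i equal to 1, brackets of two or more entries vanish by commutativity. Only bijective
colourings survive, and each contributes the product of the parts. -/
theorem faceChar_facePower {X : Type*} [Fintype X] [DecidableEq X] {k l : ℕ} {E : X → X → Prop}
    {u : X → Fin k} (hu : Function.Surjective u) (hE : ∀ x y, E x y ↔ u x = u y)
    (s : Fin l → ℕ) (hs : ∀ j, 0 < s j) [Decidable (Finset.univ.val.map (sizes (fun _ => 1) u) =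
      Finset.univ.val.map s)] :
    faceChar R E (facePower R X s) = if Finset.univ.val.map (sizes (fun _ => 1) u) =
      Finset.univ.val.map s then ((symCount s * ∏ j, s j : ℕ) : R) else 0 := by
  classical
  have hd : ∀ i, 0 < sizes (fun _ => 1) u i := by
    intro i
    obtain ⟨x, rfl⟩ := hu i
    rw [sizes, Finset.sum_const, smul_eq_mul, mul_one]
    exact Finset.card_pos.2 ⟨x, by simp⟩
  have h := map_facePower (R := R) (X := X) hd (P := fun _ => (1 : R))
    (L := (faceChar R E).toLinearMap) (fun l s => by
      have h₁ : (faceChar R E).toLinearMap (faceSum R X s) = _ := faceChar_faceSum R s E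
      rw [h₁, colourSum]
      simp only [hE, incProd_one]
      rw [Nat.card_congr (constColouringEquiv _ u hu s), Nat.card_eq_fintype_card,
        Fintype.card_subtype, Finset.card_eq_sum_ones, Nat.cast_sum]
      refine Finset.sum_congr rfl fun f _ => ?_
      rw [List.prod_eq_one]
      · simp
      · intro x hx
        obtain ⟨j, rfl⟩ := (List.mem_ofFn' _ _).1 hx
        rfl) s
  refine h.trans ?_
  generalize sizes (fun _ => 1) u = d at *
  rw [colourSum]
  have hterm : ∀ f ∈ Finset.univ.filter fun f : Fin k → Fin l => sizes d f = s,
      (List.ofFn fun j => setBr (fun i => d i • (1 : R)) (fun _ => 1)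
        (Finset.univ.filter fun i => f i = j)).prod =
      if Function.Bijective f then ((∏ j, s j : ℕ) : R) else 0 := by
    intro f hf
    simp only [Finset.mem_filter, Finset.mem_univ, true_and] at hf
    rw [List.prod_ofFn]
    split_ifs with hb
    · push_cast
      refine Finset.prod_congr rfl fun j _ => ?_
      obtain ⟨i, rfl⟩ := hb.surjective j
      have : (Finset.univ.filter fun i' => f i' = f i) = {i} := by
        ext i'; simp [hb.injective.eq_iff]
      rw [this, setBr_singleton, ← hf, sizes_of_injective hb.injective, nsmul_one]
    · have hsurj := surjective_of_sizes_pos hs hf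
      have hinj : ¬ Function.Injective f := fun h => hb ⟨h, hsurj⟩
      obtain ⟨a, b, hab, hne⟩ := Function.not_injective_iff.1 hinj
      refine Finset.prod_eq_zero (Finset.mem_univ (f a)) (setBr_one d _ fun hc => ?_)
      obtain ⟨c, hc⟩ := Finset.card_eq_one.1 hc
      have h₁ : a ∈ ({c} : Finset (Fin k)) := hc ▸ by simp
      have h₂ : b ∈ ({c} : Finset (Fin k)) := hc ▸ by simp [hab]
      exact hne ((Finset.mem_singleton.1 h₁).trans (Finset.mem_singleton.1 h₂).symm)
  rw [Finset.sum_congr rfl hterm, ← Finset.sum_filter, Finset.filter_filter, Finset.sum_const,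
    nsmul_eq_mul]
  split_ifs with hm
  · have := card_bijective_colourings hm
    rw [Nat.card_eq_fintype_card, Fintype.card_subtype] at this
    rw [← this, Nat.cast_mul]
    congr 3
    ext f
    simp [and_comm]
  · rw [Finset.card_eq_zero.2, Nat.cast_zero, zero_mul]
    refine Finset.filter_eq_empty_iff.2 fun f _ hf => hm ?_
    have : ∀ i, s (f i) = d i := fun i => by
      rw [← hf.1, sizes_of_injective hf.2.injective]
    have hds : d = s ∘ (Equiv.ofBijective f hf.2) := funext fun i => (this i).symm
    rw [hds, ← Multiset.map_map, Multiset.map_univ_val_equiv]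

end CharPower

/-! ### The Dynkin–Specht–Wever elements acting on words -/

section DynkinWords

theorem filter_finRange_interval {n a i : ℕ} (h : a + i ≤ n) :
    (List.finRange n).filter (fun x : Fin n => a ≤ x.val ∧ x.val < a + i) =
      List.ofFn fun j : Fin i => (⟨a + j, by omega⟩ : Fin n) := by
  refine List.Perm.eq_of_pairwise' (r := (· ≤ ·)) ?_ ?_ ?_
  · exact ((List.pairwise_lt_finRange n).imp fun h => le_of_lt h).filter _
  · rw [List.pairwise_ofFn]
    intro j j' hj
    rw [Fin.mk_le_mk]
    have := Fin.lt_def.1 hj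
    omega
  · rw [List.perm_ext_iff_of_nodup ((List.nodup_finRange n).filter _) (List.nodup_ofFn.2 ?_)]
    · intro x
      simp only [List.mem_filter, List.mem_finRange, true_and, List.mem_ofFn, decide_eq_true_eq]
      constructor
      · rintro ⟨h₁, h₂⟩
        exact ⟨⟨x - a, by omega⟩, Fin.ext (by simp; omega)⟩
      · rintro ⟨j, rfl⟩
        simp
    · intro j j' hj
      simpa [Fin.ext_iff] using hj

theorem descCycle_apply {n a m : ℕ} (h : a + (m + 1) ≤ n) (x : Fin n) :
    descCycle n a (m + 1) x =
      if x.val = a then ⟨a + m, by omega⟩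
      else if a < x.val ∧ x.val < a + (m + 1) then ⟨x.val - 1, by omega⟩ else x := by
  have hl := filter_finRange_interval h
  have hnd : (List.ofFn fun j : Fin (m + 1) => (⟨a + j, by omega⟩ : Fin n)).Nodup :=
    hl ▸ (List.nodup_finRange n).filter _
  rw [descCycle, hl, List.formPerm_reverse]
  have key : ∀ (j : ℕ) (_ : j < m + 1) (y z : Fin n), y.val = a + j →
      z.val = a + (j + 1) % (m + 1) →
      (List.ofFn fun j : Fin (m + 1) => (⟨a + j, by omega⟩ : Fin n)).formPerm y = z := by
    intro j hj y z hy hz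
    have := List.formPerm_apply_getElem _ hnd j (by simpa using hj)
    rw [List.getElem_ofFn, List.getElem_ofFn] at this
    simp only [List.length_ofFn] at this
    rw [show y = ⟨a + j, by omega⟩ from Fin.ext hy, this]
    exact Fin.ext hz.symm
  rw [Perm.inv_eq_iff_eq]
  split_ifs with h₁ h₂
  · exact (key m (by omega) _ _ rfl (by rw [Nat.mod_self]; exact h₁)).symm
  · exact (key (x.val - 1 - a) (by omega) _ _ (by simp only; omega)
      (by rw [Nat.mod_eq_of_lt (by omega)]; omega)).symm
  · symm
    apply List.formPerm_apply_of_notMem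
    rw [List.mem_ofFn]
    rintro ⟨j, rfl⟩
    simp only at h₁ h₂
    omega

/-- Move the letter in position `a + m` to position `a`. -/
def moveLetter {α : Type*} (a m : ℕ) (w : List α) : List α :=
  w.take a ++ ((w.drop (a + m)).take 1 ++ ((w.drop a).take m ++ w.drop (a + (m + 1))))

theorem moveLetter_append {α : Type*} (u v : List α) (z : α) (w : List α) :
    moveLetter u.length v.length (u ++ (v ++ z :: w)) = u ++ z :: (v ++ w) := by
  have h₁ : u.drop (u.length + v.length) = [] := List.drop_eq_nil_of_le (by omega)
  have h₂ : u.drop (u.length + (v.length + 1)) = [] := List.drop_eq_nil_of_le (by omega)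
  have h₃ : v.drop (v.length + 1) = [] := List.drop_eq_nil_of_le (by omega)
  simp [moveLetter, List.drop_append, h₁, h₂, h₃]

theorem ofFn_mul_descCycle {n a m : ℕ} (h : a + (m + 1) ≤ n) (τ : Perm (Fin n)) :
    List.ofFn (τ * descCycle n a (m + 1)) = moveLetter a m (List.ofFn τ) := by
  refine List.ext_getElem (by simp [moveLetter]; omega) fun x hx _ => ?_
  rw [List.getElem_ofFn, Perm.mul_apply, descCycle_apply h]
  rw [List.length_ofFn] at hx
  simp only [moveLetter, List.getElem_append, List.length_take, List.length_ofFn, List.length_drop,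
    List.getElem_take, List.getElem_drop, List.getElem_ofFn]
  split_ifs <;> first | omega | skip
  all_goals
    congr 1
    first | rfl | (refine Fin.ext ?_; simp only; omega)

variable (R : Type*) [CommRing R] {n : ℕ}

theorem toWords_descCycle_mul {a m : ℕ} (h : a + (m + 1) ≤ n) (x : SymAlg R n) :
    toWords R (perm R (descCycle n a (m + 1)) * x) = wordMap R (moveLetter a m) (toWords R x) := by
  have : toWords R ∘ₗ LinearMap.mulLeft R (perm R (descCycle n a (m + 1))) =
      wordMap R (moveLetter a m) ∘ₗ toWords R := symAlg_hom_ext fun τ => by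
    rw [LinearMap.comp_apply, LinearMap.comp_apply, LinearMap.mulLeft_apply, perm_mul_perm,
      toWords_perm, toWords_perm, wordMap_word, ofFn_mul_descCycle h]
  exact LinearMap.congr_fun this x

/-- The action on words of the Dynkin–Specht–Wever element on the positions `a, …, a + m`. -/
noncomputable def dynkinWord (n a : ℕ) : ℕ → Module.End R (WordAlg R n)
  | 0 => 1
  | m + 1 => (1 - wordMap R (moveLetter a (m + 1))) * dynkinWord n a m

theorem toWords_dswShift_mul {a m : ℕ} (h : a + (m + 1) ≤ n) (x : SymAlg R n) :
    toWords R (dswShift R n a (m + 1) * x) = dynkinWord R n a m (toWords R x) := by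
  induction m with
  | zero => simp [dswShift, dynkinWord]
  | succ m ih =>
    have : dswShift R n a (m + 1 + 1) =
        (1 - perm R (descCycle n a (m + 1 + 1))) * dswShift R n a (m + 1) := by
      rw [dswShift, dswShift, Nat.add_sub_cancel, Nat.add_sub_cancel, List.range'_1_concat,
        List.reverse_append, List.reverse_singleton, List.singleton_append, List.map_cons,
        List.prod_cons, show 2 + m = m + 1 + 1 by omega]
    rw [this, mul_assoc, sub_mul, one_mul, map_sub, toWords_descCycle_mul R h, ih (by omega)]
    rfl

/-- The span of the words of length `m`. -/
noncomputable def homog (n m : ℕ) : Submodule R (WordAlg R n) :=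
  Submodule.span R {x | ∃ w : List (Fin n), w.length = m ∧ word R w = x}

variable {R}

theorem word_mem_homog (w : List (Fin n)) : word R w ∈ homog R n w.length :=
  Submodule.subset_span ⟨w, rfl, rfl⟩

theorem mul_mem_homog {m m' : ℕ} {x y : WordAlg R n} (hx : x ∈ homog R n m)
    (hy : y ∈ homog R n m') : x * y ∈ homog R n (m + m') := by
  have := Submodule.mul_mem_mul hx hy
  rw [homog, homog, Submodule.span_mul_span] at this
  refine Submodule.span_mono ?_ this
  rintro _ ⟨_, ⟨v, rfl, rfl⟩, _, ⟨w, rfl, rfl⟩, rfl⟩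
  exact ⟨v ++ w, List.length_append, word_append R v w⟩

theorem nestBr_mem_homog (w : List (Fin n)) :
    nestBr (letter R) (letter R) w ∈ homog R n w.length := by
  induction w using List.reverseRecOn with
  | nil => exact zero_mem _
  | append_singleton w a ih =>
    have ha : letter R a ∈ homog R n 1 := word_mem_homog [a]
    rw [nestBr_append_singleton, List.length_append, List.length_singleton]
    refine add_mem (sub_mem (mul_mem_homog ih ha) ?_) ?_
    · rw [add_comm]; exact mul_mem_homog ha ih
    · split_ifs with h
      · rw [h]; exact ha
      · exact zero_mem _

/-- Letters are moved by position, so homogeneity of b is what makes z land exactly in front of it.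
-/
theorem wordMap_moveLetter (u : List (Fin n)) {m : ℕ} {b : WordAlg R n} (hb : b ∈ homog R n m)
    (z : Fin n) (Y : WordAlg R n) :
    wordMap R (moveLetter u.length m) (word R u * (b * (letter R z * Y))) =
      word R u * (letter R z * (b * Y)) := by
  have h : wordMap R (moveLetter u.length m) ∘ₗ LinearMap.mulLeft R (word R u) ∘ₗ
        LinearMap.mulLeft R b ∘ₗ LinearMap.mulLeft R (letter R z) =
      LinearMap.mulLeft R (word R u) ∘ₗ LinearMap.mulLeft R (letter R z) ∘ₗ
        LinearMap.mulLeft R b := by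
    refine wordAlg_hom_ext fun w => ?_
    simp only [LinearMap.comp_apply, LinearMap.mulLeft_apply]
    induction hb using Submodule.span_induction with
    | mem x hx =>
      obtain ⟨v, rfl, rfl⟩ := hx
      rw [letter, ← word_append, ← word_append, ← word_append, ← word_append, ← word_append,
        ← word_append, wordMap_word, List.singleton_append, moveLetter_append,
        List.singleton_append]
    | zero => simp
    | add x y _ _ hx hy => simp only [add_mul, mul_add, map_add, hx, hy]
    | smul r x _ hx => simp only [smul_mul_assoc, mul_smul_comm, map_smul, hx]
  exact LinearMap.congr_fun h Y

/-- Each factor 1 - `moveLetter` turns the bracket b followed by the letter z into bz - zb, the next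
nested bracket. -/
theorem dynkinWord_word (u : List (Fin n)) (w : List (Fin n)) (Y : WordAlg R n) {m : ℕ}
    (hw : w.length = m + 1) :
    dynkinWord R n u.length m (word R u * (word R w * Y)) =
      word R u * (nestBr (letter R) (letter R) w * Y) := by
  induction m generalizing w Y with
  | zero =>
    obtain ⟨a, rfl⟩ := List.length_eq_one_iff.1 hw
    rfl
  | succ m ih =>
    obtain ⟨v, z, rfl⟩ : ∃ v z, w = v ++ [z] :=
      ⟨_, _, (List.dropLast_append_getLast (List.ne_nil_of_length_eq_add_one hw)).symm⟩
    have hv : v.length = m + 1 := by simpa using hw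
    have hv' : v ≠ [] := List.ne_nil_of_length_eq_add_one hv
    rw [dynkinWord, Module.End.mul_apply, word_append, mul_assoc, ih v _ hv,
      nestBr_append_singleton, if_neg hv', add_zero, LinearMap.sub_apply, Module.End.one_apply]
    have hb := nestBr_mem_homog (R := R) v
    rw [hv] at hb
    have := wordMap_moveLetter u hb z Y
    rw [letter] at this ⊢
    rw [this]
    simp only [sub_mul, mul_sub, mul_assoc]

/-- The operators of the later blocks act first; each leaves everything to its left as a fixed
prefix and everything to its right as a passive factor. -/
theorem prod_dynkinWord (L : List (List (Fin n))) (hL : ∀ w ∈ L, w ≠ []) (u : List (Fin n)) :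
    (List.ofFn fun j : Fin L.length => dynkinWord R n (u.length + ((L.map List.length).take j).sum)
      (L[j].length - 1)).prod (word R (u ++ L.flatten)) =
      word R u * (L.map (nestBr (letter R) (letter R))).prod := by
  induction L generalizing u with
  | nil => simp
  | cons w L ih =>
    have hw : w.length = w.length - 1 + 1 := by
      have := List.length_pos_iff.2 (hL w List.mem_cons_self)
      omega
    have := ih (fun v hv => hL v (List.mem_cons_of_mem _ hv)) (u ++ w)
    rw [List.append_assoc, List.length_append] at this
    simp only [List.length_cons, List.ofFn_succ, List.prod_cons, List.flatten_cons,
      Module.End.mul_apply, List.map_cons, Fin.val_zero, List.take_zero, List.sum_nil, add_zero,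
      Fin.val_succ, List.take_succ_cons, List.sum_cons, Fin.getElem_fin, List.getElem_cons_succ,
      List.getElem_cons_zero, ← add_assoc]
    simp only [Fin.getElem_fin] at this
    rw [this, word_append, mul_assoc, dynkinWord_word u w _ hw]

/-- The action on words of `ω^q`. -/
theorem toWords_omegaUp_mul (q : Composition n) (x : SymAlg R n) :
    toWords R (omegaUp R q * x) = (List.ofFn fun j : Fin q.length =>
      dynkinWord R n (q.sizeUpTo j) (q.blocksFun j - 1)).prod (toWords R x) := by
  rw [omegaUp, List.ofFn_eq_map, List.ofFn_eq_map]
  generalize List.finRange q.length = l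
  induction l with
  | nil => simp
  | cons j l ih =>
    rw [List.map_cons, List.prod_cons, List.map_cons, List.prod_cons, mul_assoc,
      Module.End.mul_apply, ← ih]
    have h₁ : q.blocksFun j = q.blocksFun j - 1 + 1 := by
      have := q.one_le_blocksFun j
      omega
    have h₂ : q.sizeUpTo j + q.blocksFun j ≤ n := by
      rw [← q.sizeUpTo_succ' j]; exact q.sizeUpTo_le _
    rw [h₁] at h₂
    rw [← toWords_dswShift_mul R h₂, ← h₁]

theorem toWords_omegaUp_mul_perm (q : Composition n) (τ : Perm (Fin n))
    (L : Fin q.length → List (Fin n)) (hL : ∀ j, (L j).length = q.blocksFun j)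
    (hτ : List.ofFn τ = (List.ofFn L).flatten) :
    toWords R (omegaUp R q * perm R τ) =
      (List.ofFn fun j => nestBr (letter R) (letter R) (L j)).prod := by
  have hlen : (List.ofFn L).length = q.length := List.length_ofFn
  have hmap : (List.ofFn L).map List.length = q.blocks := by
    rw [List.map_ofFn, ← q.ofFn_blocksFun]
    congr 1
    funext j
    exact hL j
  have := prod_dynkinWord (R := R) (List.ofFn L) (fun w hw => by
    obtain ⟨j, rfl⟩ := (List.mem_ofFn' _ _).1 hw
    have := q.one_le_blocksFun j
    rw [← List.length_pos_iff, hL]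
    omega) []
  rw [word_nil, one_mul, hmap, List.map_ofFn, List.nil_append] at this
  rw [toWords_omegaUp_mul, toWords_perm, hτ]
  refine Eq.trans ?_ this
  congr 2
  refine Eq.trans (congrArg List.ofFn (funext fun j => ?_)) (List.ofFn_congr hlen _).symm
  simp [Composition.sizeUpTo, hL]

theorem toWords_omegaUp_mul_sortPerm (q : Composition n) {f : Fin n → Fin q.length}
    (hf : sizes (fun _ => 1) f = q.blocksFun) :
    toWords R (omegaUp R q * perm R ((Face.ofFun f).sortPerm 1)) =
      (List.ofFn fun j => setBr (letter R) (letter R) (Finset.univ.filter fun x => f x = j)).prod :=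
  toWords_omegaUp_mul_perm q _ _ (fun j => by
    rw [Finset.length_sort, ← hf, sizes, Finset.sum_const, smul_eq_mul, mul_one])
    (ofFn_sortPerm_one f)

theorem omega_eq_sum (q : Composition n) :
    omega R q = ∑ f : Fin n → Fin q.length with sizes (fun _ => 1) f = q.blocksFun,
      omegaUp R q * perm R ((Face.ofFun f).sortPerm 1) := by
  rw [omega, ← toSym_faceSum, faceSum, map_sum, Finset.mul_sum]
  simp only [toSym_single, one_smul]

theorem toWords_omega (q : Composition n) :
    toWords R (omega R q) = colourSum (fun _ => 1) (setBr (letter R) (letter R)) q.blocksFun := by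
  rw [omega_eq_sum, map_sum, colourSum]
  refine Finset.sum_congr rfl fun f hf => ?_
  rw [toWords_omegaUp_mul_sortPerm q (Finset.mem_filter.1 hf).2]

-- In the algebra of words both sides become the same sum of products of nested brackets of the
-- colour classes. This places ω_q in the image of the descent subalgebra.
variable (R) in
theorem toSym_facePower (q : Composition n) :
    toSym R (facePower R (Fin n) q.blocksFun) = omega R q :=
  toWords_injective R (by rw [toWords_toSym_facePower, toWords_omega])

end DynkinWords

/-! ### Lie elements under stable sorting -/

section LieSorting

variable (R : Type*) [CommRing R] {n k l : ℕ}

/-- The subwords of a word formed by the letters of each colour. -/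
def colourSplit (f : Fin n → Fin l) : FreeMonoid (Fin n) →* (Fin l → FreeMonoid (Fin n)) where
  toFun w j := FreeMonoid.ofList (w.toList.filter fun x => f x = j)
  map_one' := rfl
  map_mul' v w := funext fun j => by
    rw [FreeMonoid.toList_mul, List.filter_append, FreeMonoid.ofList_append, Pi.mul_apply]

theorem colourSplit_of (f : Fin n → Fin l) (a : Fin n) :
    colourSplit f (FreeMonoid.of a) = Pi.mulSingle (f a) (FreeMonoid.of a) := by
  funext j
  by_cases h : f a = j
  · subst h
    rw [Pi.mulSingle_eq_same]
    change FreeMonoid.ofList ([a].filter fun x => f x = f a) = _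
    simp
  · rw [Pi.mulSingle_eq_of_ne (Ne.symm h)]
    change FreeMonoid.ofList ([a].filter fun x => f x = j) = _
    simp [h]

/-- The algebra of tuples of words. -/
abbrev MultiWordAlg (R : Type*) [CommRing R] (n l : ℕ) : Type _ :=
  MonoidAlgebra R (Fin l → FreeMonoid (Fin n))

/-- The algebra homomorphism splitting words by a colouring of the letters. -/
noncomputable def splitHom (f : Fin n → Fin l) : WordAlg R n →ₐ[R] MultiWordAlg R n l :=
  MonoidAlgebra.mapDomainAlgHom R R (colourSplit f)

/-- The inclusion of words as the `j`-th component of tuples of words. -/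
noncomputable def inclHom (j : Fin l) : WordAlg R n →ₐ[R] MultiWordAlg R n l :=
  MonoidAlgebra.mapDomainAlgHom R R (MonoidHom.mulSingle (fun _ => FreeMonoid (Fin n)) j)

/-- Concatenation of tuples of words. -/
noncomputable def concatWords : MultiWordAlg R n l →ₗ[R] WordAlg R n :=
  MonoidAlgebra.mapDomainLinearMap R R fun m => (List.ofFn m).prod

theorem splitHom_single (f : Fin n → Fin l) (w : FreeMonoid (Fin n)) :
    splitHom R f (MonoidAlgebra.single w 1) = MonoidAlgebra.single (colourSplit f w) 1 := by
  simp [splitHom]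

theorem inclHom_single (j : Fin l) (w : FreeMonoid (Fin n)) (r : R) :
    inclHom R j (MonoidAlgebra.single w r) = MonoidAlgebra.single (Pi.mulSingle j w) r := by
  simp [inclHom]

theorem concatWords_single (m : Fin l → FreeMonoid (Fin n)) :
    concatWords R (MonoidAlgebra.single m 1) = MonoidAlgebra.single (List.ofFn m).prod 1 := by
  simp [concatWords]

theorem concatWords_splitHom (f : Fin n → Fin l) (y : WordAlg R n) :
    concatWords R (splitHom R f y) = wordMap R (sortList f) y := by
  have : concatWords R ∘ₗ (splitHom R f).toLinearMap = wordMap R (sortList f) :=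
    wordAlg_hom_ext fun w => by
      rw [LinearMap.comp_apply, AlgHom.toLinearMap_apply, wordMap_word, word, splitHom_single,
        concatWords_single, word, sortList, FreeMonoid.ofList_flatten, List.map_map,
        List.ofFn_eq_map]
      rfl
  exact LinearMap.congr_fun this y

variable {R}

theorem splitHom_letter (f : Fin n → Fin l) (a : Fin n) :
    splitHom R f (letter R a) = inclHom R (f a) (letter R a) := by
  have : letter R a = MonoidAlgebra.single (FreeMonoid.of a) 1 := rfl
  rw [this, splitHom_single, inclHom_single, colourSplit_of]

theorem inclHom_commute {i j : Fin l} (h : i ≠ j) (x y : WordAlg R n) :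
    inclHom R i x * inclHom R j y = inclHom R j y * inclHom R i x := by
  induction x using MonoidAlgebra.induction_linear with
  | zero => simp
  | add a b ha hb => rw [map_add, add_mul, mul_add, ha, hb]
  | single v r =>
    induction y using MonoidAlgebra.induction_linear with
    | zero => simp
    | add a b ha hb => rw [map_add, add_mul, mul_add, ha, hb]
    | single w r' =>
      have hc : Commute (Pi.mulSingle i v : Fin l → FreeMonoid (Fin n)) (Pi.mulSingle j w) :=
        Pi.mulSingle_commute (f := fun _ => FreeMonoid (Fin n)) h v w
      rw [inclHom_single, inclHom_single, MonoidAlgebra.single_mul_single,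
        MonoidAlgebra.single_mul_single, mul_comm r, hc.eq]

theorem splitHom_nestBr_of_const {f : Fin n → Fin l} {j : Fin l} {w : List (Fin n)}
    (h : ∀ x ∈ w, f x = j) : splitHom R f (nestBr (letter R) (letter R) w) =
      inclHom R j (nestBr (letter R) (letter R) w) := by
  induction w using List.reverseRecOn with
  | nil => rw [nestBr, map_zero, map_zero]
  | append_singleton w a ih =>
    have ha : splitHom R f (letter R a) = inclHom R j (letter R a) := by
      rw [splitHom_letter, h a (by simp)]
    have hw := ih fun x hx => h x (by simp [hx])
    rw [nestBr_append_singleton, map_add, map_sub, map_mul, map_mul, map_add, map_sub, map_mul,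
      map_mul, ha, hw]
    split_ifs
    · rw [ha]
    · rw [map_zero, map_zero]

/-- After splitting, letters of different colours commute. A nested bracket therefore dies at the
first letter whose colour differs from the earlier ones. -/
theorem splitHom_nestBr_of_ne {f : Fin n → Fin l} {w : List (Fin n)}
    (h : ∃ x ∈ w, ∃ y ∈ w, f x ≠ f y) : splitHom R f (nestBr (letter R) (letter R) w) = 0 := by
  induction w using List.reverseRecOn with
  | nil => simp at h
  | append_singleton w a ih =>
    have hw : w ≠ [] := by
      rintro rfl
      simp at h
    rw [nestBr_append_singleton, if_neg hw, add_zero, map_sub, map_mul, map_mul]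
    by_cases h' : ∃ x ∈ w, ∃ y ∈ w, f x ≠ f y
    · rw [ih h', mul_zero, zero_mul, sub_zero]
    · push Not at h'
      obtain ⟨b, hb⟩ := List.exists_mem_of_ne_nil w hw
      have hc : ∀ x ∈ w, f x = f b := fun x hx => h' x hx b hb
      have hne : f b ≠ f a := by
        intro hba
        obtain ⟨x, hx, y, hy, hxy⟩ := h
        have : ∀ z ∈ w ++ [a], f z = f b := by
          intro z hz
          rcases List.mem_append.1 hz with hz | hz
          · exact hc z hz
          · rw [List.mem_singleton.1 hz, hba]
        exact hxy ((this x hx).trans (this y hy).symm)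
      rw [splitHom_nestBr_of_const hc, splitHom_letter, inclHom_commute hne, sub_self]

theorem prod_comp_sortPerm {M : Type*} [Monoid M] (g : Fin k → Fin l) (y : Fin k → M) :
    (List.ofFn fun i => y ((Face.ofFun g).sortPerm 1 i)).prod = (List.ofFn fun j =>
      (((Finset.univ.filter fun i => g i = j).sort (· ≤ ·)).map y).prod).prod := by
  have : (List.ofFn fun i => y ((Face.ofFun g).sortPerm 1 i)) =
      (List.ofFn ((Face.ofFun g).sortPerm 1)).map y := by
    rw [List.map_ofFn]; rfl
  rw [this, ofFn_sortPerm_one, List.map_flatten, List.prod_flatten, List.map_ofFn, List.map_ofFn]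
  rfl

theorem prod_map_mulSingle {M : Type*} [Monoid M] (g : Fin k → Fin l) (v : Fin k → M) (j : Fin l)
    (L : List (Fin k)) :
    (L.map fun i => (Pi.mulSingle (g i) (v i) : Fin l → M)).prod j =
      ((L.filter fun i => g i = j).map v).prod := by
  induction L with
  | nil => rfl
  | cons a L ih =>
    rw [List.map_cons, List.prod_cons, Pi.mul_apply, ih]
    by_cases h : g a = j
    · subst h
      rw [Pi.mulSingle_eq_same, List.filter_cons_of_pos (by simp), List.map_cons, List.prod_cons]
    · rw [Pi.mulSingle_eq_of_ne (Ne.symm h), List.filter_cons_of_neg (by simpa using h), one_mul]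

theorem prod_ofFn_single {M : Type*} [Monoid M] (m : Fin k → M) :
    (List.ofFn fun i => (MonoidAlgebra.single (m i) 1 : MonoidAlgebra R M)).prod =
      MonoidAlgebra.single (List.ofFn m).prod 1 := by
  have := map_list_prod (MonoidAlgebra.of R M) (List.ofFn m)
  rw [List.map_ofFn] at this
  exact this.symm

/-- Both sides are multilinear in y, so it suffices to take words, where concatenation collects the
factors of each colour in their original order. -/
theorem concatWords_prod_inclHom (g : Fin k → Fin l) (y : Fin k → WordAlg R n) :
    concatWords R (List.ofFn fun i => inclHom R (g i) (y i)).prod =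
      (List.ofFn fun j => incProd y (Finset.univ.filter fun i => g i = j)).prod := by
  have h : (concatWords R).compMultilinearMap
      ((MultilinearMap.mkPiAlgebraFin R k (MultiWordAlg R n l)).compLinearMap
        fun i => (inclHom R (g i)).toLinearMap) =
      (MultilinearMap.mkPiAlgebraFin R k (WordAlg R n)).domDomCongr
        ((Face.ofFun g).sortPerm 1) := by
    refine Module.Basis.ext_multilinear
      (fun _ => MonoidAlgebra.basis (FreeMonoid (Fin n)) R) fun v => ?_
    simp only [MonoidAlgebra.basis_apply, LinearMap.compMultilinearMap_apply,
      MultilinearMap.compLinearMap_apply, MultilinearMap.mkPiAlgebraFin_apply,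
      AlgHom.toLinearMap_apply, inclHom_single, MultilinearMap.domDomCongr_apply,
      prod_ofFn_single, concatWords_single]
    congr 1
    rw [prod_comp_sortPerm g v]
    congr 2
    funext j
    rw [List.ofFn_eq_map, prod_map_mulSingle, filter_finRange_eq_sort]
  have := congrArg (fun φ => φ y) h
  simp only [LinearMap.compMultilinearMap_apply, MultilinearMap.compLinearMap_apply,
      MultilinearMap.mkPiAlgebraFin_apply, AlgHom.toLinearMap_apply,
      MultilinearMap.domDomCongr_apply] at this
  rw [this, prod_comp_sortPerm g y]
  rfl

/-- The product of the brackets of the fibres of a colouring. -/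
noncomputable def fibreBr (R : Type*) [CommRing R] (u : Fin n → Fin k) (i : Fin k) : WordAlg R n :=
  setBr (letter R) (letter R) (Finset.univ.filter fun x => u x = i)

theorem wordMap_sortList_prod (f : Fin n → Fin l) (y : Fin k → WordAlg R n) :
    wordMap R (sortList f) (List.ofFn y).prod =
      concatWords R (List.ofFn fun i => splitHom R f (y i)).prod := by
  rw [← concatWords_splitHom, map_list_prod, List.map_ofFn]
  rfl

theorem wordMap_sortList_comp (u : Fin n → Fin k) (g : Fin k → Fin l) :
    wordMap R (sortList (g ∘ u)) (List.ofFn (fibreBr R u)).prod =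
      (List.ofFn fun j => incProd (fibreBr R u) (Finset.univ.filter fun i => g i = j)).prod := by
  rw [wordMap_sortList_prod, ← concatWords_prod_inclHom]
  have : ∀ i, splitHom R (g ∘ u) (fibreBr R u i) = inclHom R (g i) (fibreBr R u i) := fun i =>
    splitHom_nestBr_of_const fun x hx => by
      rw [Finset.mem_sort, Finset.mem_filter] at hx
      rw [Function.comp_apply, hx.2]
  simp only [this]

theorem wordMap_sortList_of_ne {u : Fin n → Fin k} {f : Fin n → Fin l}
    (h : ∃ x y, u x = u y ∧ f x ≠ f y) :
    wordMap R (sortList f) (List.ofFn (fibreBr R u)).prod = 0 := by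
  obtain ⟨x, y, hxy, hf⟩ := h
  rw [wordMap_sortList_prod, List.prod_eq_zero, map_zero]
  rw [List.mem_ofFn]
  refine ⟨u x, splitHom_nestBr_of_ne ⟨x, ?_, y, ?_, hf⟩⟩ <;> simp [hxy]

/-- Sorting by f kills the product of brackets unless f is constant on the fibres of u. The
surviving f factor through u, and sorting then only rearranges the brackets as if they were letters
of weights `sizes (fun _ => 1) u`. -/
theorem sum_wordMap_sortList {u : Fin n → Fin k} (hu : Function.Surjective u) (s : Fin l → ℕ) :
    ∑ f : Fin n → Fin l with sizes (fun _ => 1) f = s,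
      wordMap R (sortList f) (List.ofFn (fibreBr R u)).prod =
    colourSum (sizes (fun _ => 1) u) (incProd (fibreBr R u)) s := by
  symm
  refine Finset.sum_of_injOn (fun g => g ∘ u) (hu.injective_comp_right.injOn) ?_ ?_ ?_
  · intro g hg
    simp only [Finset.coe_filter, Finset.mem_univ, true_and, Set.mem_ofPred_eq] at hg ⊢
    rw [← hg]
    exact sizes_comp (fun _ => 1) u g
  · intro f hf hf'
    refine wordMap_sortList_of_ne ?_
    by_contra hcon
    push Not at hcon
    refine hf' ⟨fun i => f (hu i).choose, ?_, ?_⟩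
    · simp only [Finset.coe_filter, Finset.mem_univ, true_and, Set.mem_ofPred_eq]
      refine (sizes_comp (fun _ => 1) u _).symm.trans (Eq.trans ?_ (Finset.mem_filter.1 hf).2)
      congr 1
      funext x
      exact hcon _ _ (hu (u x)).choose_spec
    · funext x
      exact hcon _ _ (hu (u x)).choose_spec
  · intro g _
    exact (wordMap_sortList_comp u g).symm

/-- The order of the centralizer of a permutation whose cycle type is given by `q`. -/
noncomputable def centralizerCard (q : Composition n) : ℕ :=
  symCount q.blocksFun * ∏ j, q.blocksFun j

/-- The transfer principle applied to the action on a fixed product of brackets, which plays the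
role of the word with letters `fibreBr R u i`. -/
theorem toWords_facePower_act (q : Composition n) {u : Fin n → Fin q.length}
    (hu : sizes (fun _ => 1) u = q.blocksFun) :
    toWords R (faceAct R (facePower R (Fin n) q.blocksFun)
      (omegaUp R q * perm R ((Face.ofFun u).sortPerm 1))) =
    colourSum q.blocksFun (setBr (fun i => q.blocksFun i • fibreBr R u i) (fibreBr R u))
      q.blocksFun := by
  have hpos : ∀ j, 0 < q.blocksFun j := fun j => q.one_le_blocksFun j
  have hsurj := surjective_of_sizes_pos hpos hu
  have := map_facePower (R := R) (X := Fin n) hpos (P := fibreBr R u)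
    (L := toWords R ∘ₗ (LinearMap.applyₗ (omegaUp R q * perm R ((Face.ofFun u).sortPerm 1))) ∘ₗ
      (faceAct R).toLinearMap) (fun l s => by
      rw [← hu, ← sum_wordMap_sortList hsurj]
      simp only [LinearMap.comp_apply, AlgHom.toLinearMap_apply, LinearMap.applyₗ_apply_apply]
      rw [faceSum, map_sum, LinearMap.sum_apply, map_sum]
      simp only [toWords_faceAct, toWords_omegaUp_mul_sortPerm q hu]
      rfl) q.blocksFun
  exact this

theorem prod_setBr_of_bijective {d : Fin k → ℕ} {g : Fin k → Fin k} (hg : Function.Bijective g)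
    (hd : ∀ i, d (g i) = d i) (u : Fin n → Fin k) :
    (List.ofFn fun j => setBr (fun i => d i • fibreBr R u i) (fibreBr R u)
      (Finset.univ.filter fun i => g i = j)).prod =
    (∏ j, d j) • (List.ofFn (fibreBr R (g ∘ u))).prod := by
  have h₁ : ∀ j, setBr (fun i => d i • fibreBr R u i) (fibreBr R u)
      (Finset.univ.filter fun i => g i = j) = d j • fibreBr R (g ∘ u) j := by
    intro j
    obtain ⟨i, rfl⟩ := hg.surjective j
    have e₁ : (Finset.univ.filter fun i' => g i' = g i) = {i} := by
      ext i'; simp [hg.injective.eq_iff]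
    have e₂ : (Finset.univ.filter fun x => (g ∘ u) x = g i) =
        Finset.univ.filter fun x => u x = i := by
      ext x; simp [hg.injective.eq_iff]
    rw [e₁, setBr_singleton, hd, fibreBr, fibreBr, e₂]
  simp only [h₁]
  exact (MultilinearMap.mkPiAlgebraFin ℕ k (WordAlg R n)).map_smul_univ _ _

theorem sum_comp_of_injective (q : Composition n) {V : Type*} [AddCommMonoid V]
    {g : Fin q.length → Fin q.length} (hg : Function.Injective g)
    (hs : sizes q.blocksFun g = q.blocksFun) (h : (Fin n → Fin q.length) → V) :
    ∑ u : Fin n → Fin q.length with sizes (fun _ => 1) u = q.blocksFun, h (g ∘ u) =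
      ∑ u : Fin n → Fin q.length with sizes (fun _ => 1) u = q.blocksFun, h u := by
  have hmaps : Set.MapsTo (fun u : Fin n → Fin q.length => g ∘ u)
      (Finset.univ.filter fun u => sizes (fun _ => 1) u = q.blocksFun :
        Finset (Fin n → Fin q.length))
      (Finset.univ.filter fun u => sizes (fun _ => 1) u = q.blocksFun :
        Finset (Fin n → Fin q.length)) := by
    intro u hu
    simp only [Finset.coe_filter, Finset.mem_univ, true_and, Set.mem_ofPred_eq] at hu ⊢
    refine (sizes_comp (fun _ => 1) u g).trans ?_
    rw [hu, hs]
  exact Finset.sum_nbij (fun u => g ∘ u) hmaps hg.comp_left.injOn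
    (Finset.surjOn_of_injOn_of_card_le _ hmaps hg.comp_left.injOn le_rfl) fun _ _ => rfl

/-- The left factor acts through its lift on each product of brackets of the right factor.
Colourings g of the blocks preserving all weights are surjective, hence bijective, so every outer
bracket has one entry and contributes a part of q. Each of the `symCount` many g then merely
reindexes the sum over u. -/
theorem omega_mul_self (q : Composition n) :
    omega R q * omega R q = (centralizerCard q : R) • omega R q := by
  refine toWords_injective R ?_
  have hpos : ∀ j, 0 < q.blocksFun j := fun j => q.one_le_blocksFun j
  have hmem := faceDescent_le_faceInvariants R (Fin n) (facePower_mem R (Fin n) q.blocksFun)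
  have hω : toWords R (omega R q) = ∑ u : Fin n → Fin q.length with
      sizes (fun _ => 1) u = q.blocksFun, (List.ofFn (fibreBr R u)).prod := toWords_omega q
  conv_lhs => rw [← toSym_facePower, toSym_mul R hmem, toSym_facePower, omega_eq_sum]
  rw [map_sum, map_sum]
  have h₁ : ∀ u ∈ Finset.univ.filter fun u : Fin n → Fin q.length =>
      sizes (fun _ => 1) u = q.blocksFun,
      toWords R (faceAct R (facePower R (Fin n) q.blocksFun)
        (omegaUp R q * perm R ((Face.ofFun u).sortPerm 1))) =
      ∑ g : Fin q.length → Fin q.length with sizes q.blocksFun g = q.blocksFun,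
        (∏ j, q.blocksFun j) • (List.ofFn (fibreBr R (g ∘ u))).prod := by
    intro u hu
    rw [toWords_facePower_act q (Finset.mem_filter.1 hu).2, colourSum]
    refine Finset.sum_congr rfl fun g hg => ?_
    have hg' := (Finset.mem_filter.1 hg).2
    have hbij := Finite.surjective_iff_bijective.1 (surjective_of_sizes_pos hpos hg')
    refine prod_setBr_of_bijective hbij (fun i => ?_) u
    have := sizes_of_injective (d := q.blocksFun) hbij.injective i
    rwa [hg'] at this
  rw [Finset.sum_congr rfl h₁, Finset.sum_comm]
  have h₂ : ∀ g ∈ Finset.univ.filter fun g : Fin q.length → Fin q.length =>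
      sizes q.blocksFun g = q.blocksFun,
      ∑ u : Fin n → Fin q.length with sizes (fun _ => 1) u = q.blocksFun,
        (∏ j, q.blocksFun j) • (List.ofFn (fibreBr R (g ∘ u))).prod =
      (∏ j, q.blocksFun j) • toWords R (omega R q) := by
    intro g hg
    have hg' := (Finset.mem_filter.1 hg).2
    have hinj := (Finite.surjective_iff_bijective.1 (surjective_of_sizes_pos hpos hg')).injective
    rw [sum_comp_of_injective q hinj hg' fun u =>
      (∏ j, q.blocksFun j) • (List.ofFn (fibreBr R u)).prod, ← Finset.smul_sum, hω]
  have h₃ : (Finset.univ.filter fun g : Fin q.length → Fin q.length =>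
      sizes q.blocksFun g = q.blocksFun).card = symCount q.blocksFun := by
    rw [← card_bijective_colourings (d := q.blocksFun) rfl, Nat.card_eq_fintype_card,
      Fintype.card_subtype]
    congr 1
    ext g
    simp only [Finset.mem_filter, Finset.mem_univ, true_and]
    exact ⟨fun h => ⟨Finite.surjective_iff_bijective.1 (surjective_of_sizes_pos hpos h), h⟩,
      fun h => h.2⟩
  rw [Finset.sum_congr rfl h₂, Finset.sum_const, h₃, smul_smul, map_smul, Nat.cast_smul_eq_nsmul,
    centralizerCard]

end LieSorting

/-! ### The coefficient of the identity -/

section IdentityCoefficient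

theorem mul_incProd_eq_zero {ι Q : Type*} [LinearOrder ι] [Ring Q] {P : ι → Q}
    (hP : ∀ a b, a < b → P b * P a = 0) {b : ι} {S : Finset ι} (hS : ∀ a ∈ S, a < b)
    (hne : S.Nonempty) : P b * incProd P S = 0 := by
  induction S using Finset.induction_on_max with
  | empty => simp at hne
  | insert a S ha ih =>
    rw [incProd_insert_max P ha, ← mul_assoc]
    rcases S.eq_empty_or_nonempty with rfl | h
    · rw [incProd_empty, mul_one, hP a b (hS a (by simp))]
    · rw [ih (fun x hx => hS x (Finset.mem_insert_of_mem hx)) h, zero_mul]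

/-- In every commutator the term beginning with the largest letter contains a vanishing product P b
* P a with a < b, so only the increasing product is left. -/
theorem setBr_eq_incProd {ι Q : Type*} [LinearOrder ι] [Ring Q] {P : ι → Q}
    (hP : ∀ a b, a < b → P b * P a = 0) {S : Finset ι} (hne : S.Nonempty) :
    setBr P P S = incProd P S := by
  induction S using Finset.induction_on_max with
  | empty => simp at hne
  | insert a S ha ih =>
    rw [setBr_insert_max P P ha, incProd_insert_max P ha]
    rcases S.eq_empty_or_nonempty with rfl | h
    · simp [setBr_empty, incProd_empty]
    · rw [ih h, mul_incProd_eq_zero hP ha h, if_neg h.ne_empty, sub_zero, add_zero]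

theorem map_nestBr {ι Q Q' : Type*} [Ring Q] [Ring Q'] (φ : Q →+* Q') (c P : ι → Q) (w : List ι) :
    φ (nestBr c P w) = nestBr (fun i => φ (c i)) (fun i => φ (P i)) w := by
  induction w using List.reverseRecOn with
  | nil => exact map_zero φ
  | append_singleton w a ih =>
    rw [nestBr_append_singleton, nestBr_append_singleton, map_add, map_sub, map_mul, map_mul, ih]
    split_ifs <;> simp

theorem map_colourSum {ι Q Q' : Type*} [LinearOrder ι] [Fintype ι] [Ring Q] [Ring Q'] (φ : Q →+* Q')
    (d : ι → ℕ) (h : Finset ι → Q) {l : ℕ} (s : Fin l → ℕ) :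
    φ (colourSum d h s) = colourSum d (fun S => φ (h S)) s := by
  rw [colourSum, map_sum, colourSum]
  refine Finset.sum_congr rfl fun f _ => ?_
  rw [map_list_prod, List.map_ofFn]
  rfl

variable {R : Type*} [CommRing R] {n : ℕ}

/-- The matrix unit by which the letter `i` acts. -/
def letterMat (R : Type*) [CommRing R] {n : ℕ} (i : Fin n) : Matrix (Fin (n + 1)) (Fin (n + 1)) R :=
  Matrix.single i.castSucc i.succ 1

theorem letterMat_mul_eq_zero {a b : Fin n} (h : a < b) :
    letterMat R b * letterMat R a = 0 := by
  refine Matrix.single_mul_single_of_ne _ _ _ _ (fun h' => ?_) _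
  have := congrArg Fin.val h'
  have := Fin.lt_def.1 h
  simp at *
  omega

theorem prod_letterMat_apply (w : List (Fin n)) (i j : Fin (n + 1)) :
    (w.map (letterMat R)).prod i j =
      if w.map Fin.val = List.range' i w.length ∧ j.val = i + w.length then 1 else 0 := by
  induction w generalizing i with
  | nil => simp [Matrix.one_apply, Fin.ext_iff, eq_comm]
  | cons a w ih =>
    rw [List.map_cons, List.prod_cons, letterMat, List.map_cons, List.length_cons, List.range'_succ]
    by_cases h : i = a.castSucc
    · subst h
      rw [Matrix.single_mul_apply_same, one_mul, ih]
      simp only [Fin.val_succ, Fin.val_castSucc, List.cons.injEq, true_and]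
      congr 3
      omega
    · rw [Matrix.single_mul_apply_of_ne _ _ _ _ _ h, if_neg]
      rintro ⟨h', -⟩
      rw [List.cons.injEq] at h'
      exact h (Fin.ext h'.1.symm)

/-- The representation of words by products of matrix units. -/
noncomputable def wordRep (R : Type*) [CommRing R] (n : ℕ) :
    WordAlg R n →ₐ[R] Matrix (Fin (n + 1)) (Fin (n + 1)) R :=
  MonoidAlgebra.lift R _ _ (FreeMonoid.lift (letterMat R))

theorem wordRep_word (w : List (Fin n)) : wordRep R n (word R w) = (w.map (letterMat R)).prod := by
  rw [wordRep, word, MonoidAlgebra.lift_single, one_smul, FreeMonoid.lift_apply]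
  rfl

/-- The matrix units compose to a path from 0 to n only along the word 0, 1, …, n - 1, which is the
word of the identity. -/
theorem wordRep_toWords_apply (a : SymAlg R n) :
    wordRep R n (toWords R a) 0 (Fin.last n) = a.coeff 1 := by
  have h : Matrix.entryLinearMap R R (0 : Fin (n + 1)) (Fin.last n) ∘ₗ (wordRep R n).toLinearMap ∘ₗ
      toWords R = (Finsupp.lapply 1) ∘ₗ (MonoidAlgebra.coeffLinearEquiv R).toLinearMap := by
    refine symAlg_hom_ext fun σ => ?_
    change wordRep R n (toWords R (perm R σ)) 0 (Fin.last n) = (perm R σ).coeff 1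
    rw [toWords_perm, wordRep_word, prod_letterMat_apply]
    have h₁ : (List.ofFn σ).map Fin.val = List.range' 0 n ↔ MulOpposite.op σ = 1 := by
      have e : List.range' 0 n = (List.ofFn (1 : Perm (Fin n))).map Fin.val := by
        rw [List.map_ofFn, ← List.range_eq_range', List.ofFn_eq_map, ← List.map_coe_finRange_eq_range]
        rfl
      rw [e, (List.map_injective_iff.2 Fin.val_injective).eq_iff, List.ofFn_injective.eq_iff,
        Equiv.coe_fn_injective.eq_iff, ← MulOpposite.op_one, MulOpposite.op_injective.eq_iff]
    simp only [List.length_ofFn, Fin.val_zero, Fin.val_last, zero_add, and_true, h₁]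
    rw [perm, MonoidAlgebra.of_apply, MonoidAlgebra.coeff_single, Finsupp.single_apply]
  exact LinearMap.congr_fun h a

/-- In the matrix unit representation brackets and increasing products agree, so ω_q and Ξ^q have
the same coefficient at the identity; in Ξ^q it is 1 because the identity has no descents. -/
theorem omega_coeff_one (q : Composition n) : (omega R q).coeff 1 = 1 := by
  have h : wordRep R n (toWords R (omega R q)) = wordRep R n (toWords R (Xi R q)) := by
    rw [toWords_omega, ← toSym_faceSum, toWords_toSym_faceSum]
    refine (map_colourSum (wordRep R n).toRingHom _ _ _).trans
      (Eq.trans ?_ (map_colourSum (wordRep R n).toRingHom _ _ _).symm)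
    rw [colourSum, colourSum]
    refine Finset.sum_congr rfl fun f hf => ?_
    congr 2
    funext j
    have hlet : ∀ i, (wordRep R n).toRingHom (letter R i) = letterMat R i := fun i => by
      change wordRep R n (word R [i]) = _
      rw [wordRep_word]; simp
    have hne : (Finset.univ.filter fun x => f x = j).Nonempty := by
      have h₁ : (Finset.univ.filter fun x => f x = j).card = q.blocksFun j := by
        rw [← (Finset.mem_filter.1 hf).2, sizes, Finset.sum_const, smul_eq_mul, mul_one]
      rw [← Finset.card_pos, h₁]
      exact q.one_le_blocksFun j
    rw [setBr, map_nestBr, incProd, map_list_prod, List.map_map]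
    simp only [Function.comp_def, hlet]
    exact setBr_eq_incProd (fun a b hab => letterMat_mul_eq_zero hab) hne
  classical
  rw [← wordRep_toWords_apply, h, wordRep_toWords_apply, Xi]
  have h₁ : (1 : Perm (Fin n)) ∈ (Finset.univ.filter fun σ : Perm (Fin n) =>
      descents σ ⊆ {i | ∃ j ∈ Finset.Icc 1 q.length, i = q.sizeUpTo j}) := by
    simp only [Finset.mem_filter, Finset.mem_univ, true_and]
    rintro i ⟨hi, hn, hlt⟩
    rw [Perm.one_apply, Perm.one_apply, Fin.mk_lt_mk] at hlt
    omega
  rw [MonoidAlgebra.coeff_sum, Finset.sum_apply', Finset.sum_eq_single_of_mem _ h₁]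
  · rw [perm, MonoidAlgebra.of_apply, MonoidAlgebra.coeff_single, MulOpposite.op_one,
      Finsupp.single_eq_same]
  · intro σ _ hσ
    rw [perm, MonoidAlgebra.of_apply, MonoidAlgebra.coeff_single, Finsupp.single_eq_of_ne]
    exact fun h => hσ (MulOpposite.op_injective (h.symm.trans MulOpposite.op_one.symm))

end IdentityCoefficient

/-! ### Ranks of multiples of idempotents -/

section Rank

open Polynomial

theorem charpoly_trace_of_mul_self {K V : Type*} [Field K] [AddCommGroup V] [Module K V]
    [FiniteDimensional K V] {f : Module.End K V} {c : K} (hc : c ≠ 0) (hf : f * f = c • f) :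
    f.charpoly = (X - C c) ^ Module.finrank K (LinearMap.range f) *
        X ^ Module.finrank K (LinearMap.ker f) ∧
      LinearMap.trace K V f = Module.finrank K (LinearMap.range f) * c := by
  have hff : ∀ v, f (f v) = c • f v := fun v => LinearMap.congr_fun hf v
  have hcompl : IsCompl (LinearMap.range f) (LinearMap.ker f) := by
    rw [isCompl_iff, Submodule.disjoint_def, codisjoint_iff, Submodule.eq_top_iff']
    refine ⟨?_, fun v => ?_⟩
    · rintro _ ⟨v, rfl⟩ hv
      rw [LinearMap.mem_ker, hff] at hv
      exact (smul_eq_zero.1 hv).resolve_left hc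
    · have hv : v = f (c⁻¹ • v) + (v - f (c⁻¹ • v)) := (add_sub_cancel _ _).symm
      rw [hv]
      refine Submodule.add_mem_sup ⟨_, rfl⟩ ?_
      rw [LinearMap.mem_ker, map_sub, hff, ← map_smul, smul_inv_smul₀ hc, sub_self]
  let e := Submodule.prodEquivOfIsCompl _ _ hcompl
  -- The map f acts as c on its range and as 0 on its kernel. The scalar c is written 0 - (-c) • 1
  -- so that its characteristic polynomial is a translate of that of 0.
  let g : Module.End K (LinearMap.range f × LinearMap.ker f) :=
    LinearMap.prodMap (0 - (-c) • (1 : Module.End K (LinearMap.range f)))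
      (0 : Module.End K (LinearMap.ker f))
  have hg : e.conj g = f := by
    refine LinearMap.ext fun v => ?_
    obtain ⟨⟨⟨_, w, rfl⟩, b, hb⟩, rfl⟩ := e.surjective v
    rw [LinearEquiv.conj_apply_apply, e.symm_apply_apply]
    have hb' : f b = 0 := hb
    simp [e, g, hff, hb']
  constructor
  · conv_lhs => rw [← hg, LinearEquiv.charpoly_conj, LinearMap.charpoly_prodMap,
      LinearMap.charpoly_sub_smul, LinearMap.charpoly_zero, LinearMap.charpoly_zero]
    rw [X_pow_comp, map_neg, ← sub_eq_add_neg]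
  · conv_lhs => rw [← hg, LinearMap.trace_conj', LinearMap.trace_prodMap']
    simp [mul_comm]

theorem eq_of_charpoly_eq {K : Type*} [Field K] {c : K} (hc : c ≠ 0) {a b a' b' : ℕ}
    (h : (X - C c) ^ a * X ^ b = (X - C c) ^ a' * X ^ b') : a = a' := by
  have key : ∀ a b : ℕ, ((X - C c) ^ a * X ^ b : K[X]).rootMultiplicity c = a := by
    intro a b
    have hne : ((X - C c) ^ a * X ^ b : K[X]) ≠ 0 :=
      mul_ne_zero (pow_ne_zero _ (X_sub_C_ne_zero c)) (pow_ne_zero _ X_ne_zero)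
    rw [rootMultiplicity_mul hne, rootMultiplicity_X_sub_C_pow, rootMultiplicity_eq_zero, add_zero]
    simp [hc]
  rw [← key a b, h, key]

theorem matrix_charpoly_trace_of_mul_self {K : Type*} [Field K] {ι : Type*} [Fintype ι]
    [DecidableEq ι] {N : Matrix ι ι K} {c : K} (hc : c ≠ 0) (hN : N * N = c • N) :
    (∃ b, N.charpoly = (X - C c) ^ N.rank * X ^ b) ∧ N.trace = N.rank * c := by
  have hf : N.toLin' * N.toLin' = c • N.toLin' := by
    rw [← map_smul, Module.End.mul_eq_comp, ← Matrix.toLin'_mul, hN]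
  obtain ⟨h₁, h₂⟩ := charpoly_trace_of_mul_self hc hf
  have hrank : N.rank = Module.finrank K (LinearMap.range N.toLin') := rfl
  rw [Matrix.charpoly_toLin'] at h₁
  rw [Matrix.trace_toLin'_eq] at h₂
  exact ⟨⟨_, h₁⟩, h₂⟩

/-- The integral characteristic polynomial is a power of X - c times a power of X. As c stays
nonzero in F, the multiplicity of c is the rank over both ℚ and F, and the trace over ℚ computes it
as an equality of integers. -/
theorem rank_mul_eq_trace {ι : Type*} [Fintype ι] [DecidableEq ι] {M : Matrix ι ι ℤ} {c : ℤ}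
    (hM : M * M = c • M) {F : Type*} [Field F] (hc : (c : F) ≠ 0) :
    ((M.map (Int.castRingHom F)).rank : ℤ) * c = M.trace := by
  have hc₀ : (c : ℚ) ≠ 0 := by
    rintro h
    rw [Int.cast_eq_zero] at h
    exact hc (by rw [h, Int.cast_zero])
  have hmul : ∀ (K : Type _) [Field K], M.map (Int.castRingHom K) * M.map (Int.castRingHom K) =
      (c : K) • M.map (Int.castRingHom K) := by
    intro K _
    rw [← Matrix.map_mul, hM]
    ext i j
    rw [Matrix.map_apply, Matrix.smul_apply, Matrix.smul_apply, Matrix.map_apply, smul_eq_mul,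
      map_mul, smul_eq_mul, eq_intCast]
  obtain ⟨⟨b₀, h₀⟩, ht⟩ := matrix_charpoly_trace_of_mul_self hc₀ (by
    rw [← Matrix.map_mul, hM]
    ext i j
    rw [Matrix.map_apply, Matrix.smul_apply, Matrix.smul_apply, Matrix.map_apply, smul_eq_mul,
      map_mul, smul_eq_mul, eq_intCast] : M.map (Int.castRingHom ℚ) * M.map (Int.castRingHom ℚ) =
      (c : ℚ) • M.map (Int.castRingHom ℚ))
  obtain ⟨⟨b, h⟩, -⟩ := matrix_charpoly_trace_of_mul_self hc (hmul F)
  have hZ : M.charpoly = (X - C c) ^ (M.map (Int.castRingHom ℚ)).rank * X ^ b₀ := by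
    refine Polynomial.map_injective (Int.castRingHom ℚ) Int.cast_injective ?_
    rw [← Matrix.charpoly_map, h₀]
    simp
  have hF := Matrix.charpoly_map M (Int.castRingHom F)
  rw [h, hZ] at hF
  have hrank : (M.map (Int.castRingHom F)).rank = (M.map (Int.castRingHom ℚ)).rank :=
    eq_of_charpoly_eq hc (b := b) (b' := b₀) (by rw [hF]; simp)
  rw [hrank]
  have htr : (M.map (Int.castRingHom ℚ)).trace = (M.trace : ℚ) := by
    rw [Matrix.trace, Matrix.trace, Int.cast_sum]
    rfl
  rw [htr] at ht
  exact_mod_cast ht.symm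

end Rank

/-! ### The dimension of the higher Lie modules -/

section LieDimension

variable {n : ℕ}

/-- The permutations as a basis of the group algebra. -/
noncomputable def permBasis (R : Type*) [CommRing R] (n : ℕ) :
    Module.Basis (Perm (Fin n)) R (SymAlg R n) :=
  (MonoidAlgebra.basis (Perm (Fin n))ᵐᵒᵖ R).reindex MulOpposite.opEquiv.symm

/-- The matrix of left multiplication by an element of the group algebra. -/
noncomputable def mulMat (R : Type*) [CommRing R] {n : ℕ} (x : SymAlg R n) :
    Matrix (Perm (Fin n)) (Perm (Fin n)) R :=
  LinearMap.toMatrix (permBasis R n) (permBasis R n) (LinearMap.mulLeft R x)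

theorem mulMat_apply {R : Type*} [CommRing R] (x : SymAlg R n) (g h : Perm (Fin n)) :
    mulMat R x g h = x.coeff (MulOpposite.op g * (MulOpposite.op h)⁻¹) := by
  rw [mulMat, LinearMap.toMatrix_apply, LinearMap.mulLeft_apply, permBasis,
    Module.Basis.reindex_apply, MonoidAlgebra.basis_apply, Module.Basis.repr_reindex_apply]
  change (x * MonoidAlgebra.single (MulOpposite.op h) 1).coeff (MulOpposite.op g) = _
  rw [MonoidAlgebra.coeff_mul_single_apply, mul_one]

theorem mulMat_mul {R : Type*} [CommRing R] (x y : SymAlg R n) :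
    mulMat R (x * y) = mulMat R x * mulMat R y := by
  rw [mulMat, mulMat, mulMat, ← LinearMap.toMatrix_mul]
  congr 1
  ext z
  simp

theorem mulMat_smul {R : Type*} [CommRing R] (r : R) (x : SymAlg R n) :
    mulMat R (r • x) = r • mulMat R x := by
  ext g h
  rw [mulMat_apply, Matrix.smul_apply, mulMat_apply]
  rfl

theorem mapRingHom_perm {R S : Type*} [CommRing R] [CommRing S] (φ : R →+* S)
    (σ : Perm (Fin n)) : MonoidAlgebra.mapRingHom _ φ (perm R σ) = perm S σ := by
  rw [perm, perm, MonoidAlgebra.of_apply, MonoidAlgebra.of_apply, MonoidAlgebra.mapRingHom_single,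
    map_one]

theorem mapRingHom_omega {R S : Type*} [CommRing R] [CommRing S] (φ : R →+* S)
    (q : Composition n) : MonoidAlgebra.mapRingHom _ φ (omega R q) = omega S q := by
  have h₁ : ∀ a m, MonoidAlgebra.mapRingHom _ φ (dswShift R n a m) = dswShift S n a m := by
    intro a m
    rw [dswShift, dswShift, map_list_prod, List.map_map]
    congr 2
    funext i
    rw [Function.comp_apply, map_sub, map_one, mapRingHom_perm]
  rw [omega, omega, map_mul, omegaUp, omegaUp, map_list_prod, List.map_ofFn, Xi, Xi, map_sum]
  simp only [mapRingHom_perm, Function.comp_def, h₁]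

theorem mem_rightIdeal {R : Type*} [CommRing R] {x y : SymAlg R n} :
    y ∈ rightIdeal x ↔ ∃ a, x * a = y := by
  rw [rightIdeal, Submodule.mem_span_singleton]
  exact ⟨fun ⟨a, h⟩ => ⟨a.unop, h⟩, fun ⟨a, h⟩ => ⟨MulOpposite.op a, h⟩⟩

theorem finrank_rightIdeal {F : Type*} [Field F] (x : SymAlg F n) :
    Module.finrank F (rightIdeal x) = (mulMat F x).rank := by
  rw [Matrix.rank_eq_finrank_range_toLin _ (permBasis F n) (permBasis F n),
    mulMat, Matrix.toLin_toMatrix]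
  have : (rightIdeal x).restrictScalars F = LinearMap.range (LinearMap.mulLeft F x) := by
    ext y
    rw [Submodule.restrictScalars_mem, mem_rightIdeal]
    rfl
  rw [← this]
  rfl

/-- Every diagonal entry of left multiplication by ω_q is its coefficient at the identity, namely 1,
so the integral trace is n!. Working over ℤ avoids losing the rank modulo p. -/
theorem finrank_LieMod {F : Type*} [Field F] (q : Composition n)
    (hc : (centralizerCard q : F) ≠ 0) :
    Module.finrank F (LieMod F q) * centralizerCard q = n.factorial := by
  have hM : mulMat ℤ (omega ℤ q) * mulMat ℤ (omega ℤ q) =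
      (centralizerCard q : ℤ) • mulMat ℤ (omega ℤ q) := by
    rw [← mulMat_mul, omega_mul_self, mulMat_smul]
  have hmap : (mulMat ℤ (omega ℤ q)).map (Int.castRingHom F) = mulMat F (omega F q) := by
    ext g h
    rw [Matrix.map_apply, mulMat_apply, mulMat_apply, ← mapRingHom_omega (Int.castRingHom F)]
    simp
  have h := rank_mul_eq_trace hM (F := F) (by exact_mod_cast hc)
  rw [hmap] at h
  have htr : (mulMat ℤ (omega ℤ q)).trace = n.factorial := by
    have : ∀ g, mulMat ℤ (omega ℤ q) g g = 1 := fun g => by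
      rw [mulMat_apply, mul_inv_cancel, omega_coeff_one]
    rw [Matrix.trace]
    simp [this, Fintype.card_perm]
  rw [htr] at h
  rw [LieMod, finrank_rightIdeal]
  exact_mod_cast h

end LieDimension

/-! ### Centralizers and conjugacy classes -/

section Classes

variable {n : ℕ}

/-- Fixed points are absent from the cycle type: as parts 1 they leave the product of the parts
unchanged and contribute the factorial of their number. -/
theorem card_centralizer_eq (q : Composition n) {σ : Perm (Fin n)}
    (h : σ.partition.parts = (q.blocks : Multiset ℕ)) :
    (Fintype.card (Fin n) - σ.cycleType.sum).factorial * σ.cycleType.prod *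
      ∏ i ∈ σ.cycleType.toFinset, (σ.cycleType.count i).factorial = centralizerCard q := by
  set M := σ.cycleType with hM
  set r := Fintype.card (Fin n) - σ.support.card with hr
  have hparts : Finset.univ.val.map q.blocksFun = M + Multiset.replicate r 1 := by
    rw [map_blocksFun, ← h, Equiv.Perm.parts_partition]
  have hprod : ∏ j, q.blocksFun j = M.prod := by
    rw [Finset.prod_eq_multiset_prod, hparts, Multiset.prod_add, Multiset.prod_replicate, one_pow,
      mul_one]
  have h1 : 1 ∉ M := fun h1 => by
    have := Equiv.Perm.two_le_of_mem_cycleType h1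
    omega
  have hcount : symCount q.blocksFun = r.factorial * ∏ i ∈ M.toFinset, (M.count i).factorial := by
    rw [symCount_eq_prod, hparts]
    have hsub : (M + Multiset.replicate r 1).toFinset ⊆ insert 1 M.toFinset := by
      intro i hi
      rw [Multiset.mem_toFinset, Multiset.mem_add] at hi
      rcases hi with hi | hi
      · exact Finset.mem_insert_of_mem (Multiset.mem_toFinset.2 hi)
      · rw [Multiset.eq_of_mem_replicate hi]; exact Finset.mem_insert_self _ _
    rw [Finset.prod_subset hsub, Finset.prod_insert (by simpa using h1)]
    · congr 1
      · rw [Multiset.count_add, Multiset.count_eq_zero_of_notMem h1, zero_add,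
          Multiset.count_replicate_self]
      · refine Finset.prod_congr rfl fun i hi => ?_
        have hi1 : i ≠ 1 := fun h => h1 (h ▸ Multiset.mem_toFinset.1 hi)
        rw [Multiset.count_add, Multiset.count_replicate, if_neg (Ne.symm hi1), add_zero]
    · intro i _ hi
      rw [Multiset.count_eq_zero_of_notMem (fun h => hi (Multiset.mem_toFinset.2 h)),
        Nat.factorial_zero]
  rw [centralizerCard, hprod, hcount, hr, hM, Equiv.Perm.sum_cycleType]
  ring

theorem ccl_eq_isConj {μ : n.Partition} {σ : Perm (Fin n)} (hσ : σ ∈ ccl μ) :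
    ccl μ = {τ | IsConj σ τ} := by
  ext τ
  have hσ' : σ.partition.parts = μ.parts := hσ
  change τ.partition.parts = μ.parts ↔ IsConj σ τ
  rw [Equiv.Perm.partition_eq_of_isConj, Nat.Partition.ext_iff, hσ', eq_comm]

theorem card_ccl_mul (q : Composition n) {μ : n.Partition}
    (h : μ.parts = (q.blocks : Multiset ℕ)) :
    Nat.card (ccl μ) * centralizerCard q = n.factorial := by
  obtain ⟨σ, hσ⟩ := ccl_nonempty μ
  have h₁ : σ.partition.parts = (q.blocks : Multiset ℕ) := Eq.trans hσ h
  have h₂ := Equiv.Perm.card_isConj_mul_eq σ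
  rw [card_centralizer_eq q h₁, Fintype.card_fin] at h₂
  rw [ccl_eq_isConj hσ]
  exact h₂

theorem centralizerCard_cast_ne_zero {F : Type*} [Field F] {p : ℕ} (hp : p.Prime) [CharP F p]
    {q : Composition n} (hq : CoprimeTo p q) {μ : n.Partition}
    (h : μ.parts = (q.blocks : Multiset ℕ)) (hμ : IsRegular p μ) :
    (centralizerCard q : F) ≠ 0 := by
  rw [centralizerCard, Nat.cast_mul, Nat.cast_prod]
  refine mul_ne_zero (symCount_cast_ne_zero F hp fun i => ?_) (Finset.prod_ne_zero_iff.2 ?_)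
  · rw [map_blocksFun, ← h]
    exact hμ i
  · intro j _ h0
    rw [CharP.cast_eq_zero_iff F p] at h0
    exact hq _ (q.blocksFun_mem_blocks j) h0

theorem exists_isPPrimePart {p : ℕ} (hp : p.Prime) (σ : Perm (Fin n)) :
    ∃ s, IsPPrimePart p σ s := by
  obtain ⟨a, m, hm, hσ⟩ := Nat.exists_eq_pow_mul_and_not_dvd (orderOf_pos σ).ne' p hp.ne_one
  have hcop : IsCoprime ((p ^ a : ℕ) : ℤ) (m : ℤ) :=
    Nat.isCoprime_iff_coprime.2 (Nat.Coprime.pow_left a ((hp.coprime_iff_not_dvd).2 hm))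
  obtain ⟨x, y, hxy⟩ := hcop
  have hone : σ ^ (((p ^ a : ℕ) : ℤ) * m) = 1 := by
    rw [← Nat.cast_mul, zpow_natCast, ← hσ, pow_orderOf_eq_one]
  -- By the Bézout relation x p^a + y m = 1 these two powers multiply to σ; the first has order
  -- dividing m, the second order dividing p^a.
  refine ⟨σ ^ (x * (p ^ a : ℕ)), σ ^ (y * m), ?_, ?_, ?_, ?_⟩
  · rw [← zpow_add, add_comm, hxy, zpow_one]
  · rw [← zpow_add, hxy, zpow_one]
  · suffices h : orderOf (σ ^ (y * (m : ℤ))) ∣ p ^ a by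
      obtain ⟨k, -, hk⟩ := (Nat.dvd_prime_pow hp).1 h
      exact ⟨k, hk⟩
    refine orderOf_dvd_of_pow_eq_one ?_
    rw [← zpow_natCast, ← zpow_mul, mul_assoc, mul_comm (m : ℤ), mul_comm, zpow_mul, hone, one_zpow]
  · intro hdvd
    refine hm (hdvd.trans (orderOf_dvd_of_pow_eq_one ?_))
    rw [← zpow_natCast, ← zpow_mul, mul_assoc, mul_comm, zpow_mul, hone, one_zpow]

theorem eq_one_of_commute {p : ℕ} (q : Composition n)
    (hc : ¬ p ∣ centralizerCard q) {σ u : Perm (Fin n)}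
    (h : σ.partition.parts = (q.blocks : Multiset ℕ)) (hu : u * σ = σ * u)
    (hk : ∃ k, orderOf u = p ^ k) : u = 1 := by
  have hcard := Equiv.Perm.nat_card_centralizer σ
  rw [card_centralizer_eq q h] at hcard
  have hmem : u ∈ Subgroup.centralizer {σ} := by
    rw [Subgroup.mem_centralizer_singleton_iff]
    exact hu
  have hdvd : orderOf u ∣ centralizerCard q := by
    rw [← hcard]
    exact Subgroup.orderOf_dvd_natCard _ hmem
  obtain ⟨k, hk⟩ := hk
  rcases k with _ | k
  · rwa [pow_zero, orderOf_eq_one_iff] at hk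
  · exact absurd ((dvd_pow_self p k.succ_ne_zero).trans (hk ▸ hdvd)) hc

/-- As p does not divide the centralizer order, elements of the class are their own p'-parts.
Conversely, if the p'-part of σ lies in the class, the p-part of σ centralizes it, hence is trivial.
-/
theorem pccl_eq_ccl {p : ℕ} (hp : p.Prime) (q : Composition n)
    (hc : ¬ p ∣ centralizerCard q) {μ : n.Partition} (h : μ.parts = (q.blocks : Multiset ℕ)) :
    pccl p μ = ccl μ := by
  have hfix : ∀ σ ∈ ccl μ, ∀ s, IsPPrimePart p σ s → s = σ := by
    rintro σ hσ s ⟨u, h₁, h₂, hk, -⟩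
    have hu : u = 1 := eq_one_of_commute q hc (Eq.trans hσ h)
      (calc u * σ = u * (s * u) := congrArg (u * ·) h₂
        _ = u * s * u := (mul_assoc _ _ _).symm
        _ = σ * u := congrArg (· * u) h₁.symm) hk
    rw [h₁, hu, one_mul]
  ext σ
  constructor
  · rintro ⟨ν, hν, hσ⟩
    obtain ⟨τ, hτ⟩ := ccl_nonempty μ
    obtain ⟨s, hs⟩ := exists_isPPrimePart hp σ
    obtain ⟨t, ht⟩ := exists_isPPrimePart hp τ
    have hconj := hν σ hσ τ hτ s t hs ht
    rw [hfix τ hτ t ht] at hconj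
    have hsμ : s ∈ ccl μ := by
      rw [ccl_eq_isConj hτ]
      exact hconj.symm
    obtain ⟨u, h₁, h₂, hk, -⟩ := hs
    have hu : u = 1 := eq_one_of_commute q hc (Eq.trans hsμ h) (h₁.symm.trans h₂) hk
    rw [h₁, hu, one_mul]
    exact hsμ
  · intro hσ
    refine ⟨μ, fun σ hσ τ hτ s t hs ht => ?_, hσ⟩
    rw [hfix σ hσ s hs, hfix τ hτ t ht]
    rw [ccl_eq_isConj hσ] at hτ
    exact hτ

end Classes

/-! ### Right ideals -/

section RightIdeals

variable {R : Type*} [CommRing R] {n : ℕ}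

/-- Left multiplication as a homomorphism of right modules. -/
noncomputable def leftMul (a : SymAlg R n) : SymAlg R n →ₗ[(SymAlg R n)ᵐᵒᵖ] SymAlg R n where
  toFun x := a * x
  map_add' := mul_add a
  map_smul' b x := (mul_assoc a x b.unop).symm

theorem map_leftMul_rightIdeal (a x : SymAlg R n) :
    (rightIdeal x).map (leftMul a) = rightIdeal (a * x) := by
  rw [rightIdeal, Submodule.map_span, Set.image_singleton]
  rfl

theorem rightIdeal_mul_of_isUnit (x : SymAlg R n) {u : SymAlg R n} (hu : IsUnit u) :
    rightIdeal (x * u) = rightIdeal x := by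
  obtain ⟨u, rfl⟩ := hu
  ext y
  rw [mem_rightIdeal, mem_rightIdeal]
  constructor
  · rintro ⟨a, rfl⟩
    exact ⟨u * a, (mul_assoc _ _ _).symm⟩
  · rintro ⟨a, rfl⟩
    exact ⟨↑u⁻¹ * a, by rw [mul_assoc, Units.mul_inv_cancel_left]⟩

/-- Left multiplication as an isomorphism of right ideals. -/
theorem nonempty_rightIdeal_equiv {a x : SymAlg R n} (h : ∀ b, a * (x * b) = 0 → x * b = 0) :
    Nonempty (rightIdeal x ≃ₗ[(SymAlg R n)ᵐᵒᵖ] rightIdeal (a * x)) := by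
  have hinj : Function.Injective ((leftMul a).domRestrict (rightIdeal x)) := by
    rw [← LinearMap.ker_eq_bot, LinearMap.ker_eq_bot']
    rintro ⟨y, hy⟩ h0
    obtain ⟨b, rfl⟩ := mem_rightIdeal.1 hy
    exact Subtype.ext (h b h0)
  refine ⟨(LinearEquiv.ofInjective _ hinj).trans (LinearEquiv.ofEq _ _ ?_)⟩
  rw [LinearMap.range_domRestrict, map_leftMul_rightIdeal]

theorem projective_rightIdeal {e : SymAlg R n} (he : IsIdempotentElem e) :
    Module.Projective (SymAlg R n)ᵐᵒᵖ (rightIdeal e) := by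
  let φ : (SymAlg R n)ᵐᵒᵖ ≃ₗ[(SymAlg R n)ᵐᵒᵖ] SymAlg R n :=
    { MulOpposite.opAddEquiv.symm with map_smul' := fun _ _ => rfl }
  have : Module.Projective (SymAlg R n)ᵐᵒᵖ (SymAlg R n) := Module.Projective.of_equiv φ
  refine Module.Projective.of_split (rightIdeal e).subtype
    ((leftMul e).codRestrict (rightIdeal e) fun x => mem_rightIdeal.2 ⟨x, rfl⟩) ?_
  refine LinearMap.ext fun y => Subtype.ext ?_
  obtain ⟨b, hb⟩ := mem_rightIdeal.1 y.2
  change e * y.1 = y.1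
  rw [← hb, ← mul_assoc, he.eq]

end RightIdeals

/-! ### Comparison with the modular idempotents -/

section Comparison

variable {F : Type*} [Field F] {p n : ℕ}

theorem partChar_facePower (q : Composition n) {l : n.Partition}
    (hl : l.parts = (q.blocks : Multiset ℕ)) (μ : n.Partition) [Decidable (μ = l)] :
    partChar F μ (facePower F (Fin n) q.blocksFun) =
      if μ = l then (centralizerCard q : F) else 0 := by
  classical
  obtain ⟨k, u, hu, hE, h⟩ := exists_cycle_map_choose μ
  have h₁ := faceChar_facePower (R := F) hu hE q.blocksFun fun j => q.one_le_blocksFun j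
  rw [partChar, h₁, h, map_blocksFun, ← hl]
  simp only [← Nat.Partition.ext_iff]
  rfl

theorem toSym_pow {y : FaceAlg F (Fin n)} (hy : y ∈ faceDescent F (Fin n)) (k : ℕ) :
    toSym F (y ^ k) = toSym F y ^ k := by
  induction k with
  | zero => rw [pow_zero, pow_zero, toSym_one]
  | succ k ih =>
    rw [pow_succ', pow_succ', toSym_map_mul F (faceDescent_le_faceInvariants F _ hy), ih]

/-- Two idempotents of the descent algebra with the same characters are conjugate by a unit. -/
theorem exists_unit_of_partChar_eq (hp : p.Prime) [CharP F p] {y z : FaceAlg F (Fin n)}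
    (hy : y ∈ faceDescent F (Fin n)) (hz : z ∈ faceDescent F (Fin n))
    (hchar : ∀ μ : RegPart p n, partChar F μ.1 y = partChar F μ.1 z)
    (h01 : ∀ μ : RegPart p n, IsIdempotentElem (partChar F μ.1 z))
    (hiy : IsIdempotentElem (toSym F y)) (hiz : IsIdempotentElem (toSym F z)) :
    ∃ u : SymAlg F n, IsUnit u ∧ u * toSym F z = toSym F y * toSym F z ∧
      toSym F y * u = toSym F y * toSym F z := by
  -- Here 1 + x = yz + (1 - y)(1 - z). Where both characters equal a, that of x is 2a² - 2a = 0, so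
  -- x is nilpotent and 1 + x maps to a unit. Idempotency is needed only for the images in the group
  -- algebra.
  set x := 2 * (y * z) - y - z with hx
  have hmem : x ∈ faceDescent F (Fin n) := by
    refine sub_mem (sub_mem ?_ hy) hz
    rw [two_mul]
    exact add_mem (mul_mem hy hz) (mul_mem hy hz)
  have h0 : x ^ p ^ n = 0 := pow_eq_zero_of_partChar hp hmem fun μ => by
    rw [hx, map_sub, map_sub, map_mul, map_mul, hchar, (h01 μ).eq, map_ofNat]
    ring
  have hnil : IsNilpotent (toSym F x) := ⟨p ^ n, by rw [← toSym_pow hmem, h0, map_zero]⟩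
  have hsx : toSym F x = 2 * (toSym F y * toSym F z) - toSym F y - toSym F z := by
    rw [hx, map_sub, map_sub, two_mul, map_add,
      toSym_map_mul F (faceDescent_le_faceInvariants F _ hy), two_mul]
  refine ⟨1 + toSym F x, hnil.isUnit_one_add, ?_, ?_⟩
  · have : (1 + toSym F x) * toSym F z = toSym F z + 2 * (toSym F y * (toSym F z * toSym F z)) -
        toSym F y * toSym F z - toSym F z * toSym F z := by
      rw [hsx]; noncomm_ring
    rw [this, hiz.eq]
    noncomm_ring
  · have : toSym F y * (1 + toSym F x) = toSym F y + 2 * (toSym F y * toSym F y * toSym F z) -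
        toSym F y * toSym F y - toSym F y * toSym F z := by
      rw [hsx]; noncomm_ring
    rw [this, hiy.eq]
    noncomm_ring

/-- Left multiplication by P projects onto the smaller ideal, so its kernel cuts out a complement.
-/
theorem exists_isCompl_rightIdeal {R : Type*} [CommRing R] {x P e : SymAlg R n}
    (h₁ : ∀ a, P * a ∈ rightIdeal (x * e)) (h₂ : P * (x * e) = x * e) :
    ∃ C : Submodule (SymAlg R n)ᵐᵒᵖ (SymAlg R n),
      Disjoint (rightIdeal (x * e)) C ∧ rightIdeal (x * e) ⊔ C = rightIdeal x := by
  have hle : rightIdeal (x * e) ≤ rightIdeal x := fun y hy => by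
    obtain ⟨a, rfl⟩ := mem_rightIdeal.1 hy
    exact mem_rightIdeal.2 ⟨e * a, (mul_assoc _ _ _).symm⟩
  have hfix : ∀ y ∈ rightIdeal (x * e), P * y = y := fun y hy => by
    obtain ⟨a, rfl⟩ := mem_rightIdeal.1 hy
    rw [← mul_assoc, h₂]
  refine ⟨rightIdeal x ⊓ LinearMap.ker (leftMul P), ?_, le_antisymm (sup_le hle inf_le_left) ?_⟩
  · rw [Submodule.disjoint_def]
    rintro y hy ⟨-, hy'⟩
    exact (hfix y hy).symm.trans hy'
  · intro y hy
    have hsplit : y = P * y + (y - P * y) := (add_sub_cancel _ _).symm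
    rw [hsplit]
    refine Submodule.add_mem_sup (h₁ y) ⟨sub_mem hy (hle (h₁ y)), ?_⟩
    change P * (y - P * y) = 0
    rw [mul_sub, hfix _ (h₁ y), sub_self]

end Comparison

end DescentAlg


theorem theoremT {F : Type*} [Field F] {p : ℕ} (hp : p.Prime) [CharP F p] {n m : ℕ}
    (ν : Fin m ≃ RegPart p n)
    (hν : ∀ i j : Fin m, WeakRef (toComp (ν i).1) (toComp (ν j).1) → i ≤ j)
    (q : Composition n) (hq : CoprimeTo p q)
    (l : RegPart p n) (hl : l.1 = Nat.Partition.ofComposition n q) :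
    Nonempty (rightIdeal (Xi F q * modIdem F ν l) ≃ₗ[(SymAlg F n)ᵐᵒᵖ] LieMod F q) ∧
    Nonempty (LieMod F q ≃ₗ[(SymAlg F n)ᵐᵒᵖ] rightIdeal (modIdem F ν l)) ∧
    Module.Projective (SymAlg F n)ᵐᵒᵖ (rightIdeal (Xi F q * modIdem F ν l)) ∧
    rightIdeal (Xi F q * modIdem F ν l) ≤ XMod F q ∧
    (∃ C : Submodule (SymAlg F n)ᵐᵒᵖ (SymAlg F n),
      Disjoint (rightIdeal (Xi F q * modIdem F ν l)) C ∧
      rightIdeal (Xi F q * modIdem F ν l) ⊔ C = XMod F q) ∧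
    Module.finrank F (rightIdeal (Xi F q * modIdem F ν l)) = Nat.card (pccl p l.1) ∧
    Nat.card (pccl p l.1) = Nat.card (ccl l.1) := by
  classical
  have hparts : l.1.parts = (q.blocks : Multiset ℕ) := by rw [hl]; rfl
  have hc : (centralizerCard q : F) ≠ 0 := centralizerCard_cast_ne_zero hp hq hparts l.2
  have hpc : ¬ p ∣ centralizerCard q := fun h => hc ((CharP.cast_eq_zero_iff F p _).2 h)
  obtain ⟨z, hz, hze, hzi, hzc⟩ := exists_lift_modIdem (F := F) hp ν hν l
  generalize modIdem F ν l = e at *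
  set c : F := (centralizerCard q : F) with hcdef
  set y : FaceAlg F (Fin n) := c⁻¹ • facePower F (Fin n) q.blocksFun with hydef
  have hy : y ∈ faceDescent F (Fin n) := Subalgebra.smul_mem _ (facePower_mem F (Fin n) _) _
  have hyE : toSym F y = c⁻¹ • omega F q := by rw [hydef, map_smul, toSym_facePower]
  have hyc : ∀ μ : RegPart p n, partChar F μ.1 y = if μ = l then 1 else 0 := fun μ => by
    rw [hydef, map_smul, partChar_facePower q hparts, smul_eq_mul]
    simp only [Subtype.ext_iff, mul_ite, mul_zero]
    rw [← hcdef, inv_mul_cancel₀ hc]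
  have hiE : IsIdempotentElem (toSym F y) := by
    rw [IsIdempotentElem, hyE, smul_mul_smul_comm, omega_mul_self, smul_smul, mul_assoc,
      inv_mul_cancel₀ hc, mul_one]
  have hie : IsIdempotentElem (toSym F z) := by
    rw [IsIdempotentElem, ← toSym_map_mul F (faceDescent_le_faceInvariants F _ hz), hzi.eq]
  obtain ⟨u, hu, hue, hEu⟩ := exists_unit_of_partChar_eq (F := F) hp hy hz
    (fun μ => (hyc μ).trans (hzc μ).symm) (fun μ => by
      rw [hzc μ, IsIdempotentElem]; split_ifs <;> simp) hiE hie
  rw [hze] at hue hEu hie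
  have hLie : rightIdeal (u * e) = LieMod F q := by
    rw [hue, ← hEu, rightIdeal_mul_of_isUnit _ hu, hyE, LieMod]
    have : c⁻¹ • omega F q = omega F q * algebraMap F _ c⁻¹ := by
      rw [← Algebra.commutes, Algebra.smul_def]
    rw [this, rightIdeal_mul_of_isUnit _ ((IsUnit.mk0 _ (inv_ne_zero hc)).map _)]
  -- Since ω^q Ξ^q = ω_q = cE and Ee = ue, left multiplication by Ξ^q on the ideal of e has a left
  -- inverse up to the unit u and the scalar c.
  have hW : omegaUp F q * (Xi F q * e) = c • (u * e) := by
    rw [← mul_assoc, hue, hyE, smul_mul_assoc, smul_inv_smul₀ hc]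
    rfl
  obtain ⟨φ₁⟩ := nonempty_rightIdeal_equiv (a := u) (x := e) fun b h => hu.mul_right_eq_zero.1 h
  obtain ⟨φ₂⟩ := nonempty_rightIdeal_equiv (a := Xi F q) (x := e) fun b h => by
    have h₁ : c • (u * (e * b)) = 0 := by
      rw [← mul_assoc u, ← smul_mul_assoc, ← hW, mul_assoc, mul_assoc, h, mul_zero]
    exact hu.mul_right_eq_zero.1 ((smul_eq_zero.1 h₁).resolve_left hc)
  rw [hLie] at φ₁
  have hpccl := pccl_eq_ccl hp q hpc hparts
  refine ⟨⟨φ₂.symm.trans φ₁⟩, ⟨φ₁.symm⟩, ?_, ?_, ?_, ?_, by rw [hpccl]⟩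
  · have := projective_rightIdeal hie
    exact Module.Projective.of_equiv φ₂
  · intro x hx
    obtain ⟨a, rfl⟩ := mem_rightIdeal.1 hx
    exact mem_rightIdeal.2 ⟨e * a, (mul_assoc _ _ _).symm⟩
  · obtain ⟨v, rfl⟩ := hu
    refine exists_isCompl_rightIdeal
      -- P undoes Ξ^q on the ideal of e, by way of ω^q, v⁻¹ and c⁻¹, and then applies Ξ^q e again;
      -- hence it fixes Ξ^q e.
      (P := c⁻¹ • (Xi F q * e * ((↑v⁻¹ : SymAlg F n) * omegaUp F q))) (fun a => ?_) ?_
    · rw [← mul_smul_comm, mul_assoc]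
      exact mem_rightIdeal.2 ⟨_, rfl⟩
    · rw [smul_mul_assoc, mul_assoc, mul_assoc (↑v⁻¹ : SymAlg F n), hW, mul_smul_comm,
        mul_smul_comm, inv_smul_smul₀ hc, Units.inv_mul_cancel_left, mul_assoc, hie.eq]
  · rw [hpccl, ((φ₂.symm.trans φ₁).restrictScalars F).finrank_eq]
    have hpos : 0 < centralizerCard q := Nat.pos_of_ne_zero fun h => hpc (h ▸ dvd_zero p)
    exact Nat.eq_of_mul_eq_mul_right hpos
      ((finrank_LieMod q hc).trans (card_ccl_mul q hparts).symm)
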